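/- Let $\mathbb F$ be an algebraically closed field with $\operatorname{char}\mathbb F\neq 2$, and let $G$ be an abelian group with identity $e$. Put $G^\#=G\times\mathbb Z_2$, identify $G$ with $G\times\{\bar 0\}$, and write $|g|\in\mathbb Z_2$ for the second component of $g\in G^\#$. A $G$-graded superalgebra is regarded as a $G^\#$-graded algebra. **The superalgebra.** For integers $m,n\ge 0$ let $M(m,n)$ be the matrix superalgebra $M_{m+n}(\mathbb F)$ with its block $\mathbb Z_2$-grading, and let $M(m,n)^{\mathrm{sop}}$ be the same superspace with product $\bar X\,\bar Y=(-1)^{|X||Y|}\,\overline{YX}$. The algebra $M(m,n)\times M(m,n)^{\mathrm{sop}}$ carries the exchange superinvolution $(X,\bar Y)\mapsto(Y,\bar X)$. A $G$-grading on a superalgebra with superinvolution is a $G$-grading of the algebra by subsuperspaces, preserved by the superinvolution. It makes the superalgebra $R$ graded-simple if $RR\ne0$ and the only $G^\#$-graded ideals are $0$ and $R$. It is called even if $R\cong\operatorname{End}_{\mathcal D}(\mathcal U)$ as a graded superalgebra, where $\mathcal D$ is a $G$-graded-division superalgebra (nonzero, unital, all nonzero $G^\#$-homogeneous elements invertible)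 with $\mathcal D=\mathcal D^{\bar 0}$, and $\mathcal U$ is a graded right $\mathcal D$-module of finite rank. Isomorphisms of graded superalgebras with superinvolution are algebra isomorphisms that preserve $G^\#$-degrees and commute with the superinvolutions. **Standard realizations.** Consider pairs $(T,\beta)$ where $T\subseteq G$ is a finite elementary $2$-subgroup and $\beta:T\times T\to\{\pm1\}$ is an alternating bicharacter ($\beta(t,t)=1$ for all $t$) with radical $\operatorname{rad}\beta=\{e,f\}$, $f\neq e$. For each such pair fix a subgroup $K$ with $T=\langle f\rangle\times K$ and a decomposition $K=A\times B$ such that $\beta$ is trivial on $A\times A$ and on $B\times B$. Let $\mathcal C=\mathbb F\langle f\rangle\cong\mathbb F\times\mathbb F$ with $f=(1,-1)$. On the space with basis $\{e_b\}_{b\in B}$ put $X_a e_{b'}=\beta(a,b')e_{b'}$ for $a\in A$ and $X_be_{b'}=e_{bb'}$ for $b\in B$, and let $\mathcal M=\operatorname{End}(\mathbb F^B)$. Let $\mathcal D=\mathcal C\otimes\mathcal M$, with all elements even, graded so that $c\otimes X_aX_b$ has degree $cab$ ($c\in\langle f\rangle$, $a\in A$, $b\in B$), and let $\varphi_0$ be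 the exchange on $\mathcal C$ tensored with transposition on $\mathcal M$. Then $\mathcal D_t$ is one-dimensional for each $t\in T$, and $\varphi_0$ acts on $\mathcal D_t$ as a scalar $\eta(t)\in\{\pm1\}$. For each $(T,\beta)$ fix also nonzero elements $X_t\in\mathcal D_t$ ($t\in T$), a section $\xi:G/T\to G$ of the natural map, and a total order on $G/T$. **Admissible parameters.** Let $g_0=(h_0,p_0)\in G^\#$. Finitely supported maps $\kappa_{\bar 0},\kappa_{\bar 1}:G/T\to\mathbb Z_{\ge0}$, not both zero, form a $g_0$-admissible pair if (a) $\kappa_i(x)=\kappa_{i+p_0}(h_0^{-1}x^{-1})$ for all $i\in\mathbb Z_2$ and $x\in G/T$; and (b) if $p_0=\bar0$, $h_0g^2\in T$ and $\eta(h_0g^2)=-(-1)^i$, for some $g\in G$ and $i\in\mathbb Z_2$, then $\kappa_i(gT)$ is even. **Models.** Let $(\kappa_{\bar 0},\kappa_{\bar 1})$ be $g_0$-admissible and $k_i=\sum_x\kappa_i(x)$. Take a graded right $\mathcal D$-module $\mathcal U=\mathcal U^{\bar0}\oplus\mathcal U^{\bar1}$ with homogeneous basis $u_1,\dots,u_k$,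 $k=k_{\bar0}+k_{\bar1}$, and a matrix $\Phi\in M_k(\mathcal D)$, as follows. If $p_0=\bar 0$, the basis consists, for each $i$ and $x$, of $\kappa_i(x)$ elements of degree $(\xi(x),i)$. The blocks of $\Phi$ are zero except that, for $h_0xy=T$ and $t=h_0\xi(x)\xi(y)$, the parity-$i$ blocks are as follows. For $x=y$ the block is $I\otimes X_t$ if $(-1)^i\eta(t)=1$, and $\begin{pmatrix}0&I\\-I&0\end{pmatrix}\otimes X_t$ if $(-1)^i\eta(t)=-1$. For $x<y$ the block at the pair $\{x,y\}$ is $\begin{pmatrix}0&I\\(-1)^i\eta(t)I&0\end{pmatrix}\otimes X_t$. If $p_0=\bar1$, the even part of the basis has $\kappa_{\bar0}(x)$ elements of degree $(\xi(x),\bar0)$ for each $x$; the odd part has, for each even basis element of degree $(\xi(x),\bar 0)$, one element of degree $(\xi(x)^{-1}h_0^{-1},\bar1)$; and $\Phi=\begin{pmatrix}0&I\\I&0\end{pmatrix}$. The model $M^{\mathrm{ex}}(T,\beta,\kappa_{\bar0},\kappa_{\bar1},g_0)$ is $\operatorname{End}_{\mathcal D}(\mathcal U)=M_{k_{\bar0}|k_{\bar1}}(\mathcal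 D)$, where a matrix with single nonzero entry $d\in\mathcal D_t$ in position $(p,q)$ has degree $(\deg u_p)\,t\,(\deg u_q)^{-1}$, endowed with the superinvolution $\varphi(X)=\Phi^{-1}\varphi_0(X^{s\top})\Phi$. Here $\varphi_0$ is applied entrywise and $(X^{s\top})_{pq}=(-1)^{(|u_p|+|u_q|)|u_p|}X_{qp}$. **Theorem.** 1. Let $M(m,n)\times M(m,n)^{\mathrm{sop}}$ with the exchange superinvolution be endowed with an even $G$-grading that makes it graded-simple. Then, as a graded superalgebra with superinvolution, it is isomorphic to some model $M^{\mathrm{ex}}(T,\beta,\kappa_{\bar0},\kappa_{\bar1},g_0)$. 2. Two models $M^{\mathrm{ex}}(T,\beta,\kappa_{\bar0},\kappa_{\bar1},g_0)$ and $M^{\mathrm{ex}}(T',\beta',\kappa'_{\bar0},\kappa'_{\bar1},g'_0)$ are isomorphic as graded superalgebras with superinvolution if and only if $T=T'$, $\beta=\beta'$, and there is $g\in G$ such that one of the following holds, where $(g\cdot\kappa)(x)=\kappa(g^{-1}x)$: (i) $\kappa'_{\bar0}=g\cdot\kappa_{\bar0}$, $\kappa'_{\bar1}=g\cdot\kappa_{\bar1}$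 and $g_0'=g^{-2}g_0$; (ii) $\kappa'_{\bar0}=g\cdot\kappa_{\bar1}$, $\kappa'_{\bar1}=g\cdot\kappa_{\bar0}$ and $g_0'=fg^{-2}g_0$. -/

import Mathlib

open scoped TensorProduct

universe u v

/-! ### Graded superalgebras

For a group `G`, the group `G^# = G × ℤ/2` is `GSharp G`.  A `G`-graded superalgebra is the same
thing as a `G^#`-graded algebra, the component of degree `(g, i)` being `R_g ∩ R^i`. -/

/-- The group `G^# = G × ℤ/2`, written multiplicatively. -/
abbrev GSharp (G : Type v) : Type v := G × Multiplicative (ZMod 2)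

/-- The parity of an element of `G^#`. -/
def GSharp.par {G : Type v} (g : GSharp G) : ZMod 2 := Multiplicative.toAdd g.2

/-- The element `(g, i)` of `G^#`. -/
def GSharp.mk {G : Type v} (g : G) (i : ZMod 2) : GSharp G := (g, Multiplicative.ofAdd i)

/-- The scalar `(-1)^i`. -/
def parSign (F : Type u) [Field F] (i : ZMod 2) : F := if i = 0 then 1 else -1

/-- `𝒜` is an `H`-grading on the algebra `R`: `R` is the direct sum of the subspaces `𝒜 h`, and
`𝒜 g * 𝒜 h ⊆ 𝒜 (g * h)`. -/
structure IsAlgGrading {F : Type u} [Field F] {R : Type*} [Ring R] [Algebra F R]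
    {H : Type*} [Group H] (𝒜 : H → Submodule F R) : Prop where
  indep : iSupIndep 𝒜
  iSup_eq : ⨆ h, 𝒜 h = ⊤
  mul_mem : ∀ g h : H, ∀ a ∈ 𝒜 g, ∀ b ∈ 𝒜 h, a * b ∈ 𝒜 (g * h)

/-- The `G^#`-grading attached to a `G`-grading `Γ` and a parity decomposition `par`. -/
def sharpGrading {F : Type u} [Field F] {R : Type*} [Ring R] [Algebra F R] {G : Type v}
    (par : ZMod 2 → Submodule F R) (Γ : G → Submodule F R) (g : GSharp G) : Submodule F R :=
  Γ g.1 ⊓ par g.par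

/-- `Γ` is a `G`-grading on the superalgebra with superinvolution `(R, φ)`, where
`R = par 0 ⊕ par 1`: it is an algebra grading, every component is a subsuperspace, and `φ`
preserves degrees. -/
structure IsSuperinvGrading {F : Type u} [Field F] {R : Type*} [Ring R] [Algebra F R]
    {G : Type v} [Group G] (par : ZMod 2 → Submodule F R) (φ : R → R)
    (Γ : G → Submodule F R) : Prop where
  grading : IsAlgGrading Γ
  superspace : ∀ g, Γ g = (Γ g ⊓ par 0) ⊔ (Γ g ⊓ par 1)
  map_mem : ∀ g, ∀ a ∈ Γ g, φ a ∈ Γ g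

/-- Graded-simplicity: the product is not identically zero, and the only two-sided ideals that are
graded subspaces are `0` and `R`. -/
def IsGradedSimple {F : Type u} [Field F] {R : Type*} [Ring R] [Algebra F R]
    {H : Type*} (𝒜 : H → Submodule F R) : Prop :=
  (∃ a b : R, a * b ≠ 0) ∧
    ∀ J : Submodule F R, (∀ r : R, ∀ a ∈ J, r * a ∈ J ∧ a * r ∈ J) →
      J = ⨆ h, J ⊓ 𝒜 h → J = ⊥ ∨ J = ⊤

/-- A graded-division algebra: a nonzero unital graded algebra in which every nonzero homogeneous
element is invertible. -/
structure IsGradedDivision {F : Type u} [Field F] {D : Type*} [Ring D] [Algebra F D]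
    {H : Type*} [Group H] (𝒟 : H → Submodule F D) : Prop where
  grading : IsAlgGrading 𝒟
  nontrivial : Nontrivial D
  isUnit : ∀ h, ∀ d ∈ 𝒟 h, d ≠ 0 → IsUnit d

/-- The grading on `End_D(U) = M_ι(D)`, where `U` is the graded right `D`-module with graded basis
indexed by `ι` and basis elements of degrees `γ i`: the matrix with the single nonzero entry `d`
in position `(i, j)` has degree `γ i * deg d * (γ j)⁻¹`. -/
def endGrading {F : Type u} [Field F] {D : Type*} [Ring D] [Algebra F D] {H : Type*} [Group H]
    {ι : Type*} (𝒟 : H → Submodule F D) (γ : ι → H) (h : H) :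
    Submodule F (Matrix ι ι D) where
  carrier := {X | ∀ i j, X i j ∈ 𝒟 ((γ i)⁻¹ * h * γ j)}
  zero_mem' := fun _ _ => Submodule.zero_mem _
  add_mem' := fun hX hY i j => Submodule.add_mem _ (hX i j) (hY i j)
  smul_mem' := fun c _ hX i j => Submodule.smul_mem _ c (hX i j)

/-- The `G`-grading underlying the `G^#`-grading `𝒜` is even: `R ≅ End_D(U)` as graded
superalgebras for an even graded-division superalgebra `D` (that is, `D = D^0`) and a graded right
`D`-module `U` of finite rank. -/
def IsEvenGrading {F : Type u} [Field F] {R : Type u} [Ring R] [Algebra F R] {G : Type v}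
    [CommGroup G] (𝒜 : GSharp G → Submodule F R) : Prop :=
  ∃ (D : Type u) (_ : Ring D) (_ : Algebra F D) (𝒟 : GSharp G → Submodule F D)
    (k : ℕ) (γ : Fin k → GSharp G) (ψ : R ≃ₐ[F] Matrix (Fin k) (Fin k) D),
    IsGradedDivision 𝒟 ∧ (∀ g : GSharp G, g.par ≠ 0 → 𝒟 g = ⊥) ∧
      ∀ g, ∀ r ∈ 𝒜 g, ψ r ∈ endGrading 𝒟 γ g

/-- Isomorphism of graded superalgebras with superinvolution, as `G^#`-graded algebras. -/
def GradedSuperinvIso {F : Type u} [Field F] {H : Type*}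
    {R : Type*} [Ring R] [Algebra F R] (𝒜 : H → Submodule F R) (φ : R → R)
    {R' : Type*} [Ring R'] [Algebra F R'] (𝒜' : H → Submodule F R') (φ' : R' → R') : Prop :=
  ∃ ψ : R ≃ₐ[F] R', (∀ h, (𝒜 h).map (ψ : R →ₗ[F] R') = 𝒜' h) ∧ ∀ r, ψ (φ r) = φ' (ψ r)

/-! ### The superalgebra `M(m,n) × M(m,n)^sop` with exchange superinvolution -/

/-- Parity of the basis vectors of `F^{m|n}`. -/
def blockPar (m n : ℕ) : Fin m ⊕ Fin n → ZMod 2 := Sum.elim (fun _ => 0) (fun _ => 1)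

/-- The underlying algebra of `M(m,n)`. -/
abbrev SuperMat (F : Type u) (m n : ℕ) : Type u := Matrix (Fin m ⊕ Fin n) (Fin m ⊕ Fin n) F

/-- The component of parity `i` of `M(m,n)`. -/
def SuperMat.parity (F : Type u) [Field F] (m n : ℕ) (i : ZMod 2) :
    Submodule F (SuperMat F m n) where
  carrier := {X | ∀ a b, blockPar m n a + blockPar m n b ≠ i → X a b = 0}
  zero_mem' := fun _ _ _ => rfl
  add_mem' := fun {X Y} hX hY a b h => by simp [hX a b h, hY a b h]
  smul_mem' := fun c X hX a b h => by simp [hX a b h]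

/-- The superopposite `M(m,n)^sop`: the superspace `M(m,n)` with product
`X̄ Ȳ = (-1)^{|X||Y|} (Y X)‾` for homogeneous `X`, `Y`. -/
def SuperMatOp (F : Type u) (m n : ℕ) : Type u := SuperMat F m n

/-- The element `X̄` of `M(m,n)^sop`. -/
def SuperMatOp.of {F : Type u} {m n : ℕ} (X : SuperMat F m n) : SuperMatOp F m n := X

/-- The element `X` of `M(m,n)` underlying `X̄`. -/
def SuperMatOp.val {F : Type u} {m n : ℕ} (X : SuperMatOp F m n) : SuperMat F m n := X

theorem SuperMatOp.ext' {F : Type u} {m n : ℕ} {X Y : SuperMatOp F m n}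
    (h : ∀ a b, X.val a b = Y.val a b) : X = Y :=
  Matrix.ext h

namespace SuperMatOp

variable {F : Type u} [Field F] {m n : ℕ}

noncomputable instance : AddCommGroup (SuperMatOp F m n) :=
  inferInstanceAs (AddCommGroup (SuperMat F m n))

noncomputable instance : Module F (SuperMatOp F m n) :=
  inferInstanceAs (Module F (SuperMat F m n))

/-- Bilinear extension of the sign rule: the entry `Y a k` sits in parity `|a| + |k|`, the entry
`X k b` in parity `|k| + |b|`. -/
noncomputable instance : Mul (SuperMatOp F m n) where
  mul X Y := of fun a b => ∑ k,
    parSign F ((blockPar m n a + blockPar m n k) * (blockPar m n k + blockPar m n b)) *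
      (Y.val a k * X.val k b)

noncomputable instance : One (SuperMatOp F m n) where
  one := of 1

theorem mul_val (X Y : SuperMatOp F m n) (a b : Fin m ⊕ Fin n) :
    (X * Y).val a b = ∑ k,
      parSign F ((blockPar m n a + blockPar m n k) * (blockPar m n k + blockPar m n b)) *
        (Y.val a k * X.val k b) := rfl

theorem add_val (X Y : SuperMatOp F m n) (a b : Fin m ⊕ Fin n) :
    (X + Y).val a b = X.val a b + Y.val a b := rfl

theorem smul_val (c : F) (X : SuperMatOp F m n) (a b : Fin m ⊕ Fin n) :
    (c • X).val a b = c * X.val a b := rfl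

theorem zero_val (a b : Fin m ⊕ Fin n) : (0 : SuperMatOp F m n).val a b = 0 := rfl

theorem one_val (a b : Fin m ⊕ Fin n) :
    (1 : SuperMatOp F m n).val a b = if a = b then 1 else 0 := Matrix.one_apply

theorem parSign_mul_parSign (x y z w : ZMod 2) :
    parSign F ((x + y) * (y + w)) * parSign F ((y + z) * (z + w)) =
      parSign F ((x + z) * (z + w)) * parSign F ((x + y) * (y + z)) := by
  have key : ∀ x y z w : ZMod 2,
      ((x + y) * (y + w) = 0 ∧ (y + z) * (z + w) = 0 ∨
        (x + y) * (y + w) ≠ 0 ∧ (y + z) * (z + w) ≠ 0) ↔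
      ((x + z) * (z + w) = 0 ∧ (x + y) * (y + z) = 0 ∨
        (x + z) * (z + w) ≠ 0 ∧ (x + y) * (y + z) ≠ 0) := by decide
  have k := key x y z w
  unfold parSign
  split_ifs <;> simp_all

noncomputable instance : Ring (SuperMatOp F m n) :=
  { (inferInstance : AddCommGroup (SuperMatOp F m n)) with
    mul := (· * ·)
    one := 1
    left_distrib := fun X Y Z => ext' fun a b => by
      simp only [mul_val, add_val, ← Finset.sum_add_distrib]
      exact Finset.sum_congr rfl fun k _ => by ring
    right_distrib := fun X Y Z => ext' fun a b => by
      simp only [mul_val, add_val, ← Finset.sum_add_distrib]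
      exact Finset.sum_congr rfl fun k _ => by ring
    zero_mul := fun X => ext' fun a b => by simp [mul_val, zero_val]
    mul_zero := fun X => ext' fun a b => by simp [mul_val, zero_val]
    mul_assoc := fun X Y Z => ext' fun a b => by
      simp only [mul_val, Finset.mul_sum, Finset.sum_mul]
      rw [Finset.sum_comm]
      refine Finset.sum_congr rfl fun k _ => Finset.sum_congr rfl fun l _ => ?_
      linear_combination (Z.val a l * Y.val l k * X.val k b) *
        parSign_mul_parSign (F := F) (blockPar m n a) (blockPar m n l) (blockPar m n k)
          (blockPar m n b)
    one_mul := fun X => ext' fun a b => by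
      have h2 : ∀ x : ZMod 2, x + x = 0 := by decide
      simp [mul_val, one_val, h2, parSign]
    mul_one := fun X => ext' fun a b => by
      have h2 : ∀ x : ZMod 2, x + x = 0 := by decide
      simp [mul_val, one_val, h2, parSign] }

noncomputable instance : Algebra F (SuperMatOp F m n) :=
  Algebra.ofModule
    (fun c X Y => ext' fun a b => by
      simp only [mul_val, smul_val, Finset.mul_sum]
      exact Finset.sum_congr rfl fun k _ => by ring)
    (fun c X Y => ext' fun a b => by
      simp only [mul_val, smul_val, Finset.mul_sum]
      exact Finset.sum_congr rfl fun k _ => by ring)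

/-- The component of parity `i` of `M(m,n)^sop`. -/
noncomputable def parity (F : Type u) [Field F] (m n : ℕ) (i : ZMod 2) : Submodule F (SuperMatOp F m n) where
  carrier := {X | X.val ∈ SuperMat.parity F m n i}
  zero_mem' := (SuperMat.parity F m n i).zero_mem
  add_mem' := fun hX hY => (SuperMat.parity F m n i).add_mem hX hY
  smul_mem' := fun c _ hX => (SuperMat.parity F m n i).smul_mem c hX

end SuperMatOp

/-- The algebra `M(m,n) × M(m,n)^sop`. -/
abbrev MxMsop (F : Type u) (m n : ℕ) : Type u := SuperMat F m n × SuperMatOp F m n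

/-- The component of parity `i` of `M(m,n) × M(m,n)^sop`. -/
noncomputable def MxMsop.parity (F : Type u) [Field F] (m n : ℕ) (i : ZMod 2) : Submodule F (MxMsop F m n) :=
  (SuperMat.parity F m n i).prod (SuperMatOp.parity F m n i)

/-- The exchange superinvolution `(X, Ȳ) ↦ (Y, X̄)`. -/
def MxMsop.exchange (F : Type u) (m n : ℕ) (X : MxMsop F m n) : MxMsop F m n :=
  (X.2.val, SuperMatOp.of X.1)

/-! ### Standard realizations of even type `M × M^sop` -/

/-- A finite elementary `2`-subgroup `T` of `G` together with an alternating bicharacter `β` on `T`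
whose radical is `{e, f}` with `f ≠ e`.  (As `T` is an elementary `2`-group, `β` takes values
`±1`; the element `f` is determined by `T` and `β`.) -/
structure ExPair (F : Type u) [Field F] (G : Type v) [CommGroup G] where
  T : Subgroup G
  finite_T : Finite T
  sq_eq_one : ∀ t : T, t * t = 1
  β : T →* T →* Fˣ
  alternating : ∀ t, β t t = 1
  f : T
  f_ne_one : f ≠ 1
  mem_rad : ∀ t, (∀ s, β t s = 1) ↔ t = 1 ∨ t = f

/-- The choices behind a standard realization: a complement `K` of the radical `⟨f⟩` in `T`, and a
decomposition `K = A × B` with `β` trivial on `A` and on `B`. -/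
structure StdRealization {F : Type u} [Field F] {G : Type v} [CommGroup G] (P : ExPair F G) where
  K : Subgroup P.T
  isCompl_K : IsCompl (Subgroup.zpowers P.f) K
  A : Subgroup P.T
  B : Subgroup P.T
  sup_eq : A ⊔ B = K
  disjoint : Disjoint A B
  isotropic_A : ∀ a ∈ A, ∀ a' ∈ A, P.β a a' = 1
  isotropic_B : ∀ b ∈ B, ∀ b' ∈ B, P.β b b' = 1

namespace StdRealization

variable {F : Type u} [Field F] {G : Type v} [CommGroup G] {P : ExPair F G}

noncomputable instance (S : StdRealization P) : Fintype S.B :=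
  haveI := P.finite_T
  Fintype.ofFinite _

noncomputable instance (S : StdRealization P) : DecidableEq S.B := Classical.decEq _

/-- The algebra `𝒟 = 𝒞 ⊗ ℳ`, where `𝒞 = F × F` is the group algebra of `⟨f⟩`
(with `f = (1, -1)`), and `ℳ = End(V)`, written in the basis `{e_b}_{b ∈ B}` of `V`. -/
abbrev Alg (S : StdRealization P) : Type (max u v) := (F × F) ⊗[F] Matrix S.B S.B F

open Classical in
/-- The element of `𝒞 = F × F` corresponding to `c ∈ ⟨f⟩`. -/
noncomputable def zeta (P : ExPair F G) (c : P.T) : F × F := if c = 1 then (1, 1) else (1, -1)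

/-- `X_a (e_b) = β(a, b) e_b` for `a ∈ A`. -/
noncomputable def Xa (S : StdRealization P) (a : P.T) : Matrix S.B S.B F :=
  Matrix.diagonal fun b => (P.β a b : F)

open Classical in
/-- `X_b (e_{b'}) = e_{b b'}` for `b ∈ B`. -/
noncomputable def Xb (S : StdRealization P) (b : P.T) : Matrix S.B S.B F :=
  Matrix.of fun r s => if (r : P.T) = b * s then 1 else 0

/-- The component `𝒟_t`: it is spanned by `c ⊗ X_a X_b`, where `t = c a b` with `c ∈ ⟨f⟩`,
`a ∈ A`, `b ∈ B`. -/
noncomputable def comp (S : StdRealization P) (t : P.T) : Submodule F S.Alg :=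
  Submodule.span F {d | ∃ c ∈ Subgroup.zpowers P.f, ∃ a ∈ S.A, ∃ b ∈ S.B,
    c * a * b = t ∧ d = zeta P c ⊗ₜ[F] (S.Xa a * S.Xb b)}

/-- The `G^#`-grading on `𝒟`; the support is `T ⊆ G = G × {0}`. -/
noncomputable def grading (S : StdRealization P) (g : GSharp G) : Submodule F S.Alg :=
  ⨆ (t : P.T) (_ : GSharp.mk (t : G) 0 = g), S.comp t

/-- The superinvolution `φ₀` on `𝒟`: exchange on `𝒞` tensor transposition on `ℳ`. -/
noncomputable def phi0 (S : StdRealization P) : S.Alg →ₗ[F] S.Alg :=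
  TensorProduct.map (LinearEquiv.prodComm F F F).toLinearMap
    (Matrix.transposeLinearEquiv S.B S.B F F).toLinearMap

/-- The map `η : T → {±1}` corresponding to `φ₀`: `φ₀(d) = η(t) d` for all `d ∈ 𝒟_t`. -/
noncomputable def eta (S : StdRealization P) (t : P.T) : F :=
  Classical.epsilon fun s : F => ∀ d ∈ S.comp t, S.phi0 d = s • d

end StdRealization

/-- All the choices that the model depends on besides its parameters: a standard realization,
nonzero elements `X_t ∈ 𝒟_t`, a section `ξ : G/T → G`, and an ordering of `G/T` (which tells the two
members of a pair `{x, y}` of distinct paired cosets apart). -/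
structure ExChoices {F : Type u} [Field F] {G : Type v} [CommGroup G] (P : ExPair F G) extends
    StdRealization P where
  X : P.T → toStdRealization.Alg
  X_mem : ∀ t, X t ∈ toStdRealization.comp t
  X_ne_zero : ∀ t, X t ≠ 0
  ξ : G ⧸ P.T → G
  ξ_spec : ∀ x, (QuotientGroup.mk (ξ x) : G ⧸ P.T) = x
  order : LinearOrder (G ⧸ P.T)

/-! ### The models `M^ex(T, β, κ₀, κ₁, g₀)` -/

namespace ExChoices

variable {F : Type u} [Field F] {G : Type v} [CommGroup G] {P : ExPair F G}

/-- `(κ₀, κ₁)` is `g₀`-admissible, where `g₀ = (h₀, p₀)`: `κ_i(x) = κ_{i+p₀}(h₀⁻¹ x⁻¹)`; if `p₀ = 0`,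
`h₀ x² = T` and `η(h₀ g²) = -(-1)^i` with `x = gT`, then `κ_i(x)` is even; and `κ₀, κ₁` are not both
zero, so that the corresponding module is nonzero. -/
structure IsAdmissible (C : ExChoices P) (κ : ZMod 2 → (G ⧸ P.T →₀ ℕ)) (g₀ : GSharp G) : Prop where
  dual : ∀ i x, κ i x = κ (i + g₀.par) ((QuotientGroup.mk g₀.1 : G ⧸ P.T)⁻¹ * x⁻¹)
  even : g₀.par = 0 → ∀ (i : ZMod 2) (g : G) (h : g₀.1 * g ^ 2 ∈ P.T),
    C.eta ⟨g₀.1 * g ^ 2, h⟩ = -parSign F i → Even (κ i (QuotientGroup.mk g))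
  ne_zero : κ 0 ≠ 0 ∨ κ 1 ≠ 0

/-- Index set of a basis of `⨁_{x ∈ supp μ} (D^{μ(x)})^{[ξ(x)]}`. -/
abbrev Idx (μ : G ⧸ P.T →₀ ℕ) : Type v := Σ x : μ.support, Fin (μ x)

/-- Multiplicities indexing the odd part of the basis: `κ₁` if `g₀` is even; if `g₀` is odd, the odd
part is built as the shifted dual of the even part. -/
noncomputable def oddMult (κ : ZMod 2 → (G ⧸ P.T →₀ ℕ)) (g₀ : GSharp G) : G ⧸ P.T →₀ ℕ :=
  if g₀.par = 0 then κ 1 else κ 0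

/-- Index set of the graded basis of `U = U^0 ⊕ U^1`. -/
abbrev ModelIdx (κ : ZMod 2 → (G ⧸ P.T →₀ ℕ)) (g₀ : GSharp G) : Type v :=
  Idx (κ 0) ⊕ Idx (oddMult κ g₀)

noncomputable instance (κ : ZMod 2 → (G ⧸ P.T →₀ ℕ)) (g₀ : GSharp G) :
    DecidableEq (ModelIdx κ g₀) := Classical.decEq _

/-- Degrees of the basis elements: `(ξ(x), 0)` in the even part; in the odd part `(ξ(x), 1)` if `g₀`
is even, and `(ξ(x)⁻¹ h₀⁻¹, 1)` if `g₀ = (h₀, 1)`. -/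
noncomputable def deg (C : ExChoices P) (κ : ZMod 2 → (G ⧸ P.T →₀ ℕ)) (g₀ : GSharp G) :
    ModelIdx κ g₀ → GSharp G
  | Sum.inl a => GSharp.mk (C.ξ a.1) 0
  | Sum.inr a => if g₀.par = 0 then GSharp.mk (C.ξ a.1) 1 else GSharp.mk ((C.ξ a.1)⁻¹ * g₀.1⁻¹) 1

open Classical in
/-- For even `g₀ = (h₀, 0)`: the entry of the parity `i` part of `Φ` at the `j`-th basis element of
the coset `x` and the `j'`-th basis element of the coset `y` (`j`, `j'` counted from `0`), where `k`
is the multiplicity of `x`.  With `t = h₀ ξ(x) ξ(y)`, the blocks are `I ⊗ X_t` or `J ⊗ X_t` for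
`x = y`, according as `(-1)^i η(t)` is `1` or `-1`, and `[[0, I], [(-1)^i η(t) I, 0]] ⊗ X_t` for
`x ≠ y`. -/
noncomputable def evenEntry (C : ExChoices P) (h₀ : G) (i : ZMod 2) (x y : G ⧸ P.T)
    (k j j' : ℕ) : C.Alg :=
  if ht : h₀ * C.ξ x * C.ξ y ∈ P.T then
    if x = y then
      if parSign F i * C.eta ⟨_, ht⟩ = 1 then
        if j = j' then C.X ⟨_, ht⟩ else 0
      else
        if j + k / 2 = j' then C.X ⟨_, ht⟩
        else if j' + k / 2 = j then -C.X ⟨_, ht⟩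
        else 0
    else
      if j = j' then
        if C.order.lt x y then C.X ⟨_, ht⟩ else (parSign F i * C.eta ⟨_, ht⟩) • C.X ⟨_, ht⟩
      else 0
  else 0

open Classical in
/-- The matrix `Φ` of the super-Hermitian form `B` of degree `g₀` in the chosen graded basis.  If
`g₀` is odd, it is `[[0, I], [I, 0]]`. -/
noncomputable def Phi (C : ExChoices P) (κ : ZMod 2 → (G ⧸ P.T →₀ ℕ)) (g₀ : GSharp G) :
    Matrix (ModelIdx κ g₀) (ModelIdx κ g₀) C.Alg :=
  Matrix.of fun p q => match p, q with
    | Sum.inl a, Sum.inl b =>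
        if g₀.par = 0 then C.evenEntry g₀.1 0 a.1 b.1 (κ 0 a.1) a.2 b.2 else 0
    | Sum.inr a, Sum.inr b =>
        if g₀.par = 0 then C.evenEntry g₀.1 1 a.1 b.1 (oddMult κ g₀ a.1) a.2 b.2 else 0
    | Sum.inl a, Sum.inr b =>
        if g₀.par = 0 then 0
        else if (a.1 : G ⧸ P.T) = b.1 ∧ (a.2 : ℕ) = b.2 then 1 else 0
    | Sum.inr a, Sum.inl b =>
        if g₀.par = 0 then 0
        else if (a.1 : G ⧸ P.T) = b.1 ∧ (a.2 : ℕ) = b.2 then 1 else 0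

/-- The underlying algebra `End_D(U) = M_{k₀|k₁}(D)` of `M^ex(T, β, κ₀, κ₁, g₀)`. -/
abbrev Model (C : ExChoices P) (κ : ZMod 2 → (G ⧸ P.T →₀ ℕ)) (g₀ : GSharp G) : Type (max u v) :=
  Matrix (ModelIdx κ g₀) (ModelIdx κ g₀) C.Alg

/-- The `G^#`-grading of `M^ex(T, β, κ₀, κ₁, g₀)`. -/
noncomputable def modelGrading (C : ExChoices P) (κ : ZMod 2 → (G ⧸ P.T →₀ ℕ)) (g₀ : GSharp G) :
    GSharp G → Submodule F (C.Model κ g₀) :=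
  endGrading C.grading (C.deg κ g₀)

/-- Supertranspose: the `(p, q)` entry is `(-1)^{(|p|+|q|)|p|}` times the `(q, p)` entry. -/
noncomputable def superTranspose (C : ExChoices P) (κ : ZMod 2 → (G ⧸ P.T →₀ ℕ)) (g₀ : GSharp G)
    (Y : C.Model κ g₀) : C.Model κ g₀ :=
  Matrix.of fun p q =>
    parSign F (((C.deg κ g₀ p).par + (C.deg κ g₀ q).par) * (C.deg κ g₀ p).par) • Y q p

/-- The superinvolution of `M^ex(T, β, κ₀, κ₁, g₀)`: the superadjunction with respect to `B`, which
is `Y ↦ Φ⁻¹ φ₀(Yˢᵀ) Φ` in matrix terms. -/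
noncomputable def modelInv (C : ExChoices P) (κ : ZMod 2 → (G ⧸ P.T →₀ ℕ)) (g₀ : GSharp G)
    (Y : C.Model κ g₀) : C.Model κ g₀ :=
  Ring.inverse (C.Phi κ g₀) * (C.superTranspose κ g₀ Y).map C.phi0 * C.Phi κ g₀

end ExChoices

/-! ### Generalities on gradings -/

/-! Gradings are classified through pairs consisting of a graded-division algebra and a
super-Hermitian form over it.

Existence. Write `R = M_k(D)` with `D` even; since `F` is algebraically closed, the identity
component of `D` is `F`. The supertranspose with values in `Dᵐᵒᵖ` absorbs the signs of a
superinvolution `φ`, so `φ` becomes a graded isomorphism between matrix algebras over `D` and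
`Dᵐᵒᵖ`. Such isomorphisms are semilinear changes of basis (`exists_semilinear_of_gradedIso`), so `φ`
is the adjunction of a form `Φ` over an antiautomorphism `φ₀` of `D`; from `φ² = 1` it follows that
`φ₀` is an involution and `Φ` is Hermitian up to a sign (`IsSuperinvolution.exists_form`).

The exchange enters through the centre, `F × F` with its factors swapped: the centre of `D` is
spanned by `1` and a homogeneous element of some degree `f ≠ e`, which `φ₀` negates. As `φ₀` acts by
`±1` on the one-dimensional components, the commutation factor `β` has values `±1`, its radical is
`{e, f}`, and the support `T` is an elementary 2-group (`IsGradedDivision.exists_exPair`). A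
character of a commutative twisted group algebra then identifies `D` with the standard realization
(`StdRealization.exists_gradedEquiv`). The involution `φ₀` and the standard one differ by a
character `β(u, ·)`, so rescaling `Φ` makes it Hermitian for the standard involution, and the choice
between `u` and `uf` removes the sign (`StdRealization.exists_isSuperHermitian`).

Two forms `A`, `B` of the same degree on the same graded module are congruent: `B⁻¹A` has a square
root that is a polynomial in it, hence self-adjoint for `B` (`exists_star_conj_eq`). Only the degree
`g₀` and the multiplicities `κ` of the basis degrees remain. Nondegeneracy forces the duality of
`κ`, invertible skew-symmetric blocks force the evenness condition, and the explicit matrices `Phi`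
realize every admissible pair.

Isomorphism. A graded isomorphism preserves `T` and `β`, being the support and commutation factor of
`D`, and shifts the basis degrees by some `(g, ε)`. The form is determined by its adjunction up to a
central symmetric homogeneous factor, and such factors are scalars because degree `f` is skew; so
the shift determines the new `g₀` (`IsSuperHermitian.degree_eq`). A parity shift multiplies the form
by the skew central element of degree `f`, which is the source of the `f` in case (ii). -/

theorem IsAlgGrading.mem_congr {F : Type u} [Field F] {R : Type*} [Ring R] [Algebra F R]
    {H : Type*} {𝒜 : H → Submodule F R} {g h : H} {r : R} (hr : r ∈ 𝒜 g) (e : g = h) :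
    r ∈ 𝒜 h := e ▸ hr

section Grading

variable {F : Type u} [Field F] {R : Type*} [Ring R] [Algebra F R]
  {H : Type*} [Group H] {𝒜 : H → Submodule F R}

namespace IsAlgGrading

theorem induction (h𝒜 : IsAlgGrading 𝒜) {p : R → Prop} (zero : p 0)
    (mem : ∀ g, ∀ r ∈ 𝒜 g, p r) (add : ∀ x y, p x → p y → p (x + y)) (r : R) : p r :=
  Submodule.iSup_induction 𝒜 (motive := p) (h𝒜.iSup_eq ▸ Submodule.mem_top : r ∈ ⨆ g, 𝒜 g)
    mem zero add

/-- Later arguments compare components by means of these projections inside `R` and never return to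
`DirectSum`. -/
theorem exists_proj (h𝒜 : IsAlgGrading 𝒜) : ∃ π : H → R →ₗ[F] R,
    (∀ g r, π g r ∈ 𝒜 g) ∧ (∀ g, ∀ r ∈ 𝒜 g, π g r = r) ∧
    (∀ g k, g ≠ k → ∀ r ∈ 𝒜 k, π g r = 0) ∧ ∀ r, ∃ s : Finset H, r = ∑ g ∈ s, π g r := by
  classical
  have hint : DirectSum.IsInternal 𝒜 :=
    DirectSum.isInternal_submodule_of_iSupIndep_of_iSup_eq_top h𝒜.indep h𝒜.iSup_eq
  let _ := hint.chooseDecomposition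
  refine ⟨fun g => (𝒜 g).subtype ∘ₗ DirectSum.component F H (fun i => 𝒜 i) g ∘ₗ
    (DirectSum.decomposeLinearEquiv 𝒜).toLinearMap, fun g r => ?_, fun g r hr => ?_,
    fun g k hgk r hr => ?_, fun r => ?_⟩
  · exact Submodule.coe_mem _
  · exact DirectSum.decompose_of_mem_same 𝒜 hr
  · exact DirectSum.decompose_of_mem_ne 𝒜 hr hgk.symm
  · exact ⟨_, (DirectSum.sum_support_decompose 𝒜 r).symm⟩

/-- The projection onto a homogeneous component. -/
noncomputable def proj (h𝒜 : IsAlgGrading 𝒜) : H → R →ₗ[F] R := h𝒜.exists_proj.choose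

theorem proj_mem (h𝒜 : IsAlgGrading 𝒜) (g : H) (r : R) : h𝒜.proj g r ∈ 𝒜 g :=
  h𝒜.exists_proj.choose_spec.1 g r

theorem proj_same (h𝒜 : IsAlgGrading 𝒜) {g : H} {r : R} (hr : r ∈ 𝒜 g) : h𝒜.proj g r = r :=
  h𝒜.exists_proj.choose_spec.2.1 g r hr

theorem proj_ne (h𝒜 : IsAlgGrading 𝒜) {g k : H} (hgk : g ≠ k) {r : R} (hr : r ∈ 𝒜 k) :
    h𝒜.proj g r = 0 :=
  h𝒜.exists_proj.choose_spec.2.2.1 g k hgk r hr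

theorem exists_sum_proj (h𝒜 : IsAlgGrading 𝒜) (r : R) :
    ∃ s : Finset H, r = ∑ g ∈ s, h𝒜.proj g r :=
  h𝒜.exists_proj.choose_spec.2.2.2 r

theorem eq_of_mem (h𝒜 : IsAlgGrading 𝒜) {g k : H} {r : R} (hr : r ∈ 𝒜 g) (hr' : r ∈ 𝒜 k)
    (h0 : r ≠ 0) : g = k := by
  by_contra hgk
  exact h0 ((h𝒜.proj_same hr).symm.trans (h𝒜.proj_ne hgk hr'))

theorem proj_mul (h𝒜 : IsAlgGrading 𝒜) (g : H) {k : H} (x : R) {y : R} (hy : y ∈ 𝒜 k) :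
    h𝒜.proj g x * y = h𝒜.proj (g * k) (x * y) := by
  induction x using h𝒜.induction with
  | zero => simp
  | mem a x hx =>
    by_cases hag : g = a
    · subst hag
      rw [h𝒜.proj_same hx, h𝒜.proj_same (h𝒜.mul_mem _ _ _ hx _ hy)]
    · rw [h𝒜.proj_ne hag hx, h𝒜.proj_ne (fun h => hag (mul_right_cancel h))
        (h𝒜.mul_mem _ _ _ hx _ hy), zero_mul]
  | add x y hx hy => simp [add_mul, hx, hy]

theorem mul_proj (h𝒜 : IsAlgGrading 𝒜) (g : H) {k : H} (x : R) {y : R} (hy : y ∈ 𝒜 k) :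
    y * h𝒜.proj g x = h𝒜.proj (k * g) (y * x) := by
  induction x using h𝒜.induction with
  | zero => simp
  | mem a x hx =>
    by_cases hag : g = a
    · subst hag
      rw [h𝒜.proj_same hx, h𝒜.proj_same (h𝒜.mul_mem _ _ _ hy _ hx)]
    · rw [h𝒜.proj_ne hag hx, h𝒜.proj_ne (fun h => hag (mul_left_cancel h))
        (h𝒜.mul_mem _ _ _ hy _ hx), mul_zero]
  | add x y hx hy => simp [mul_add, hx, hy]

/-- The grading axioms do not place `1` in a component. Its component of degree `1` is a right
identity on homogeneous elements, hence on everything, and so equals `1`. -/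
theorem one_mem (h𝒜 : IsAlgGrading 𝒜) : (1 : R) ∈ 𝒜 1 := by
  have key : ∀ r : R, r * h𝒜.proj 1 1 = r := fun r => by
    induction r using h𝒜.induction with
    | zero => simp
    | mem a x hx => rw [h𝒜.mul_proj _ _ hx, mul_one, mul_one, h𝒜.proj_same hx]
    | add x y hx hy => rw [add_mul, hx, hy]
  have := key 1
  rw [one_mul] at this
  exact this ▸ h𝒜.proj_mem 1 1

/-- The inverse of a homogeneous matrix is homogeneous. -/
theorem inverse_mem (h𝒜 : IsAlgGrading 𝒜) {ι κ : Type*} [Fintype ι] [DecidableEq ι] [Fintype κ]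
    [DecidableEq κ] {P : Matrix ι κ R} {Q : Matrix κ ι R} (hPQ : P * Q = 1) (hQP : Q * P = 1)
    {a : ι → H} {b : κ → H} (hP : ∀ i j, P i j ∈ 𝒜 (a i * b j)) (j : κ) (i : ι) :
    Q j i ∈ 𝒜 ((b j)⁻¹ * (a i)⁻¹) := by
  -- Cutting each entry of `Q` down to its expected degree still gives a left inverse of the
  -- homogeneous matrix `P`; uniqueness of inverses then forces `Q' = Q`.
  let Q' : Matrix κ ι R := Matrix.of fun j i => h𝒜.proj ((b j)⁻¹ * (a i)⁻¹) (Q j i)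
  have h1 : Q' * P = 1 := by
    ext j l
    have e : (Q' * P) j l = h𝒜.proj ((b j)⁻¹ * b l) ((Q * P) j l) := by
      rw [Matrix.mul_apply, Matrix.mul_apply, map_sum]
      refine Finset.sum_congr rfl fun i _ => ?_
      change h𝒜.proj ((b j)⁻¹ * (a i)⁻¹) (Q j i) * P i l = _
      rw [h𝒜.proj_mul _ _ (hP i l), mul_assoc, inv_mul_cancel_left]
    rw [e, hQP, Matrix.one_apply]
    split_ifs with hjl
    · subst hjl
      rw [inv_mul_cancel]
      exact h𝒜.proj_same h𝒜.one_mem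
    · simp
  have h2 : Q' = Q := by
    calc Q' = Q' * (P * Q) := by rw [hPQ, Matrix.mul_one]
      _ = Q := by rw [← Matrix.mul_assoc, h1, Matrix.one_mul]
  rw [← h2]
  exact h𝒜.proj_mem _ _

theorem inv_mem (h𝒜 : IsAlgGrading 𝒜) {g : H} {x y : R} (hx : x ∈ 𝒜 g) (hxy : x * y = 1)
    (hyx : y * x = 1) : y ∈ 𝒜 g⁻¹ := by
  have := h𝒜.inverse_mem (P := Matrix.of fun _ _ : Unit => x) (Q := Matrix.of fun _ _ : Unit => y)
    (a := fun _ => g) (b := fun _ => 1) (by ext; simp [Matrix.mul_apply, hxy])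
    (by ext; simp [Matrix.mul_apply, hyx]) (by simpa using hx) () ()
  simpa using this

end IsAlgGrading

end Grading

section GradedDivision

variable {F : Type u} [Field F] {D : Type*} [Ring D] [Algebra F D]
  {H : Type*} [Group H] {𝒟 : H → Submodule F D}

theorem IsGradedDivision.exists_inv (hD : IsGradedDivision 𝒟) {h : H} {d : D} (hd : d ∈ 𝒟 h)
    (h0 : d ≠ 0) : ∃ e ∈ 𝒟 h⁻¹, d * e = 1 ∧ e * d = 1 := by
  obtain ⟨w, rfl⟩ := hD.isUnit h d hd h0
  exact ⟨↑w⁻¹, hD.grading.inv_mem hd w.mul_inv w.inv_mul, w.mul_inv, w.inv_mul⟩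

theorem IsGradedDivision.mul_ne_zero (hD : IsGradedDivision 𝒟) {h : H} {d : D} (hd : d ∈ 𝒟 h)
    (h0 : d ≠ 0) {e : D} (he : e ≠ 0) : d * e ≠ 0 := fun h' =>
  he ((hD.isUnit h d hd h0).mul_right_eq_zero.1 h')

end GradedDivision

/-! ### Graded isomorphisms between matrix algebras over graded-division algebras -/

section Morita

variable {F : Type u} [Field F] {D D' : Type*} [Ring D] [Algebra F D] [Ring D'] [Algebra F D']
  {H : Type*} [CommGroup H] {𝒟 : H → Submodule F D} {𝒟' : H → Submodule F D'}
  {ι ι' : Type*}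

theorem single_mem_endGrading [DecidableEq ι] {γ : ι → H} {i j : ι} {h : H} {d : D}
    (hd : d ∈ 𝒟 ((γ i)⁻¹ * h * γ j)) : Matrix.single i j d ∈ endGrading 𝒟 γ h := by
  intro p q
  rw [Matrix.single_apply]
  split_ifs with hpq
  · obtain ⟨rfl, rfl⟩ := hpq
    exact hd
  · exact Submodule.zero_mem _

/-- A graded isomorphism between matrix algebras over graded-division algebras is implemented by an
isomorphism of the graded-division algebras and a homogeneous change of basis. -/
theorem exists_semilinear_of_gradedIso [Fintype ι] [DecidableEq ι] [Fintype ι'] [DecidableEq ι']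
    [Nonempty ι] (hD : IsGradedDivision 𝒟)
    (hD' : IsGradedDivision 𝒟') (γ : ι → H) (γ' : ι' → H)
    (ψ : Matrix ι ι D ≃ₐ[F] Matrix ι' ι' D')
    (hψ : ∀ h, ∀ X ∈ endGrading 𝒟 γ h, ψ X ∈ endGrading 𝒟' γ' h)
    (hψ' : ∀ h, ∀ X ∈ endGrading 𝒟' γ' h, ψ.symm X ∈ endGrading 𝒟 γ h) :
    ∃ (g : H) (ψ₀ : D ≃ₐ[F] D') (P : Matrix ι' ι D') (Q : Matrix ι ι' D'),
      (∀ h, ∀ d ∈ 𝒟 h, ψ₀ d ∈ 𝒟' h) ∧ P * Q = 1 ∧ Q * P = 1 ∧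
      (∀ p i, P p i ∈ 𝒟' ((γ' p)⁻¹ * g * γ i)) ∧
      (∀ i p, Q i p ∈ 𝒟' ((γ i)⁻¹ * g⁻¹ * γ' p)) ∧
      ∀ X, ψ X = P * X.map ψ₀ * Q := by
  obtain ⟨i₀⟩ := ‹Nonempty ι›
  have := hD.nontrivial
  have he0 : ψ (Matrix.single i₀ i₀ 1) ≠ 0 := by
    rw [Ne, EmbeddingLike.map_eq_zero_iff]
    intro h
    have := congrFun (congrFun h i₀) i₀
    simp at this
  obtain ⟨k₀, j₀, hw0⟩ : ∃ k₀ j₀, ψ (Matrix.single i₀ i₀ 1) k₀ j₀ ≠ 0 := by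
    by_contra! h
    exact he0 (Matrix.ext h)
  set w := ψ (Matrix.single i₀ i₀ 1) k₀ j₀ with hw
  have hsingle : ∀ i j h, ∀ d ∈ 𝒟 h,
      Matrix.single i j d ∈ endGrading 𝒟 γ (γ i * h * (γ j)⁻¹) := fun i j h d hd =>
    single_mem_endGrading (by convert hd using 2; group)
  have hsingle1 : ∀ i j, Matrix.single i j 1 ∈ endGrading 𝒟 γ (γ i * (γ j)⁻¹) := fun i j => by
    simpa using hsingle i j 1 1 hD.grading.one_mem
  have hwmem : w ∈ 𝒟' ((γ' k₀)⁻¹ * γ' j₀) := by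
    have := hψ _ _ (hsingle1 i₀ i₀) k₀ j₀
    rwa [mul_inv_cancel, mul_one] at this
  obtain ⟨v, hv, hwv, hvw⟩ := hD'.exists_inv hwmem hw0
  -- `P` collects column `j₀` and `Q` row `k₀` of the images of the matrix units through `i₀`. The
  -- factor `v = w⁻¹` normalizes `Q * P` to `1`.
  let P : Matrix ι' ι D' := Matrix.of fun p j => ψ (Matrix.single j i₀ 1) p j₀
  let Q : Matrix ι ι' D' := Matrix.of fun j p => v * ψ (Matrix.single i₀ j 1) k₀ p
  let ψf : D → D' := fun d => v * ψ (Matrix.single i₀ i₀ d) k₀ j₀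
  have key : ∀ X, Q * ψ X * P = X.map ψf := by
    intro X
    ext j l
    have h1 : Matrix.single i₀ i₀ (X j l) = Matrix.single i₀ j 1 * X * Matrix.single l i₀ 1 := by
      rw [Matrix.single_mul_mul_single, one_mul, mul_one]
    simp only [Matrix.map_apply, ψf, h1, map_mul]
    simp only [Matrix.mul_apply, P, Q, Matrix.of_apply, Finset.mul_sum, Finset.sum_mul, mul_assoc]
  have hQP : Q * P = 1 := by
    have := key 1
    rw [map_one, Matrix.mul_one] at this
    rw [this]
    ext a b
    simp only [Matrix.map_apply, ψf, Matrix.one_apply]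
    split_ifs with hab
    · exact hvw
    · simp
  have hPQ : P * Q = 1 := by
    -- `P * Q` is the image of the scalar matrix with entry `V i₀ i₀`. This entry has degree `1`, is
    -- nonzero, and is idempotent because `Q * P = 1`; in a graded-division algebra it must be `1`.
    -- No comparison of ranks is needed.
    let V := ψ.symm (Matrix.single j₀ k₀ v)
    have hV : V i₀ i₀ ∈ 𝒟 1 := by
      have h1 : Matrix.single j₀ k₀ v ∈ endGrading 𝒟' γ' 1 :=
        single_mem_endGrading (by convert hv using 2; rw [mul_one, mul_inv, inv_inv, mul_comm])
      have := hψ' _ _ h1 i₀ i₀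
      rwa [mul_one, inv_mul_cancel] at this
    have h2 : P * Q = ψ (Matrix.diagonal fun _ => V i₀ i₀) := by
      have h3 : (Matrix.diagonal fun _ : ι => V i₀ i₀) =
          ∑ j, Matrix.single j i₀ 1 * V * Matrix.single i₀ j 1 := by
        ext a b
        simp only [Matrix.sum_apply]
        by_cases hab : a = b
        · subst hab
          rw [Finset.sum_eq_single a]
          · simp [Matrix.single_apply, Matrix.mul_apply]
          · intro c _ hc
            simp [Matrix.mul_apply, hc]
          · simp
        · rw [Matrix.diagonal_apply_ne _ hab, Finset.sum_eq_zero]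
          intro c _
          by_cases hca : c = a
          · subst hca
            simp [Matrix.single_apply, Matrix.mul_apply, hab]
          · simp [Matrix.single_apply, Matrix.mul_apply, hca]
      rw [h3, map_sum]
      ext p q
      simp only [Matrix.sum_apply, map_mul, V, AlgEquiv.apply_symm_apply]
      rw [Matrix.mul_apply]
      refine Finset.sum_congr rfl fun j _ => ?_
      rw [Matrix.mul_assoc, Matrix.mul_apply, Finset.sum_eq_single j₀]
      · rw [Matrix.single_mul_apply_same]
        rfl
      · intro c _ hc
        rw [Matrix.single_mul_apply_of_ne _ _ _ _ _ hc, mul_zero]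
      · simp
    have h4 : P * Q * (P * Q) = P * Q := by
      rw [Matrix.mul_assoc, ← Matrix.mul_assoc Q, hQP, Matrix.one_mul]
    have hv0 : V i₀ i₀ ≠ 0 := by
      intro h0
      rw [h0] at h2
      have h5 : P * Q = 0 := by
        rw [h2, Matrix.diagonal_zero, map_zero]
      have h6 : (Q * P) * (Q * P) = 0 := by
        rw [Matrix.mul_assoc, ← Matrix.mul_assoc P, h5, Matrix.zero_mul, Matrix.mul_zero]
      rw [hQP, Matrix.mul_one] at h6
      have h7 := congrFun (congrFun h6 i₀) i₀
      have := hD'.nontrivial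
      simp at h7
    have h8 : V i₀ i₀ * V i₀ i₀ = V i₀ i₀ := by
      rw [h2, ← map_mul, Matrix.diagonal_mul_diagonal] at h4
      have := congrFun (congrFun (ψ.injective h4) i₀) i₀
      simpa using this
    have h9 : V i₀ i₀ = 1 := (hD.isUnit _ _ hV hv0).mul_left_cancel (by rw [h8, mul_one])
    rw [h2, h9, Matrix.diagonal_one, map_one]
  have key2 : ∀ X, ψ X = P * X.map ψf * Q := fun X => by
    rw [← key, ← Matrix.mul_assoc, ← Matrix.mul_assoc, hPQ, Matrix.one_mul, Matrix.mul_assoc, hPQ,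
      Matrix.mul_one]
  have hone : ψf 1 = 1 := hvw
  have hmul : ∀ a b, ψf (a * b) = ψf a * ψf b := fun a b => by
    have h1 := key (Matrix.single i₀ i₀ a * Matrix.single i₀ i₀ b)
    have h2 : Q * ψ (Matrix.single i₀ i₀ a * Matrix.single i₀ i₀ b) * P =
        (Q * ψ (Matrix.single i₀ i₀ a) * P) * (Q * ψ (Matrix.single i₀ i₀ b) * P) := by
      rw [map_mul]
      calc _ = Q * (ψ (Matrix.single i₀ i₀ a) * (P * Q) * ψ (Matrix.single i₀ i₀ b)) * P := by
            rw [hPQ, Matrix.mul_one]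
        _ = _ := by simp only [Matrix.mul_assoc]
    rw [h2, key, key, Matrix.single_mul_single_same] at h1
    have hz : ψf 0 = 0 := by simp [ψf]
    have h3 := congrFun (congrFun h1 i₀) i₀
    rw [Matrix.mul_apply, Finset.sum_eq_single i₀] at h3
    · simpa using h3.symm
    · intro c _ hc
      simp [hc.symm, hz]
    · simp
  let ψl : D →ₗ[F] D' :=
    { toFun := ψf
      map_add' := fun a b => by
        simp only [ψf, ← mul_add, Matrix.single_add, map_add, Matrix.add_apply]
      map_smul' := fun c a => by
        simp only [ψf, RingHom.id_apply]
        rw [← Matrix.smul_single, map_smul, Matrix.smul_apply, mul_smul_comm] }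
  let ψa : D →ₐ[F] D' := AlgHom.ofLinearMap ψl hone hmul
  have hbij : Function.Bijective ψa := by
    constructor
    · rw [injective_iff_map_eq_zero]
      intro d hd
      have h1 : ψ (Matrix.single i₀ i₀ d) = 0 := by
        rw [key2]
        have h2 : (Matrix.single i₀ i₀ d).map ψf = 0 := by
          ext a b
          rw [Matrix.map_apply, Matrix.single_apply]
          split_ifs
          · exact hd
          · exact map_zero ψa
        rw [h2, Matrix.mul_zero, Matrix.zero_mul]
      rw [EmbeddingLike.map_eq_zero_iff] at h1
      have := congrFun (congrFun h1 i₀) i₀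
      simpa using this
    · intro d
      refine ⟨(ψ.symm (P * Matrix.single i₀ i₀ d * Q)) i₀ i₀, ?_⟩
      have h1 := key (ψ.symm (P * Matrix.single i₀ i₀ d * Q))
      rw [AlgEquiv.apply_symm_apply] at h1
      have h2 : Q * (P * Matrix.single i₀ i₀ d * Q) * P = Matrix.single i₀ i₀ d := by
        calc _ = (Q * P) * Matrix.single i₀ i₀ d * (Q * P) := by simp only [Matrix.mul_assoc]
          _ = _ := by rw [hQP, Matrix.one_mul, Matrix.mul_one]
      rw [h2] at h1
      have := congrFun (congrFun h1 i₀) i₀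
      exact (by simpa using this.symm : ψf _ = d)
  refine ⟨(γ i₀)⁻¹ * γ' j₀, AlgEquiv.ofBijective ψa hbij, P, Q, fun h d hd => ?_, hPQ, hQP,
    fun p i => ?_, fun i p => ?_, key2⟩
  · have := hD'.grading.mul_mem _ _ _ hv _ (hψ _ _ (hsingle i₀ i₀ h d hd) k₀ j₀)
    refine IsAlgGrading.mem_congr this (Additive.ofMul.injective ?_)
    simp only [ofMul_mul, ofMul_inv]
    abel
  · refine IsAlgGrading.mem_congr (hψ _ _ (hsingle1 i i₀) p j₀) (Additive.ofMul.injective ?_)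
    simp only [ofMul_mul, ofMul_inv]
    abel
  · have := hD'.grading.mul_mem _ _ _ hv _ (hψ _ _ (hsingle1 i₀ i) k₀ p)
    refine IsAlgGrading.mem_congr this (Additive.ofMul.injective ?_)
    simp only [ofMul_mul, ofMul_inv]
    abel

end Morita

/-! ### Signs and super-transposition -/

section Sign

variable {F : Type u} [Field F]

@[simp] theorem parSign_zero : parSign F 0 = 1 := if_pos rfl

@[simp] theorem parSign_one : parSign F 1 = -1 := if_neg one_ne_zero

theorem ZMod.two_cases (i : ZMod 2) : i = 0 ∨ i = 1 := by
  revert i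
  decide

theorem ZMod.two_add_self (i : ZMod 2) : i + i = 0 := by
  revert i
  decide

theorem ZMod.two_mul_self (i : ZMod 2) : i * i = i := by
  revert i
  decide

theorem parSign_add (i j : ZMod 2) : parSign F (i + j) = parSign F i * parSign F j := by
  rcases i.two_cases with rfl | rfl <;> rcases j.two_cases with rfl | rfl <;>
    simp [ZMod.two_add_self]

theorem parSign_mul_self (i : ZMod 2) : parSign F i * parSign F i = 1 := by
  rw [← parSign_add, ZMod.two_add_self, parSign_zero]

theorem parSign_ne_zero (i : ZMod 2) : parSign F i ≠ 0 :=
  left_ne_zero_of_mul_eq_one (parSign_mul_self i)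

theorem GSharp.par_mul {G : Type v} [Group G] (g h : GSharp G) :
    (g * h).par = g.par + h.par := rfl

theorem GSharp.par_inv {G : Type v} [Group G] (g : GSharp G) : (g⁻¹).par = g.par := by
  change -g.par = g.par
  rw [neg_eq_iff_add_eq_zero, ZMod.two_add_self]

theorem GSharp.par_one {G : Type v} [Group G] : (1 : GSharp G).par = 0 := rfl

@[simp] theorem GSharp.par_mk {G : Type v} (g : G) (i : ZMod 2) : (GSharp.mk g i).par = i := rfl

end Sign

section SuperTranspose

variable {F : Type u} [Field F] {D : Type*} [Ring D] [Algebra F D] {ι ι' ι'' : Type*}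

/-- Supertranspose with respect to a parity function on the index set. -/
def superTr (F : Type u) [Field F] {D : Type*} [Ring D] [Algebra F D] {ι : Type*}
    (π : ι → ZMod 2) (Y : Matrix ι ι D) : Matrix ι ι D :=
  Matrix.of fun p q => parSign F ((π p + π q) * π p) • Y q p

/-- The adjunction defined by the matrix `Φ` of a sesquilinear form. -/
noncomputable def superAdj [Fintype ι] [DecidableEq ι] (φ : D →ₗ[F] D) (π : ι → ZMod 2)
    (Φ : Matrix ι ι D) (Y : Matrix ι ι D) : Matrix ι ι D :=
  Ring.inverse Φ * (superTr F π Y).map φ * Φ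

/-- The transpose of a matrix with `φ` applied to all entries. -/
def starM (φ : D →ₗ[F] D) (P : Matrix ι ι' D) : Matrix ι' ι D := P.transpose.map φ

/-- The diagonal matrix of signs `(-1)^{ε |p|}`. -/
def signM (F : Type u) [Field F] (D : Type*) [Ring D] [Algebra F D] {ι : Type*} [DecidableEq ι]
    (ε : ZMod 2) (π : ι → ZMod 2) : Matrix ι ι D :=
  Matrix.diagonal fun p => algebraMap F D (parSign F (ε * π p))

theorem starM_apply (φ : D →ₗ[F] D) (P : Matrix ι ι' D) (i : ι') (j : ι) :
    starM φ P i j = φ (P j i) := rfl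

theorem starM_mul [Fintype ι'] {φ : D →ₗ[F] D} (hφ : ∀ a b, φ (a * b) = φ b * φ a)
    (P : Matrix ι ι' D) (Q : Matrix ι' ι'' D) : starM φ (P * Q) = starM φ Q * starM φ P := by
  ext i j
  simp [starM_apply, Matrix.mul_apply, hφ]

theorem map_one_of_antimul {φ : D →ₗ[F] D} (hφ : ∀ a b, φ (a * b) = φ b * φ a)
    (hsurj : Function.Surjective φ) : φ 1 = 1 := by
  obtain ⟨a, ha⟩ := hsurj 1
  have := hφ 1 a
  rw [one_mul, ha, one_mul] at this
  exact this.symm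

theorem starM_one [DecidableEq ι] {φ : D →ₗ[F] D} (hφ : φ 1 = 1) :
    starM φ (1 : Matrix ι ι D) = 1 := by
  rw [starM, Matrix.transpose_one, Matrix.map_one _ (map_zero φ) hφ]

theorem starM_starM {φ : D →ₗ[F] D} (hφ : ∀ a, φ (φ a) = a) (P : Matrix ι ι' D) :
    starM φ (starM φ P) = P := by
  ext i j
  simp [starM_apply, hφ]

section

variable [Fintype ι] [DecidableEq ι] [Fintype ι'] [DecidableEq ι']

omit [Fintype ι'] [DecidableEq ι'] in
theorem signM_mul_apply (ε : ZMod 2) (π : ι → ZMod 2) (P : Matrix ι ι' D) (i : ι) (j : ι') :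
    (signM F D ε π * P) i j = parSign F (ε * π i) • P i j := by
  rw [signM, Matrix.diagonal_mul, Algebra.smul_def]

omit [Fintype ι'] [DecidableEq ι'] in
theorem mul_signM_apply (ε : ZMod 2) (π : ι → ZMod 2) (P : Matrix ι' ι D) (i : ι') (j : ι) :
    (P * signM F D ε π) i j = parSign F (ε * π j) • P i j := by
  rw [signM, Matrix.mul_diagonal, Algebra.smul_def, Algebra.commutes]

theorem signM_mul_self (ε : ZMod 2) (π : ι → ZMod 2) :
    signM F D ε π * signM F D ε π = 1 := by
  rw [signM, Matrix.diagonal_mul_diagonal, ← Matrix.diagonal_one]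
  congr 1
  funext p
  rw [← map_mul, parSign_mul_self, map_one]

omit [Fintype ι] in
theorem signM_zero (π : ι → ZMod 2) : signM F D 0 π = 1 := by
  rw [signM, ← Matrix.diagonal_one]
  congr 1
  funext p
  rw [zero_mul, parSign_zero, map_one]

theorem signM_mul_comm {ε : ZMod 2} {π : ι → ZMod 2} {π' : ι' → ZMod 2} {P : Matrix ι' ι D}
    (hP : ∀ p i, P p i ≠ 0 → ε * π' p = ε * π i) :
    signM F D ε π' * P = P * signM F D ε π := by
  ext p i
  rw [signM_mul_apply, mul_signM_apply]
  by_cases h : P p i = 0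
  · simp [h]
  · rw [hP p i h]

omit [Fintype ι'] [DecidableEq ι'] in
-- At nonzero entries `P` and `Q` shift parity by `ε`, so the sign of the supertranspose of `P * Y *
-- Q` splits into the sign for `Y` and the two factors `(-1)^{ε|r|}`, `(-1)^{ε|s|}` recorded by
-- `signM`.
theorem superTr_conj {φ : D →ₗ[F] D} (hφ : ∀ a b, φ (a * b) = φ b * φ a) {ε : ZMod 2}
    {π : ι → ZMod 2} {π' : ι' → ZMod 2} {P : Matrix ι' ι D} {Q : Matrix ι ι' D}
    (hP : ∀ p i, P p i ≠ 0 → π' p = ε + π i) (hQ : ∀ i p, Q i p ≠ 0 → π' p = ε + π i)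
    (Y : Matrix ι ι D) :
    (superTr F π' (P * Y * Q)).map φ =
      starM φ Q * (signM F D ε π * (superTr F π Y).map φ * signM F D ε π) * starM φ P := by
  have hZ : ∀ r s, (signM F D ε π * (superTr F π Y).map φ * signM F D ε π) r s =
      (parSign F (ε * π s) * (parSign F (ε * π r) * parSign F ((π r + π s) * π r))) •
        φ (Y s r) := fun r s => by
    simp only [Matrix.map_apply, superTr, Matrix.of_apply, mul_signM_apply, signM_mul_apply,
      map_smul, smul_smul]
  generalize signM F D ε π * (superTr F π Y).map φ * signM F D ε π = Z at hZ
  ext p q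
  simp only [Matrix.map_apply, superTr, Matrix.of_apply, Matrix.mul_apply, hZ, starM_apply,
    map_smul, map_sum, hφ, Finset.smul_sum, Finset.sum_mul, smul_mul_assoc,
    mul_smul_comm]
  rw [Finset.sum_comm]
  refine Finset.sum_congr rfl fun s _ => Finset.sum_congr rfl fun r _ => ?_
  by_cases hr : Q r p = 0
  · simp [hr]
  by_cases hs : P q s = 0
  · simp [hs]
  rw [hP q s hs, hQ r p hr, mul_assoc, ← parSign_add, ← parSign_add]
  congr 2
  have hdec : ∀ ε a b : ZMod 2,
      (ε + a + (ε + b)) * (ε + a) = ε * b + (ε * a + (a + b) * a) := by decide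
  exact hdec _ _ _

/-- The two signs multiply to `(-1)^{|p|+|q|}`: the supertranspose squares to the parity
automorphism, not to the identity. -/
theorem superTr_superTr {φ : D →ₗ[F] D} (π : ι → ZMod 2) (Y : Matrix ι ι D) :
    (superTr F π ((superTr F π Y).map φ)).map φ =
      signM F D 1 π * (Y.map fun a => φ (φ a)) * signM F D 1 π := by
  ext p q
  simp only [Matrix.map_apply, superTr, Matrix.of_apply, mul_signM_apply, signM_mul_apply,
    map_smul, smul_smul]
  rw [← parSign_add, ← parSign_add]
  congr 2
  generalize π p = a
  generalize π q = b
  revert a b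
  decide

theorem superTr_add_one (π : ι → ZMod 2) (Y : Matrix ι ι D) :
    superTr F (fun p => 1 + π p) Y = signM F D 1 π * superTr F π Y * signM F D 1 π := by
  ext p q
  simp only [superTr, Matrix.of_apply, mul_signM_apply, signM_mul_apply, smul_smul]
  rw [← parSign_add, ← parSign_add]
  congr 2
  generalize π p = a
  generalize π q = b
  revert a b
  decide

end

end SuperTranspose

/-! ### Square roots in finite-dimensional algebras -/

section Sqrt

open Polynomial

variable {F : Type u} [Field F] [IsAlgClosed F]

/-- A unit of a finite-dimensional algebra over an algebraically closed field of characteristic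
different from `2` has a square root in the subalgebra that it generates. -/
theorem exists_sq_eq_of_isUnit (hF : (2 : F) ≠ 0) {A : Type*} [Ring A] [Algebra F A]
    [FiniteDimensional F A] {a : A} (ha : IsUnit a) :
    ∃ b ∈ Algebra.adjoin F {a}, b * b = a := by
  classical
  let S := Algebra.adjoin F {a}
  have : IsMulCommutative S := Algebra.isMulCommutative_adjoin F (by
    rintro x hx y hy
    rw [Set.mem_singleton_iff] at hx hy
    rw [hx, hy])
  let x : S := ⟨a, Algebra.self_mem_adjoin_singleton F a⟩
  let q := minpoly F a
  have hint : IsIntegral F a := Algebra.IsIntegral.isIntegral a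
  have hq0 : q ≠ 0 := minpoly.ne_zero hint
  -- The inverse of `a` in `A` must be found inside `S`. The minimal polynomial has nonzero constant
  -- term, for otherwise the unit `a` could be cancelled from its relation to leave one of lower
  -- degree; so `a⁻¹` is a polynomial in `a`.
  have hx : IsUnit x := by
    have hq00 : q.coeff 0 ≠ 0 := by
      intro h
      obtain ⟨r, hr⟩ := X_dvd_iff.2 h
      have h1 : a * aeval a r = 0 := by
        have := minpoly.aeval F a
        change aeval a q = 0 at this
        rwa [hr, map_mul, aeval_X] at this
      have h2 : aeval a r = 0 := (ha.mul_right_eq_zero).1 h1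
      have h3 : r ≠ 0 := by
        rintro rfl
        rw [mul_zero] at hr
        exact hq0 hr
      have h4 := minpoly.degree_le_of_ne_zero F a h3 h2
      change q.degree ≤ _ at h4
      rw [hr, degree_mul, degree_X] at h4
      rw [degree_eq_natDegree h3] at h4
      have h5 : 1 + r.natDegree ≤ r.natDegree := by exact_mod_cast h4
      omega
    have h1 : x * aeval x (divX q) = - algebraMap F S (q.coeff 0) := by
      have h2 : aeval x q = 0 := by
        apply Subtype.ext
        rw [← Subalgebra.coe_val, ← Polynomial.aeval_algHom_apply]
        exact minpoly.aeval F a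
      have h3 := congrArg (aeval x) (divX_mul_X_add q)
      rw [h2, map_add, map_mul, aeval_X, aeval_C] at h3
      rw [mul_comm]
      exact eq_neg_of_add_eq_zero_left h3
    exact isUnit_of_mul_isUnit_left (h1 ▸ ((isUnit_iff_ne_zero.2 hq00).map (algebraMap F S)).neg)
  obtain ⟨s, hs⟩ : ∃ s : F → F, ∀ z, s z * s z = z := by
    choose s hs using fun z : F => IsAlgClosed.exists_pow_nat_eq z (n := 2) (by norm_num)
    exact ⟨s, fun z => by rw [← sq, hs]⟩
  -- Interpolating square roots at the distinct roots of `q` makes `r² - X` vanish at each of them,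
  -- so a power of it is divisible by `q` and `r(x)` is a square root of `x` up to a nilpotent.
  let r : F[X] := Lagrange.interpolate q.roots.toFinset id s
  have hr : ∀ z ∈ q.roots, r.eval z = s z := fun z hz =>
    Lagrange.eval_interpolate_at_node s (Function.injective_id.injOn)
      (Multiset.mem_toFinset.2 hz)
  have hnil : IsNilpotent (aeval x (r * r - X)) := by
    have hdvd : q ∣ (r * r - X) ^ (Multiset.card q.roots) := by
      have h1 := (IsAlgClosed.splits q).eq_prod_roots
      rw [(minpoly.monic hint).leadingCoeff, C_1, one_mul] at h1
      rw [h1]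
      have key : ∀ m : Multiset F, (∀ z ∈ m, r.eval z = s z) →
          (m.map fun z => X - C z).prod ∣ (r * r - X) ^ (Multiset.card m) := by
        intro m
        induction m using Multiset.induction_on with
        | empty => simp
        | cons z m ih =>
          intro hm
          rw [Multiset.map_cons, Multiset.prod_cons, Multiset.card_cons, pow_succ']
          refine mul_dvd_mul ?_ (ih fun y hy => hm y (Multiset.mem_cons_of_mem hy))
          rw [dvd_iff_isRoot, IsRoot, eval_sub, eval_mul, eval_X,
            hm z (Multiset.mem_cons_self z m), hs, sub_self]
      simpa using key q.roots hr
    refine ⟨Multiset.card q.roots, ?_⟩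
    obtain ⟨c, hc⟩ := hdvd
    rw [← map_pow, hc, map_mul]
    have : aeval x q = 0 := by
      apply Subtype.ext
      rw [← Subalgebra.coe_val, ← Polynomial.aeval_algHom_apply]
      exact minpoly.aeval F a
    rw [this, zero_mul]
  -- The approximate root is corrected by Newton iteration, which converges modulo nilpotents
  -- because the derivative `2 r(x)` is a unit.
  let p : S[X] := X ^ 2 - C x
  have hp : aeval (aeval x r) p = aeval x (r * r - X) := by
    simp [p, sq]
  have hunit : IsUnit (aeval x r) := by
    have h1 : IsUnit (aeval x r * aeval x r) := by
      have : aeval x r * aeval x r = x + aeval x (r * r - X) := by simp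
      rw [this]
      exact hnil.isUnit_add_left_of_commute hx (Commute.all _ _)
    exact isUnit_of_mul_isUnit_left h1
  have hp' : IsUnit (aeval (aeval x r) (derivative p)) := by
    have : aeval (aeval x r) (derivative p) = algebraMap F S 2 * aeval x r := by
      simp [p, one_add_one_eq_two, map_ofNat]
    rw [this]
    exact ((isUnit_iff_ne_zero.2 hF).map (algebraMap F S)).mul hunit
  obtain ⟨y, ⟨-, hy⟩, -⟩ := existsUnique_nilpotent_sub_and_aeval_eq_zero (hp ▸ hnil) hp'
  refine ⟨y, y.2, ?_⟩
  have : y * y = x := by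
    have : y ^ 2 - x = 0 := by simpa [p] using hy
    rw [← sq]
    exact sub_eq_zero.1 this
  exact congrArg Subtype.val this

end Sqrt

/-! ### Homogeneous matrices -/

section Homogeneous

variable {F : Type u} [Field F] {D : Type*} [Ring D] [Algebra F D] {H : Type*} [CommGroup H]
  {𝒟 : H → Submodule F D} {ι ι' ι'' : Type*}

/-- Degrees of entries are kept in the form (row factor) times (column factor), so that homogeneity
of a product reduces to cancellation of the inner factors. -/
theorem homogeneous_mul [Fintype ι'] (h𝒟 : IsAlgGrading 𝒟) {a : ι → H} {b b' : ι' → H} {c : ι'' → H}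
    {P : Matrix ι ι' D} {Q : Matrix ι' ι'' D} (hP : ∀ i j, P i j ∈ 𝒟 (a i * b j))
    (hQ : ∀ i j, Q i j ∈ 𝒟 (b' i * c j)) (hb : ∀ i, b i * b' i = 1) (i : ι) (j : ι'') :
    (P * Q) i j ∈ 𝒟 (a i * c j) := by
  rw [Matrix.mul_apply]
  refine Submodule.sum_mem _ fun k _ => ?_
  refine IsAlgGrading.mem_congr (h𝒟.mul_mem _ _ _ (hP i k) _ (hQ k j)) ?_
  rw [mul_assoc, ← mul_assoc (b k), hb, one_mul]

theorem mem_endGrading_iff {γ : ι → H} {h : H} {X : Matrix ι ι D} :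
    X ∈ endGrading 𝒟 γ h ↔ ∀ i j, X i j ∈ 𝒟 ((γ i)⁻¹ * (h * γ j)) := by
  simp only [← mul_assoc]
  rfl

theorem conj_mem_endGrading [Fintype ι] (h𝒟 : IsAlgGrading 𝒟) {γ : ι → H}
    {γ' : ι' → H} {P : Matrix ι' ι D} {Q : Matrix ι ι' D}
    (hP : ∀ p i, P p i ∈ 𝒟 ((γ' p)⁻¹ * γ i)) (hQ : ∀ i p, Q i p ∈ 𝒟 ((γ i)⁻¹ * γ' p)) {h : H}
    {X : Matrix ι ι D} (hX : X ∈ endGrading 𝒟 γ h) : P * X * Q ∈ endGrading 𝒟 γ' h := by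
  rw [mem_endGrading_iff] at hX ⊢
  have h1 := homogeneous_mul h𝒟 hP hX fun i => mul_inv_cancel _
  refine homogeneous_mul (b' := fun i => (h * γ i)⁻¹) (c := fun i => h * γ' i) h𝒟 h1
    (fun i j => IsAlgGrading.mem_congr (hQ i j) ?_) fun i => mul_inv_cancel _
  rw [mul_inv_rev, mul_assoc, inv_mul_cancel_left]

theorem one_mem_endGrading [DecidableEq ι] (h𝒟 : IsAlgGrading 𝒟) (γ : ι → H) :
    (1 : Matrix ι ι D) ∈ endGrading 𝒟 γ 1 := by
  intro i j
  rw [Matrix.one_apply]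
  split_ifs with hij
  · subst hij
    simpa using h𝒟.one_mem
  · exact Submodule.zero_mem _

theorem mul_mem_endGrading [Fintype ι] (h𝒟 : IsAlgGrading 𝒟) {γ : ι → H} {g h : H}
    {X Y : Matrix ι ι D} (hX : X ∈ endGrading 𝒟 γ g) (hY : Y ∈ endGrading 𝒟 γ h) :
    X * Y ∈ endGrading 𝒟 γ (g * h) := by
  rw [mem_endGrading_iff] at hX hY ⊢
  intro i j
  refine IsAlgGrading.mem_congr (homogeneous_mul (b' := fun i => (g * γ i)⁻¹)
    (c := fun i => g * h * γ i) h𝒟 hX (fun i j => IsAlgGrading.mem_congr (hY i j) ?_)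
    (fun i => mul_inv_cancel _) i j) rfl
  rw [mul_inv_rev, mul_assoc, mul_assoc g, inv_mul_cancel_left]

/-- A matrix commuting with all matrices is a central scalar. -/
theorem exists_central_of_commute [Fintype ι] [DecidableEq ι] [Nonempty ι] {W : Matrix ι ι D}
    (hW : ∀ Z, W * Z = Z * W) : ∃ z : D, (∀ d, z * d = d * z) ∧ W = Matrix.diagonal fun _ => z := by
  have h1 : ∀ i j d, W i i * d = d * W j j := fun i j d => by
    have := congrFun (congrFun (hW (Matrix.single i j d)) i) j
    rwa [Matrix.mul_single_apply_same, Matrix.single_mul_apply_same] at this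
  have h2 : ∀ a i, a ≠ i → W a i = 0 := fun a i hai => by
    have := congrFun (congrFun (hW (Matrix.single i i 1)) a) i
    rwa [Matrix.mul_single_apply_same, Matrix.single_mul_apply_of_ne _ _ _ _ _ hai,
      mul_one] at this
  have h3 : ∀ i j, W i i = W j j := fun i j => by simpa using h1 i j 1
  obtain ⟨i₀⟩ := ‹Nonempty ι›
  refine ⟨W i₀ i₀, fun d => h1 i₀ i₀ d, ?_⟩
  ext i j
  rw [Matrix.diagonal_apply]
  split_ifs with hij
  · subst hij
    exact h3 _ _
  · exact h2 _ _ hij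

/-- Conjugation by an invertible rectangular matrix. -/
def conjEquiv (F : Type u) [Field F] {D : Type*} [Ring D] [Algebra F D] {ι ι' : Type*} [Fintype ι]
    [DecidableEq ι] [Fintype ι'] [DecidableEq ι'] (P : Matrix ι' ι D) (Q : Matrix ι ι' D)
    (hPQ : P * Q = 1) (hQP : Q * P = 1) : Matrix ι ι D ≃ₐ[F] Matrix ι' ι' D where
  toFun X := P * X * Q
  invFun Y := Q * Y * P
  left_inv X := by
    calc Q * (P * X * Q) * P = (Q * P) * X * (Q * P) := by simp only [Matrix.mul_assoc]
      _ = X := by rw [hQP, Matrix.one_mul, Matrix.mul_one]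
  right_inv Y := by
    calc P * (Q * Y * P) * Q = (P * Q) * Y * (P * Q) := by simp only [Matrix.mul_assoc]
      _ = Y := by rw [hPQ, Matrix.one_mul, Matrix.mul_one]
  map_mul' X Y := by
    calc P * (X * Y) * Q = P * X * (1 * Y) * Q := by simp only [Matrix.mul_assoc, Matrix.one_mul]
      _ = P * X * Q * (P * Y * Q) := by rw [← hQP]; simp only [Matrix.mul_assoc]
  map_add' X Y := by rw [Matrix.mul_add, Matrix.add_mul]
  commutes' c := by
    rw [Algebra.algebraMap_eq_smul_one, Matrix.mul_smul, Matrix.mul_one, Matrix.smul_mul, hPQ,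
      ← Algebra.algebraMap_eq_smul_one]

end Homogeneous

theorem GradedSuperinvIso.trans {F : Type u} [Field F] {H : Type*}
    {R₁ R₂ R₃ : Type*} [Ring R₁] [Algebra F R₁] [Ring R₂] [Algebra F R₂] [Ring R₃] [Algebra F R₃]
    {𝒜₁ : H → Submodule F R₁} {φ₁ : R₁ → R₁} {𝒜₂ : H → Submodule F R₂} {φ₂ : R₂ → R₂}
    {𝒜₃ : H → Submodule F R₃} {φ₃ : R₃ → R₃} (h : GradedSuperinvIso 𝒜₁ φ₁ 𝒜₂ φ₂)
    (h' : GradedSuperinvIso 𝒜₂ φ₂ 𝒜₃ φ₃) : GradedSuperinvIso 𝒜₁ φ₁ 𝒜₃ φ₃ := by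
  obtain ⟨ψ, h1, h2⟩ := h
  obtain ⟨ψ', h1', h2'⟩ := h'
  refine ⟨ψ.trans ψ', fun g => ?_, fun r => ?_⟩
  · rw [← h1', ← h1, ← Submodule.map_comp]
    rfl
  · simp [h2, h2']

theorem map_eq_of_forall_mem {F : Type u} [Field F] {R R' : Type*} [Ring R] [Algebra F R] [Ring R']
    [Algebra F R'] {A : Submodule F R} {A' : Submodule F R'} (ψ : R ≃ₐ[F] R')
    (h : ∀ r ∈ A, ψ r ∈ A') (h' : ∀ r ∈ A', ψ.symm r ∈ A) : A.map (ψ : R →ₗ[F] R') = A' := by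
  apply le_antisymm
  · rintro _ ⟨r, hr, rfl⟩
    exact h r hr
  · intro r hr
    exact ⟨ψ.symm r, h' r hr, ψ.apply_symm_apply r⟩

/-! ### Super-Hermitian forms over a graded-division algebra with involution -/

section Hermitian

variable {F : Type u} [Field F] {D : Type*} [Ring D] [Algebra F D] {G : Type v} [CommGroup G]

/-- An even graded-division algebra with one-dimensional components, supported on an elementary
`2`-group and endowed with a degree-preserving involution. -/
structure IsInvolutiveDivision (𝒟 : GSharp G → Submodule F D) (φ : D →ₗ[F] D) : Prop where
  division : IsGradedDivision 𝒟
  even : ∀ g : GSharp G, g.par ≠ 0 → 𝒟 g = ⊥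
  scalar : ∀ d ∈ 𝒟 1, ∃ c : F, d = c • (1 : D)
  antimul : ∀ a b, φ (a * b) = φ b * φ a
  invol : ∀ a, φ (φ a) = a
  map_mem : ∀ h, ∀ d ∈ 𝒟 h, φ d ∈ 𝒟 h
  sq : ∀ h, ∀ d ∈ 𝒟 h, d ≠ 0 → h * h = 1

/-- `Φ` is the matrix of a nondegenerate super-Hermitian form of degree `g₀` on the graded module
with basis elements of degrees `γ`. -/
structure IsSuperHermitian {ι : Type*} [Fintype ι] [DecidableEq ι] (𝒟 : GSharp G → Submodule F D)
    (φ : D →ₗ[F] D) (γ : ι → GSharp G) (g₀ : GSharp G) (Φ : Matrix ι ι D) : Prop where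
  mem : ∀ p q, Φ p q ∈ 𝒟 (g₀ * γ p * γ q)
  herm : ∀ p q, φ (Φ q p) = parSign F ((γ p).par * (γ q).par) • Φ p q
  isUnit : IsUnit Φ

variable {𝒟 : GSharp G → Submodule F D} {φ : D →ₗ[F] D} {ι ι' : Type*}
  [Fintype ι] [DecidableEq ι] [Fintype ι'] [DecidableEq ι']

theorem exists_mul_eq_one {A : Type*} [Monoid A] {a : A} (ha : IsUnit a) :
    ∃ b, a * b = 1 ∧ b * a = 1 := by
  obtain ⟨u, rfl⟩ := ha
  exact ⟨↑u⁻¹, u.mul_inv, u.inv_mul⟩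

theorem superAdj_eq {Φ Ψ : Matrix ι ι D} (h1 : Φ * Ψ = 1) (h2 : Ψ * Φ = 1) (π : ι → ZMod 2)
    (Y : Matrix ι ι D) : superAdj φ π Φ Y = Ψ * (superTr F π Y).map φ * Φ := by
  have : Ring.inverse Φ = Ψ := Ring.inverse_unit ⟨Φ, Ψ, h1, h2⟩
  rw [superAdj, this]

omit [CommGroup G] in
theorem par_eq_zero_of_mem (heven : ∀ g : GSharp G, g.par ≠ 0 → 𝒟 g = ⊥) {g : GSharp G} {d : D}
    (hd : d ∈ 𝒟 g) (h0 : d ≠ 0) : g.par = 0 := by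
  by_contra hg
  rw [heven g hg] at hd
  exact h0 hd

theorem par_eq_of_mem (heven : ∀ g : GSharp G, g.par ≠ 0 → 𝒟 g = ⊥) {g h : GSharp G} {d : D}
    (hd : d ∈ 𝒟 (g⁻¹ * h)) (h0 : d ≠ 0) : g.par = 0 + h.par := by
  have := par_eq_zero_of_mem heven hd h0
  rw [GSharp.par_mul, GSharp.par_inv] at this
  rw [zero_add]
  generalize g.par = a at *
  generalize h.par = b at *
  revert a b
  decide

theorem par_add_of_mem (heven : ∀ g : GSharp G, g.par ≠ 0 → 𝒟 g = ⊥) {g₀ g h : GSharp G} {d : D}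
    (hd : d ∈ 𝒟 (g₀ * g * h)) (h0 : d ≠ 0) : g.par = g₀.par + h.par := by
  have := par_eq_zero_of_mem heven hd h0
  rw [GSharp.par_mul, GSharp.par_mul] at this
  generalize g₀.par = c at *
  generalize g.par = a at *
  generalize h.par = b at *
  revert a b c
  decide

namespace IsInvolutiveDivision

theorem map_one (h : IsInvolutiveDivision 𝒟 φ) : φ 1 = 1 :=
  map_one_of_antimul h.antimul fun a => ⟨φ a, h.invol a⟩

end IsInvolutiveDivision

/-- At a nonzero entry the degree of the form gives `|p| = |g₀| + |q|`, so the sign `(-1)^{|p||q|}`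
depends on the row alone. Hermitian symmetry thereby becomes a matrix identity. -/
theorem IsSuperHermitian.star_eq (heven : ∀ g : GSharp G, g.par ≠ 0 → 𝒟 g = ⊥) {γ : ι → GSharp G}
    {g₀ : GSharp G} {Φ : Matrix ι ι D} (hΦ : IsSuperHermitian 𝒟 φ γ g₀ Φ) :
    starM φ Φ = signM F D (1 + g₀.par) (fun p => (γ p).par) * Φ := by
  ext p q
  rw [starM_apply, hΦ.herm, signM_mul_apply]
  by_cases h0 : Φ p q = 0
  · rw [h0, smul_zero, smul_zero]
  · have := par_add_of_mem heven (hΦ.mem p q) h0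
    rw [this]
    congr 2
    generalize g₀.par = a
    generalize (γ q).par = b
    revert a b
    decide

theorem IsSuperHermitian.signM_comm (heven : ∀ g : GSharp G, g.par ≠ 0 → 𝒟 g = ⊥)
    {γ : ι → GSharp G} {g₀ : GSharp G} {Φ : Matrix ι ι D} (hΦ : IsSuperHermitian 𝒟 φ γ g₀ Φ) :
    signM F D (1 + g₀.par) (fun p => (γ p).par) * Φ =
      Φ * signM F D (1 + g₀.par) (fun p => (γ p).par) := by
  refine signM_mul_comm fun p q h0 => ?_
  have := par_add_of_mem heven (hΦ.mem p q) h0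
  rw [this]
  generalize g₀.par = a
  generalize (γ q).par = b
  revert a b
  decide

theorem starM_conj_isUnit (hmul : ∀ a b, φ (a * b) = φ b * φ a) (hone : φ 1 = 1)
    {P : Matrix ι' ι D} {Q : Matrix ι ι' D} (hPQ : P * Q = 1) (hQP : Q * P = 1)
    {Φ' Ψ' : Matrix ι' ι' D} (h1 : Φ' * Ψ' = 1) (h2 : Ψ' * Φ' = 1) :
    (starM φ P * Φ' * P) * (Q * Ψ' * starM φ Q) = 1 ∧
      (Q * Ψ' * starM φ Q) * (starM φ P * Φ' * P) = 1 := by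
  have h3 : starM φ Q * starM φ P = 1 := by rw [← starM_mul hmul, hPQ, starM_one hone]
  have h4 : starM φ P * starM φ Q = 1 := by rw [← starM_mul hmul, hQP, starM_one hone]
  constructor
  · calc _ = starM φ P * (Φ' * (P * Q) * Ψ') * starM φ Q := by simp only [Matrix.mul_assoc]
      _ = 1 := by rw [hPQ, Matrix.mul_one, h1, Matrix.mul_one, h4]
  · calc _ = Q * (Ψ' * (starM φ Q * starM φ P) * Φ') * P := by simp only [Matrix.mul_assoc]
      _ = 1 := by rw [h3, Matrix.mul_one, h2, Matrix.mul_one, hQP]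

/-- The new matrix is the Gram matrix of the same form in another graded basis. The change of basis
preserves parity, so the sign matrix moves past it and the symmetry type is kept. -/
theorem IsSuperHermitian.congr (h : IsInvolutiveDivision 𝒟 φ) {γ : ι → GSharp G}
    {γ' : ι' → GSharp G} {g₀ : GSharp G} {Φ' : Matrix ι' ι' D}
    (hΦ' : IsSuperHermitian 𝒟 φ γ' g₀ Φ') {P : Matrix ι' ι D} {Q : Matrix ι ι' D}
    (hPQ : P * Q = 1) (hQP : Q * P = 1) (hP : ∀ p i, P p i ∈ 𝒟 ((γ' p)⁻¹ * γ i)) :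
    IsSuperHermitian 𝒟 φ γ g₀ (starM φ P * Φ' * P) := by
  obtain ⟨Ψ', hΦΨ, hΨΦ⟩ := exists_mul_eq_one hΦ'.isUnit
  have hmem : ∀ p q, (starM φ P * Φ' * P) p q ∈ 𝒟 (g₀ * γ p * γ q) := by
    have h1 : ∀ i j, starM φ P i j ∈ 𝒟 (γ i * (γ' j)⁻¹) := fun i j => by
      rw [starM_apply]
      by_cases h0 : P j i = 0
      · rw [h0, map_zero]
        exact Submodule.zero_mem _
      · have h1 := h.sq _ _ (hP j i) h0
        refine IsAlgGrading.mem_congr (h.map_mem _ _ (hP j i)) (mul_comm _ _)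
    have h2 := homogeneous_mul (b' := γ') (c := fun j => g₀ * γ' j) h.division.grading h1
      (fun i j => IsAlgGrading.mem_congr (hΦ'.mem i j) (by rw [mul_comm g₀, mul_assoc]))
      fun i => inv_mul_cancel _
    have h3 := homogeneous_mul (b' := fun j => (g₀ * γ' j)⁻¹) (c := fun j => g₀ * γ j)
      h.division.grading h2 (fun i j => IsAlgGrading.mem_congr (hP i j)
        (by rw [mul_inv_rev, mul_assoc, inv_mul_cancel_left])) fun i => mul_inv_cancel _
    exact fun p q => IsAlgGrading.mem_congr (h3 p q) (by rw [← mul_assoc, mul_comm g₀])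
  refine ⟨hmem, fun p q => ?_, ?_⟩
  · have e : starM φ (starM φ P * Φ' * P) =
        starM φ P * (signM F D (1 + g₀.par) (fun p => (γ' p).par) * Φ') * P := by
      rw [starM_mul h.antimul, starM_mul h.antimul, starM_starM h.invol, hΦ'.star_eq h.even]
      simp only [Matrix.mul_assoc]
    rw [← starM_apply φ _ p q, e, hΦ'.signM_comm h.even, ← Matrix.mul_assoc, Matrix.mul_assoc,
      signM_mul_comm (π := fun p => (γ p).par) (fun p i h0 => by
        rw [par_eq_of_mem h.even (hP p i) h0, zero_add]), ← Matrix.mul_assoc, mul_signM_apply]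
    by_cases h0 : (starM φ P * Φ' * P) p q = 0
    · rw [h0, smul_zero, smul_zero]
    · have := par_add_of_mem h.even (hmem p q) h0
      rw [this]
      congr 2
      generalize g₀.par = a
      generalize (γ q).par = b
      revert a b
      decide
  · obtain ⟨h1, h2⟩ := starM_conj_isUnit h.antimul h.map_one hPQ hQP hΦΨ hΨΦ
    exact ⟨⟨_, _, h1, h2⟩, rfl⟩

/-- Both sides are the adjoint of one operator, computed in two bases. Since `P` is even,
`superTr_conj` applies with `ε = 0` and leaves no signs. -/
theorem superAdj_conj (h : IsInvolutiveDivision 𝒟 φ) {γ : ι → GSharp G} {γ' : ι' → GSharp G}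
    {P : Matrix ι' ι D} {Q : Matrix ι ι' D} (hPQ : P * Q = 1) (hQP : Q * P = 1)
    (hP : ∀ p i, P p i ∈ 𝒟 ((γ' p)⁻¹ * γ i)) (hQ : ∀ i p, Q i p ∈ 𝒟 ((γ i)⁻¹ * γ' p))
    {Φ' : Matrix ι' ι' D} (hΦ' : IsUnit Φ') (X : Matrix ι ι D) :
    P * superAdj φ (fun p => (γ p).par) (starM φ P * Φ' * P) X * Q =
      superAdj φ (fun p => (γ' p).par) Φ' (P * X * Q) := by
  obtain ⟨Ψ', hΦΨ, hΨΦ⟩ := exists_mul_eq_one hΦ'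
  obtain ⟨h1, h2⟩ := starM_conj_isUnit h.antimul h.map_one hPQ hQP hΦΨ hΨΦ
  rw [superAdj_eq h1 h2, superAdj_eq hΦΨ hΨΦ,
    superTr_conj h.antimul (π := fun p => (γ p).par)
      (fun p i h0 => par_eq_of_mem h.even (hP p i) h0)
      (fun i p h0 => by
        have := par_eq_of_mem h.even (hQ i p) h0
        rw [this, zero_add, zero_add]),
    signM_zero, Matrix.one_mul, Matrix.mul_one]
  generalize (superTr F (fun p => (γ p).par) X).map φ = Z
  calc _ = (P * Q) * Ψ' * starM φ Q * Z * starM φ P * Φ' * (P * Q) := by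
        simp only [Matrix.mul_assoc]
    _ = _ := by
        rw [hPQ, Matrix.one_mul, Matrix.mul_one]
        simp only [Matrix.mul_assoc]

theorem gradedSuperinvIso_of_congr (h : IsInvolutiveDivision 𝒟 φ) {γ : ι → GSharp G}
    {γ' : ι' → GSharp G} {P : Matrix ι' ι D} {Q : Matrix ι ι' D} (hPQ : P * Q = 1) (hQP : Q * P = 1)
    (hP : ∀ p i, P p i ∈ 𝒟 ((γ' p)⁻¹ * γ i)) {Φ' : Matrix ι' ι' D} (hΦ' : IsUnit Φ') :
    GradedSuperinvIso (endGrading 𝒟 γ)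
      (superAdj φ (fun p => (γ p).par) (starM φ P * Φ' * P))
      (endGrading 𝒟 γ') (superAdj φ (fun p => (γ' p).par) Φ') := by
  have hQ : ∀ i p, Q i p ∈ 𝒟 ((γ i)⁻¹ * γ' p) := fun i p => by
    simpa using h.division.grading.inverse_mem hPQ hQP hP i p
  refine ⟨conjEquiv F P Q hPQ hQP, fun g => map_eq_of_forall_mem _ (fun X hX => ?_)
    (fun X hX => ?_), fun X => ?_⟩
  · exact conj_mem_endGrading h.division.grading hP hQ hX
  · exact conj_mem_endGrading h.division.grading hQ hP hX
  · exact superAdj_conj h hPQ hQP hP hQ hΦ' X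

/-- Put `M = B⁻¹A`. It is self-adjoint for `B`, and so is any polynomial in it, in particular a
square root `N`; hence `N* B N = B N² = A`. The square root also has degree `1`, because `M` does.
-/
theorem exists_star_conj_eq [IsAlgClosed F] (hF : (2 : F) ≠ 0) [FiniteDimensional F D]
    (h : IsInvolutiveDivision 𝒟 φ) {γ : ι → GSharp G} {g₀ : GSharp G} {A B : Matrix ι ι D}
    (hΦ : IsSuperHermitian 𝒟 φ γ g₀ A) (hΦ' : IsSuperHermitian 𝒟 φ γ g₀ B) :
    ∃ N N' : Matrix ι ι D, N * N' = 1 ∧ N' * N = 1 ∧ N ∈ endGrading 𝒟 γ 1 ∧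
      starM φ N * B * N = A := by
  have hs := hΦ.star_eq h.even
  have hs' := hΦ'.star_eq h.even
  have hc := hΦ.signM_comm h.even
  have hmem := hΦ.mem
  have hmem' := hΦ'.mem
  obtain ⟨A', hAA, hAA'⟩ := exists_mul_eq_one hΦ.isUnit
  obtain ⟨B', hBB, hBB'⟩ := exists_mul_eq_one hΦ'.isUnit
  set S := signM F D (1 + g₀.par) fun p => (γ p).par with hS
  have hSS : S * S = 1 := signM_mul_self _ _
  set M : Matrix ι ι D := B' * A with hM
  have hMM : M * (A' * B) = 1 := by
    calc _ = B' * (A * A') * B := by simp only [hM, Matrix.mul_assoc]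
      _ = 1 := by rw [hAA, Matrix.mul_one, hBB']
  have hMM' : A' * B * M = 1 := by
    calc _ = A' * (B * B') * A := by simp only [hM, Matrix.mul_assoc]
      _ = 1 := by rw [hBB, Matrix.mul_one, hAA']
  have hMmem : M ∈ endGrading 𝒟 γ 1 := by
    have h1 := h.division.grading.inverse_mem (a := fun p => γ p) (b := fun q => g₀ * γ q)
      hBB hBB'
      (fun i j => IsAlgGrading.mem_congr (hmem' i j) (by rw [mul_comm g₀, mul_assoc]))
    have h2 := homogeneous_mul (b' := fun p => γ p) (c := fun q => g₀ * γ q) h.division.grading h1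
      (fun i j => IsAlgGrading.mem_congr (hmem i j) (by rw [mul_comm g₀, mul_assoc]))
      (fun i => inv_mul_cancel _)
    rw [mem_endGrading_iff]
    intro i j
    refine IsAlgGrading.mem_congr (h2 i j) ?_
    rw [mul_inv_rev, mul_assoc, inv_mul_cancel_left, one_mul]
  obtain ⟨N, hN, hNN⟩ := exists_sq_eq_of_isUnit hF (⟨⟨M, A' * B, hMM, hMM'⟩, rfl⟩ : IsUnit M)
  -- Both forms have the same symmetry type `S`, so the sign matrices coming from `A` and from `B`
  -- cancel.
  have hstarM : starM φ M * B = B * M := by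
    have h1 : starM φ B * starM φ B' = 1 := by
      rw [← starM_mul h.antimul, hBB', starM_one h.map_one]
    have h2 : starM φ B' = B' * S := by
      calc starM φ B' =
          B' * (S * S) * B * starM φ B' := by
            rw [hSS, Matrix.mul_one, hBB', Matrix.one_mul]
        _ = B' * S * (S * B * starM φ B') := by
            simp only [Matrix.mul_assoc]
        _ = _ := by rw [← hs', h1, Matrix.mul_one]
    rw [hM, starM_mul h.antimul, h2, hs, hc]
    have hc' : S * B = B * S := hΦ'.signM_comm h.even
    calc _ = A * S * B' * (S * B) := by simp only [Matrix.mul_assoc]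
      _ = A * S * (B' * B) * S := by rw [hc']; simp only [Matrix.mul_assoc]
      _ = A := by rw [hBB', Matrix.mul_one, Matrix.mul_assoc, hSS, Matrix.mul_one]
      _ = _ := by rw [← Matrix.mul_assoc, hBB, Matrix.one_mul]
  have hcomm : ∀ x ∈ Algebra.adjoin F {M},
      ∀ y ∈ Algebra.adjoin F {M}, x * y = y * x := by
    have : IsMulCommutative (Algebra.adjoin F {M}) :=
      Algebra.isMulCommutative_adjoin F (by
        rintro x hx y hy
        rw [Set.mem_singleton_iff] at hx hy
        rw [hx, hy])
    exact fun x hx y hy => setLike_mul_comm hx hy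
  -- A product of elements self-adjoint for `B` is self-adjoint when they commute, as they do in the
  -- subalgebra generated by `M`.
  have hstarN : starM φ N * B = B * N := by
    clear hNN
    induction hN using Algebra.adjoin_induction with
    | mem x hx =>
      rw [Set.mem_singleton_iff] at hx
      rw [hx, hstarM]
    | algebraMap c =>
      have : starM φ (algebraMap F (Matrix ι ι D) c) = algebraMap F (Matrix ι ι D) c := by
        rw [Algebra.algebraMap_eq_smul_one]
        ext i j
        rw [starM_apply, Matrix.smul_apply, Matrix.smul_apply, map_smul, Matrix.one_apply,
          Matrix.one_apply]
        by_cases hij : i = j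
        · simp [hij, h.map_one]
        · simp [hij, Ne.symm hij]
      rw [this]
      exact Algebra.commutes c _
    | add x y hx hy hx' hy' =>
      have : starM φ (x + y) = starM φ x + starM φ y := by
        ext i j
        simp [starM_apply]
      rw [this, Matrix.add_mul, Matrix.mul_add, hx', hy']
    | mul x y hx hy hx' hy' =>
      rw [starM_mul h.antimul, Matrix.mul_assoc, hx', ← Matrix.mul_assoc, hy', Matrix.mul_assoc,
        hcomm y hy x hx]
  have hNmem : N ∈ endGrading 𝒟 γ 1 := by
    clear hNN hstarN
    induction hN using Algebra.adjoin_induction with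
    | mem x hx =>
      rw [Set.mem_singleton_iff] at hx
      rwa [hx]
    | algebraMap c =>
      rw [Algebra.algebraMap_eq_smul_one]
      exact Submodule.smul_mem _ _ (one_mem_endGrading h.division.grading γ)
    | add x y _ _ hx hy => exact Submodule.add_mem _ hx hy
    | mul x y _ _ hx hy => simpa using mul_mem_endGrading h.division.grading hx hy
  have hNM : N * M = M * N := by rw [← hNN, Matrix.mul_assoc]
  generalize A' * B = M' at hMM hMM'
  refine ⟨N, N * M', ?_, ?_, hNmem, ?_⟩
  · rw [← Matrix.mul_assoc, hNN, hMM]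
  · have : N * M' = M' * N := by
      calc _ = M' * (M * N) * M' := by rw [← Matrix.mul_assoc M', hMM', Matrix.one_mul]
        _ = _ := by
          rw [← hNM, ← Matrix.mul_assoc, Matrix.mul_assoc, hMM, Matrix.mul_one]
    rw [this, Matrix.mul_assoc, hNN, hMM']
  · rw [hstarN, Matrix.mul_assoc, hNN, hM, ← Matrix.mul_assoc, hBB,
      Matrix.one_mul]

/-- Two super-Hermitian forms of the same degree on isomorphic graded modules give isomorphic graded
superalgebras with superinvolution. -/
theorem IsSuperHermitian.gradedSuperinvIso [IsAlgClosed F] (hF : (2 : F) ≠ 0)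
    [FiniteDimensional F D] (h : IsInvolutiveDivision 𝒟 φ) {γ : ι → GSharp G} {γ' : ι' → GSharp G}
    {g₀ : GSharp G} {Φ : Matrix ι ι D} {Φ' : Matrix ι' ι' D}
    (hΦ : IsSuperHermitian 𝒟 φ γ g₀ Φ) (hΦ' : IsSuperHermitian 𝒟 φ γ' g₀ Φ') (σ : ι ≃ ι')
    (hσ : ∀ p, ∃ d ∈ 𝒟 ((γ' (σ p))⁻¹ * γ p), d ≠ 0) :
    GradedSuperinvIso (endGrading 𝒟 γ) (superAdj φ (fun p => (γ p).par) Φ)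
      (endGrading 𝒟 γ') (superAdj φ (fun p => (γ' p).par) Φ') := by
  choose d hd hd0 using hσ
  choose e he hde hed using fun p => h.division.exists_inv (hd p) (hd0 p)
  -- A monomial change of basis along `σ`, with invertible homogeneous coefficients that make the
  -- degrees agree. It pulls `Φ'` back to the module on which `Φ` lives.
  let P : Matrix ι' ι D := Matrix.of fun p' p => if p' = σ p then d p else 0
  let Q : Matrix ι ι' D := Matrix.of fun p p' => if p' = σ p then e p else 0
  have hPa : ∀ p' p, P p' p = if p' = σ p then d p else 0 := fun _ _ => rfl
  have hQa : ∀ p p', Q p p' = if p' = σ p then e p else 0 := fun _ _ => rfl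
  have hPQ : P * Q = 1 := by
    ext a b
    rw [Matrix.mul_apply, Finset.sum_eq_single (σ.symm a)]
    · rw [hPa, hQa, Matrix.one_apply]
      by_cases hab : a = b
      · subst hab
        simp [hde]
      · simp [hab, Ne.symm hab]
    · intro p _ hp
      rw [hPa, if_neg, zero_mul]
      rintro rfl
      simp at hp
    · simp
  have hQP : Q * P = 1 := by
    ext a b
    rw [Matrix.mul_apply, Finset.sum_eq_single (σ a)]
    · rw [hPa, hQa, Matrix.one_apply]
      by_cases hab : a = b
      · subst hab
        simp [hed]
      · simp [hab]
    · intro p _ hp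
      rw [hQa, if_neg hp, zero_mul]
    · simp
  have hP : ∀ p i, P p i ∈ 𝒟 ((γ' p)⁻¹ * γ i) := fun p i => by
    rw [hPa]
    split_ifs with hpi
    · subst hpi
      exact hd i
    · exact Submodule.zero_mem _
  obtain ⟨N, N', hNN, hNN', hNmem, hN⟩ := exists_star_conj_eq hF h hΦ (hΦ'.congr h hPQ hQP hP)
  have h1 : (P * N) * (N' * Q) = 1 := by
    rw [Matrix.mul_assoc, ← Matrix.mul_assoc N, hNN, Matrix.one_mul, hPQ]
  have h2 : (N' * Q) * (P * N) = 1 := by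
    rw [Matrix.mul_assoc, ← Matrix.mul_assoc Q, hQP, Matrix.one_mul, hNN']
  have h3 : ∀ p i, (P * N) p i ∈ 𝒟 ((γ' p)⁻¹ * γ i) := by
    rw [mem_endGrading_iff] at hNmem
    simp only [one_mul] at hNmem
    exact homogeneous_mul h.division.grading hP hNmem fun i => mul_inv_cancel _
  have := gradedSuperinvIso_of_congr h h1 h2 h3 hΦ'.isUnit
  have e1 : starM φ (P * N) * Φ' * (P * N) = Φ := by
    rw [← hN, starM_mul h.antimul]
    simp only [Matrix.mul_assoc]
  rwa [e1] at this

end Hermitian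

/-! ### Shifts of degree and parity; uniqueness of the degree of a form. -/

section Shift

variable {F : Type u} [Field F] {D : Type*} [Ring D] [Algebra F D] {G : Type v} [CommGroup G]
  {𝒟 : GSharp G → Submodule F D} {φ : D →ₗ[F] D} {ι ι' : Type*}
  [Fintype ι] [DecidableEq ι] [Fintype ι'] [DecidableEq ι']

omit [Fintype ι] [DecidableEq ι] in
theorem endGrading_shift (γ : ι → GSharp G) (g : GSharp G) :
    endGrading 𝒟 (fun p => g * γ p) = endGrading 𝒟 γ := by
  funext h
  ext X
  refine forall_congr' fun i => forall_congr' fun j => ?_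
  have : (g * γ i)⁻¹ * h * (g * γ j) = (γ i)⁻¹ * h * γ j := Additive.ofMul.injective (by
    simp only [ofMul_mul, ofMul_inv]
    abel)
  rw [this]

theorem IsSuperHermitian.shift {γ : ι → GSharp G} {g₀ : GSharp G} {Φ : Matrix ι ι D}
    (hΦ : IsSuperHermitian 𝒟 φ γ g₀ Φ) (g : G) :
    IsSuperHermitian 𝒟 φ (fun p => GSharp.mk g 0 * γ p) (GSharp.mk (g⁻¹ ^ 2) 0 * g₀) Φ where
  mem p q := by
    refine IsAlgGrading.mem_congr (hΦ.mem p q) ?_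
    have : GSharp.mk (g⁻¹ ^ 2) 0 * GSharp.mk g 0 * GSharp.mk g 0 = 1 := by
      ext
      · simp [GSharp.mk, sq]
      · rfl
    calc g₀ * γ p * γ q = 1 * (g₀ * γ p * γ q) := (one_mul _).symm
      _ = _ := by
        rw [← this]
        apply Additive.ofMul.injective
        simp only [ofMul_mul]
        abel
  herm p q := by
    rw [hΦ.herm]
    simp [GSharp.par_mul]
  isUnit := hΦ.isUnit

/-- Shifting parities replaces `(-1)^{|p||q|}` by `(-1)^{(1+|p|)(1+|q|)}`. The row signs
`(-1)^{|p|}` account for the terms linear in the parities, and the remaining `-1` is supplied by the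
skew central element `c`, at the cost of its degree `f`. -/
theorem IsSuperHermitian.parityShift (h : IsInvolutiveDivision 𝒟 φ) {γ : ι → GSharp G}
    {g₀ : GSharp G} {Φ : Matrix ι ι D} (hΦ : IsSuperHermitian 𝒟 φ γ g₀ Φ) (g : G) {f : G} {c : D}
    (hc : c ∈ 𝒟 (GSharp.mk f 0)) (hc0 : c ≠ 0) (hcc : ∀ d, c * d = d * c) (hφc : φ c = -c) :
    IsSuperHermitian 𝒟 φ (fun p => GSharp.mk g 1 * γ p) (GSharp.mk (f * g⁻¹ ^ 2) 0 * g₀)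
      (Matrix.scalar ι c * signM F D 1 (fun p => (γ p).par) * Φ) := by
  have hentry : ∀ p q, (Matrix.scalar ι c * signM F D 1 (fun p => (γ p).par) * Φ) p q =
      parSign F (γ p).par • (c * Φ p q) := fun p q => by
    rw [Matrix.mul_assoc, Matrix.scalar_apply, Matrix.diagonal_mul, signM_mul_apply, one_mul,
      mul_smul_comm]
  refine ⟨fun p q => ?_, fun p q => ?_, ?_⟩
  · rw [hentry]
    refine Submodule.smul_mem _ _ (IsAlgGrading.mem_congr
      (h.division.grading.mul_mem _ _ _ hc _ (hΦ.mem p q)) ?_)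
    have : GSharp.mk (f * g⁻¹ ^ 2) 0 * GSharp.mk g 1 * GSharp.mk g 1 = GSharp.mk f 0 := by
      refine Prod.ext ?_ ?_
      · simp [GSharp.mk, sq, mul_assoc]
      · change (0 : ZMod 2) + 1 + 1 = 0
        decide
    rw [← this]
    apply Additive.ofMul.injective
    simp only [ofMul_mul]
    abel
  · rw [hentry, hentry, map_smul, h.antimul, hφc, hΦ.herm, mul_neg, smul_mul_assoc, ← hcc, smul_neg,
      ← neg_smul, smul_smul, smul_smul, GSharp.par_mul, GSharp.par_mul, GSharp.par_mk]
    congr 1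
    generalize (γ p).par = a
    generalize (γ q).par = b
    rcases a.two_cases with rfl | rfl <;> rcases b.two_cases with rfl | rfl <;>
      simp [ZMod.two_add_self]
  · refine (IsUnit.mul ?_ ?_).mul hΦ.isUnit
    · exact (h.division.isUnit _ _ hc hc0).map (Matrix.scalar ι)
    · exact ⟨⟨_, _, signM_mul_self _ _, signM_mul_self _ _⟩, rfl⟩

theorem signM_map_signM (ε : ZMod 2) (π : ι → ZMod 2) (Y : Matrix ι ι D) :
    (signM F D ε π * Y * signM F D ε π).map φ = signM F D ε π * Y.map φ * signM F D ε π := by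
  ext p q
  simp only [Matrix.map_apply, mul_signM_apply, signM_mul_apply, map_smul]

/-- The new Gram matrix differs from `Φ` by the central factor `c`, which cancels in the adjunction,
and by row signs, which undo the change of the supertranspose under the parity shift. -/
theorem superAdj_parityShift {Φ : Matrix ι ι D} (hΦ : IsUnit Φ) {c : D} (hc : IsUnit c)
    (hcc : ∀ d, c * d = d * c) (γ : ι → GSharp G) (g : G) :
    superAdj φ (fun p => (GSharp.mk g 1 * γ p).par)
      (Matrix.scalar ι c * signM F D 1 (fun p => (γ p).par) * Φ) =
      superAdj φ (fun p => (γ p).par) Φ := by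
  obtain ⟨Ψ, h1, h2⟩ := exists_mul_eq_one hΦ
  obtain ⟨e, hce, hec⟩ := exists_mul_eq_one hc
  have hS : signM F D 1 (fun p => (γ p).par) * signM F D 1 (fun p => (γ p).par) = 1 :=
    signM_mul_self _ _
  have hC1 : Matrix.scalar ι c * Matrix.scalar ι e = 1 := by rw [← map_mul, hce, map_one]
  have hC2 : Matrix.scalar ι e * Matrix.scalar ι c = 1 := by rw [← map_mul, hec, map_one]
  funext Y
  have hcomm : ∀ Z : Matrix ι ι D, Matrix.scalar ι c * Z = Z * Matrix.scalar ι c := fun Z => by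
    ext i j
    simp [hcc]
  have e1 : (fun p => (GSharp.mk g 1 * γ p).par) = fun p => 1 + (γ p).par := rfl
  rw [e1]
  have h3 : (Matrix.scalar ι c * signM F D 1 (fun p => (γ p).par) * Φ) *
      (Ψ * signM F D 1 (fun p => (γ p).par) * Matrix.scalar ι e) = 1 := by
    calc _ = Matrix.scalar ι c * (signM F D 1 (fun p => (γ p).par) * (Φ * Ψ) *
          signM F D 1 (fun p => (γ p).par)) * Matrix.scalar ι e := by simp only [Matrix.mul_assoc]
      _ = 1 := by rw [h1, Matrix.mul_one, hS, Matrix.mul_one, hC1]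
  have h4 : (Ψ * signM F D 1 (fun p => (γ p).par) * Matrix.scalar ι e) *
      (Matrix.scalar ι c * signM F D 1 (fun p => (γ p).par) * Φ) = 1 := by
    calc _ = Ψ * (signM F D 1 (fun p => (γ p).par) * (Matrix.scalar ι e * Matrix.scalar ι c) *
          signM F D 1 (fun p => (γ p).par)) * Φ := by simp only [Matrix.mul_assoc]
      _ = 1 := by rw [hC2, Matrix.mul_one, hS, Matrix.mul_one, h2]
  rw [superAdj_eq h3 h4, superAdj_eq h1 h2, superTr_add_one, signM_map_signM]
  generalize (superTr F (fun p => (γ p).par) Y).map φ = Z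
  generalize signM F D 1 (fun p => (γ p).par) = S at *
  calc _ = Ψ * S * Matrix.scalar ι e * (S * Z * S * Matrix.scalar ι c) * (S * Φ) := by
        simp only [Matrix.mul_assoc]
    _ = Ψ * S * (Matrix.scalar ι e * Matrix.scalar ι c) * (S * Z * S) * (S * Φ) := by
        rw [← hcomm]
        simp only [Matrix.mul_assoc]
    _ = Ψ * (S * S) * Z * (S * S) * Φ := by
        rw [hC2, Matrix.mul_one]
        simp only [Matrix.mul_assoc]
    _ = _ := by rw [hS, Matrix.mul_one, Matrix.mul_one]

theorem superTr_surjective (π : ι → ZMod 2) (hφ : ∀ a, φ (φ a) = a) (Z : Matrix ι ι D) :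
    ∃ Y, (superTr F π Y).map φ = Z := by
  refine ⟨signM F D 1 π * (superTr F π (Z.map φ)) * signM F D 1 π, ?_⟩
  ext p q
  simp only [superTr, Matrix.map_apply, Matrix.of_apply, mul_signM_apply, signM_mul_apply, map_smul,
    hφ, smul_smul]
  rw [← parSign_add, ← parSign_add, ← parSign_add]
  have : (π p + π q) * π p + (1 * π p + (1 * π q + (π q + π p) * π q)) = 0 := by
    generalize π p = a
    generalize π q = b
    revert a b
    decide
  rw [this, parSign_zero, one_smul]

/-- The degree of a super-Hermitian form is determined by the superinvolution, when no central
homogeneous element of degree different from `1` is symmetric. -/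
theorem IsSuperHermitian.degree_eq [Nonempty ι] (h : IsInvolutiveDivision 𝒟 φ)
    (hz : ∀ g, ∀ z ∈ 𝒟 g, (∀ d, z * d = d * z) → φ z = z → z ≠ 0 → g = 1)
    {γ : ι → GSharp G} {γ' : ι' → GSharp G} {g₀ g₀' : GSharp G} {Φ : Matrix ι ι D}
    {Φ' : Matrix ι' ι' D} (hΦ : IsSuperHermitian 𝒟 φ γ g₀ Φ)
    (hΦ' : IsSuperHermitian 𝒟 φ γ' g₀' Φ') (ψ₀ : D ≃ₐ[F] D)
    (hψ : ∀ h, ∀ d ∈ 𝒟 h, ψ₀ d ∈ 𝒟 h) (hψφ : ∀ d, ψ₀ (φ d) = φ (ψ₀ d))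
    {P : Matrix ι' ι D} {Q : Matrix ι ι' D} (hPQ : P * Q = 1) (hQP : Q * P = 1)
    (hP : ∀ p i, P p i ∈ 𝒟 ((γ' p)⁻¹ * γ i))
    (hcomm : ∀ X : Matrix ι ι D, P * (superAdj φ (fun p => (γ p).par) Φ X).map ψ₀ * Q =
      superAdj φ (fun p => (γ' p).par) Φ' (P * X.map ψ₀ * Q)) : g₀ = g₀' := by
  have hD := h.division.nontrivial
  have hQ : ∀ i p, Q i p ∈ 𝒟 ((γ i)⁻¹ * γ' p) := fun i p => by
    simpa using h.division.grading.inverse_mem hPQ hQP hP i p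
  have hΦ₂ := hΦ'.congr h hPQ hQP hP
  obtain ⟨Ψ, h1, h2⟩ := exists_mul_eq_one hΦ.isUnit
  obtain ⟨Ψ₂, h3, h4⟩ := exists_mul_eq_one hΦ₂.isUnit
  have hconj := fun X => superAdj_conj h hPQ hQP hP hQ hΦ'.isUnit X
  set Φ₂ := starM φ P * Φ' * P
  have hmapmul : ∀ X Y : Matrix ι ι D, (X * Y).map ψ₀ = X.map ψ₀ * Y.map ψ₀ := fun X Y =>
    Matrix.map_mul
  have hsuper : ∀ X : Matrix ι ι D, ((superTr F (fun p => (γ p).par) X).map φ).map ψ₀ =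
      (superTr F (fun p => (γ p).par) (X.map ψ₀)).map φ := fun X => by
    ext p q
    simp [superTr, hψφ]
  have hΦs : Φ.map ψ₀ * Ψ.map ψ₀ = 1 := by
    rw [← hmapmul, h1, Matrix.map_one _ (map_zero ψ₀) (map_one ψ₀)]
  have hΦs' : Ψ.map ψ₀ * Φ.map ψ₀ = 1 := by
    rw [← hmapmul, h2, Matrix.map_one _ (map_zero ψ₀) (map_one ψ₀)]
  have key : ∀ Z : Matrix ι ι D, Ψ.map ψ₀ * Z * Φ.map ψ₀ = Ψ₂ * Z * Φ₂ := by
    intro Z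
    obtain ⟨Y, rfl⟩ := superTr_surjective (F := F) (fun p => (γ p).par) h.invol Z
    obtain ⟨X, rfl⟩ : ∃ X : Matrix ι ι D, X.map ψ₀ = Y := ⟨Y.map ψ₀.symm, by
      ext i j
      simp⟩
    have e1 := hcomm X
    rw [← hconj, superAdj_eq h1 h2, superAdj_eq h3 h4, hmapmul, hmapmul, hsuper] at e1
    exact (conjEquiv F P Q hPQ hQP).injective e1
  -- By `key`, conjugation by `Φ₂` and by `ψ₀(Φ)` coincide, so the two matrices differ by a central
  -- scalar `z`.
  obtain ⟨z, hzc, hW⟩ := exists_central_of_commute (W := Φ₂ * Ψ.map ψ₀) fun Z => by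
    calc _ = Φ₂ * (Ψ.map ψ₀ * Z * Φ.map ψ₀) * Ψ.map ψ₀ := by
          rw [Matrix.mul_assoc Φ₂, Matrix.mul_assoc Φ₂, Matrix.mul_assoc _ (Φ.map ψ₀), hΦs,
            Matrix.mul_one]
      _ = (Φ₂ * Ψ₂) * Z * (Φ₂ * Ψ.map ψ₀) := by
          rw [key]
          simp only [Matrix.mul_assoc]
      _ = _ := by rw [h3, Matrix.one_mul]
  have hzΦ : ∀ p q, Φ₂ p q = z * ψ₀ (Φ p q) := by
    have e1 : Φ₂ = (Matrix.diagonal fun _ => z) * Φ.map ψ₀ := by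
      rw [← hW, Matrix.mul_assoc, hΦs', Matrix.mul_one]
    intro p q
    rw [e1, Matrix.diagonal_mul, Matrix.map_apply]
  obtain ⟨p, q, hpq⟩ : ∃ p q, Φ p q ≠ 0 := by
    by_contra! h0
    have : Φ = 0 := Matrix.ext h0
    rw [this, Matrix.zero_mul] at h1
    exact zero_ne_one h1
  have hpq' : ψ₀ (Φ p q) ≠ 0 := by
    rwa [Ne, EmbeddingLike.map_eq_zero_iff]
  have hmem := hψ _ _ (hΦ.mem p q)
  obtain ⟨w, hw, hw1, hw2⟩ := h.division.exists_inv hmem hpq'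
  have hzw : z = Φ₂ p q * w := by rw [hzΦ, mul_assoc, hw1, mul_one]
  have hz0 : z ≠ 0 := by
    rintro rfl
    have : Φ₂ = 0 := Matrix.ext fun p q => by rw [hzΦ, zero_mul]; rfl
    rw [this, Matrix.zero_mul] at h3
    exact zero_ne_one h3
  -- The two forms obey the same Hermitian symmetry, which forces the central factor between them to
  -- be symmetric. Its degree is `g₀' * g₀⁻¹`, so the hypothesis `hz` applies.
  have hφz : φ z = z := by
    have e1 := hΦ₂.herm p q
    have e2 : φ (z * ψ₀ (Φ q p)) = φ (ψ₀ (Φ q p)) * φ z := h.antimul _ _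
    rw [← hzΦ, e1, ← hψφ, hΦ.herm, map_smul, smul_mul_assoc] at e2
    have e3 := smul_right_injective D (parSign_ne_zero (F := F) _) e2
    rw [hzΦ] at e3
    change z * _ = _ at e3
    rw [hzc] at e3
    exact ((h.division.isUnit _ _ hmem hpq').mul_left_cancel e3).symm
  have h5 := hz _ z (IsAlgGrading.mem_congr (hzw ▸ h.division.grading.mul_mem _ _ _
    (hΦ₂.mem p q) _ hw) (h := g₀' * g₀⁻¹) (Additive.ofMul.injective (by
      simp only [ofMul_mul, ofMul_inv]
      abel))) hzc hφz hz0
  exact (mul_inv_eq_one.1 h5).symm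

end Shift

/-! ### The standard realizations -/

section Std

variable {F : Type u} [Field F] {G : Type v} [CommGroup G]

/-- The order of a finite elementary `2`-group is invertible in characteristic different from `2`. -/
theorem natCard_ne_zero_of_sq (hF : (2 : F) ≠ 0) {A : Type*} [Group A] [Finite A]
    (h : ∀ a : A, a * a = 1) : (Nat.card A : F) ≠ 0 := by
  have hp : IsPGroup 2 A := fun a => ⟨1, by rw [pow_one, sq, h]⟩
  have : Fact (Nat.Prime 2) := ⟨Nat.prime_two⟩
  obtain ⟨n, hn⟩ := IsPGroup.iff_card.1 hp
  rw [hn]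
  push_cast
  exact pow_ne_zero _ hF

section Helpers

variable {D : Type*} [Ring D] [Algebra F D]

theorem isUnit_smul_of_ne_zero {x : F} (hx : x ≠ 0) {z : D} (hz : IsUnit z) : IsUnit (x • z) := by
  rw [Algebra.smul_def]
  exact ((isUnit_iff_ne_zero.2 hx).map (algebraMap F D)).mul hz

theorem isUnit_of_mul_self_eq {z : D} {ε : F} (hε : ε = 1 ∨ ε = -1) (h : z * z = ε • (1 : D)) :
    IsUnit z := by
  rcases hε with rfl | rfl
  · rw [one_smul] at h
    exact ⟨⟨z, z, h, h⟩, rfl⟩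
  · rw [neg_smul, one_smul] at h
    exact ⟨⟨z, -z, by rw [mul_neg, h, neg_neg], by rw [neg_mul, h, neg_neg]⟩, rfl⟩

theorem eq_zero_of_neg_smul_eq {V : Type*} [AddCommGroup V] [Module F V] (hF : (2 : F) ≠ 0) {z : V}
    (h : (-1 : F) • z = z) : z = 0 := by
  have h5 : (2 : F) • z = 0 := by
    rw [two_smul]
    nth_rewrite 1 [← h]
    rw [neg_smul, one_smul, neg_add_cancel]
  exact (smul_eq_zero.1 h5).resolve_left hF

/-- Conjugation by `u` turns `x` into `-x` and does not change the trace. -/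
theorem trace_eq_zero_of_anticommute (hF : (2 : F) ≠ 0) {τ : D →ₗ[F] F}
    (hτ : ∀ x y, τ (x * y) = τ (y * x)) {x u : D} (hu : IsUnit u)
    (h : x * u = (-1 : F) • (u * x)) : τ x = 0 := by
  obtain ⟨w, h1, h2⟩ := exists_mul_eq_one hu
  refine eq_zero_of_neg_smul_eq hF ?_
  calc (-1 : F) • τ x = (-1 : F) • τ (u * x * w) := by rw [hτ, ← mul_assoc, h2, one_mul]
    _ = τ (x * u * w) := by rw [h, smul_mul_assoc, map_smul]
    _ = τ x := by rw [mul_assoc, h1, mul_one]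

/-- Compute `φ (x * y)` in two ways. Applied to homogeneous components, this says that the signs of
a degree-preserving involution form a quadratic function whose polarization is the commutation
factor. -/
theorem antimul_scalar_mul {φ : D →ₗ[F] D} (hφ : ∀ a b, φ (a * b) = φ b * φ a) {x y z : D}
    {a b c ε δ : F} (hz : z ≠ 0) (hδ : δ ≠ 0) (hx : φ x = a • x) (hy : φ y = b • y) (hz' : φ z = c • z)
    (hyx : y * x = ε • (x * y)) (hxy : x * y = δ • z) : c = a * b * ε := by
  have h1 := hφ x y
  rw [hx, hy, smul_mul_smul_comm, hyx, hxy, map_smul, hz', smul_smul, smul_smul, smul_smul] at h1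
  have h2 : δ * c = _ := smul_left_injective F hz h1
  apply mul_left_cancel₀ hδ
  rw [h2]
  ring

theorem isAlgGrading_of_family {H T : Type*} [Group H] {e : T → H}
    {Z : T → D} (hli : LinearIndependent F Z) (hspan : Submodule.span F (Set.range Z) = ⊤)
    {𝒟 : H → Submodule F D} (hmem : ∀ t, Z t ∈ 𝒟 (e t))
    (hex : ∀ g, ∀ d ∈ 𝒟 g, d ≠ 0 → ∃ t, g = e t ∧ ∃ x : F, d = x • Z t)
    (hmul : ∀ s t, ∃ (u : T) (x : F), e u = e s * e t ∧ Z s * Z t = x • Z u) :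
    IsAlgGrading 𝒟 where
  indep := by
    rw [iSupIndep_def]
    intro g
    rw [Submodule.disjoint_def]
    intro x hx hx'
    by_contra h0
    obtain ⟨t, rfl, y, rfl⟩ := hex _ _ hx h0
    have h1 : (⨆ (k : H) (_ : k ≠ e t), 𝒟 k) ≤ Submodule.span F (Z '' {s | s ≠ t}) := by
      refine iSup₂_le fun k hk d hd => ?_
      by_cases hd0 : d = 0
      · rw [hd0]
        exact Submodule.zero_mem _
      · obtain ⟨s, rfl, y', rfl⟩ := hex _ _ hd hd0
        refine Submodule.smul_mem _ _ (Submodule.subset_span ⟨s, ?_, rfl⟩)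
        rintro rfl
        exact hk rfl
    have hy : y ≠ 0 := by
      rintro rfl
      rw [zero_smul] at h0
      exact h0 rfl
    have h2 : Z t ∈ Submodule.span F (Z '' {s | s ≠ t}) := by
      have := Submodule.smul_mem _ y⁻¹ (h1 hx')
      rwa [smul_smul, inv_mul_cancel₀ hy, one_smul] at this
    exact hli.notMem_span_image (s := {s | s ≠ t}) (by simp) h2
  iSup_eq := by
    rw [eq_top_iff, ← hspan, Submodule.span_le]
    rintro _ ⟨t, rfl⟩
    exact Submodule.mem_iSup_of_mem _ (hmem t)
  mul_mem g h a ha b hb := by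
    by_cases ha0 : a = 0
    · rw [ha0, zero_mul]
      exact Submodule.zero_mem _
    by_cases hb0 : b = 0
    · rw [hb0, mul_zero]
      exact Submodule.zero_mem _
    obtain ⟨s, rfl, x, rfl⟩ := hex _ _ ha ha0
    obtain ⟨t, rfl, y, rfl⟩ := hex _ _ hb hb0
    obtain ⟨u, z, hu, h⟩ := hmul s t
    rw [smul_mul_assoc, mul_smul_comm, h, ← hu]
    exact Submodule.smul_mem _ _ (Submodule.smul_mem _ _ (Submodule.smul_mem _ _ (hmem _)))

end Helpers

namespace ExPair

variable (P : ExPair F G)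

theorem β_sq (s t : P.T) : P.β s t * P.β s t = 1 := by
  rw [← MonoidHom.mul_apply, ← map_mul, P.sq_eq_one, map_one, MonoidHom.one_apply]

theorem β_mul_left (s t u : P.T) : P.β (s * t) u = P.β s u * P.β t u := by
  rw [map_mul, MonoidHom.mul_apply]

theorem β_mul_right (s t u : P.T) : P.β s (t * u) = P.β s t * P.β s u := map_mul _ _ _

theorem β_symm (s t : P.T) : P.β s t = P.β t s := by
  have h := P.alternating (s * t)
  rw [β_mul_left, β_mul_right, β_mul_right, P.alternating, P.alternating, one_mul, mul_one] at h
  exact mul_right_cancel (h.trans (P.β_sq t s).symm)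

theorem β_eq (s t : P.T) : (P.β s t : F) = 1 ∨ (P.β s t : F) = -1 := by
  have := congrArg Units.val (P.β_sq s t)
  rw [Units.val_mul, Units.val_one] at this
  exact mul_self_eq_one_iff.1 this

theorem β_f (t : P.T) : P.β P.f t = 1 := (P.mem_rad P.f).2 (Or.inr rfl) t

theorem β_f' (t : P.T) : P.β t P.f = 1 := by rw [β_symm, β_f]

theorem mem_zpowers {c : P.T} : c ∈ Subgroup.zpowers P.f ↔ c = 1 ∨ c = P.f := by
  constructor
  · rintro ⟨n, rfl⟩
    dsimp only
    rcases Int.even_or_odd' n with ⟨k, rfl | rfl⟩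
    · left
      rw [zpow_mul, zpow_ofNat, sq, P.sq_eq_one, one_zpow]
    · right
      rw [zpow_add, zpow_mul, zpow_ofNat, sq, P.sq_eq_one, one_zpow, one_mul, zpow_one]
  · rintro (rfl | rfl)
    · exact one_mem _
    · exact Subgroup.mem_zpowers _

theorem inv_eq (t : P.T) : t⁻¹ = t := inv_eq_of_mul_eq_one_left (P.sq_eq_one t)

theorem β_zpowers {c : P.T} (hc : c ∈ Subgroup.zpowers P.f) (t : P.T) : P.β c t = 1 :=
  (P.mem_rad c).2 (P.mem_zpowers.1 hc) t

end ExPair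

namespace StdRealization

variable {P : ExPair F G} (S : StdRealization P)

theorem exists_decomp (t : P.T) :
    ∃ c ∈ Subgroup.zpowers P.f, ∃ a ∈ S.A, ∃ b ∈ S.B, c * a * b = t := by
  have h1 : t ∈ Subgroup.zpowers P.f ⊔ S.K := by
    rw [S.isCompl_K.sup_eq_top]
    trivial
  obtain ⟨c, hc, k, hk, rfl⟩ := Subgroup.mem_sup.1 h1
  rw [← S.sup_eq] at hk
  obtain ⟨a, ha, b, hb, rfl⟩ := Subgroup.mem_sup.1 hk
  exact ⟨c, hc, a, ha, b, hb, mul_assoc _ _ _⟩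

theorem decomp_unique {c c' a a' b b' : P.T} (hc : c ∈ Subgroup.zpowers P.f)
    (hc' : c' ∈ Subgroup.zpowers P.f) (ha : a ∈ S.A) (ha' : a' ∈ S.A) (hb : b ∈ S.B)
    (hb' : b' ∈ S.B) (h : c * a * b = c' * a' * b') : c = c' ∧ a = a' ∧ b = b' := by
  have hAK : S.A ≤ S.K := S.sup_eq ▸ le_sup_left
  have hBK : S.B ≤ S.K := S.sup_eq ▸ le_sup_right
  have e1 : c'⁻¹ * c = a' * b' * (a * b)⁻¹ := by
    rw [eq_mul_inv_iff_mul_eq, mul_assoc, ← mul_assoc c, h, mul_assoc c', inv_mul_cancel_left]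
  have h1 : c'⁻¹ * c = 1 := by
    have h2 : c'⁻¹ * c ∈ S.K := e1 ▸ mul_mem (mul_mem (hAK ha') (hBK hb'))
      (inv_mem (mul_mem (hAK ha) (hBK hb)))
    exact Subgroup.disjoint_def.1 S.isCompl_K.disjoint (mul_mem (inv_mem hc') hc) h2
  obtain rfl : c' = c := inv_mul_eq_one.1 h1
  rw [mul_assoc, mul_assoc] at h
  have h2 := mul_left_cancel h
  have h3 : a'⁻¹ * a = b' * b⁻¹ := by
    rw [eq_mul_inv_iff_mul_eq, mul_assoc, h2, inv_mul_cancel_left]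
  have h4 : a'⁻¹ * a = 1 := Subgroup.disjoint_def.1 S.disjoint (mul_mem (inv_mem ha') ha)
    (h3 ▸ mul_mem hb' (inv_mem hb))
  obtain rfl : a' = a := inv_mul_eq_one.1 h4
  exact ⟨rfl, rfl, mul_left_cancel h2⟩

theorem zeta_mul {c c' : P.T} (hc : c ∈ Subgroup.zpowers P.f) (hc' : c' ∈ Subgroup.zpowers P.f) :
    zeta P c * zeta P c' = zeta P (c * c') := by
  rcases P.mem_zpowers.1 hc with rfl | rfl <;> rcases P.mem_zpowers.1 hc' with rfl | rfl <;>
    simp [zeta, P.sq_eq_one, P.f_ne_one]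

theorem Xa_mul (a a' : P.T) : S.Xa a * S.Xa a' = S.Xa (a * a') := by
  rw [Xa, Xa, Xa, Matrix.diagonal_mul_diagonal]
  congr 1
  funext b
  rw [map_mul, MonoidHom.mul_apply, Units.val_mul]

theorem Xb_mul_Xa (a b : P.T) : S.Xb b * S.Xa a = (P.β a b : F) • (S.Xa a * S.Xb b) := by
  ext r s
  rw [Xa, Matrix.mul_diagonal, Matrix.smul_apply, Matrix.diagonal_mul, Xb, Matrix.of_apply]
  by_cases h : (r : P.T) = b * s
  · rw [if_pos h, h, map_mul, Units.val_mul, one_mul, mul_one, smul_eq_mul, ← mul_assoc,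
      ← Units.val_mul, P.β_sq, Units.val_one, one_mul]
  · simp [h]

theorem Xb_mul {b b' : P.T} (hb' : b' ∈ S.B) : S.Xb b * S.Xb b' = S.Xb (b * b') := by
  ext r s
  rw [Matrix.mul_apply, Finset.sum_eq_single (⟨b' * s, mul_mem hb' s.2⟩ : S.B)]
  · simp only [Xb, Matrix.of_apply, if_true, mul_one]
    rw [mul_assoc b b' (s : P.T)]
  · intro x _ hx
    have : ¬((x : P.T) = b' * s) := fun h => hx (Subtype.ext h)
    simp [Xb, this]
  · simp

theorem Xb_transpose (b : P.T) : (S.Xb b).transpose = S.Xb b := by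
  ext r s
  simp only [Matrix.transpose_apply, Xb, Matrix.of_apply]
  have : (s : P.T) = b * r ↔ (r : P.T) = b * s := by
    constructor
    · intro h
      rw [h, ← mul_assoc, P.sq_eq_one, one_mul]
    · intro h
      rw [h, ← mul_assoc, P.sq_eq_one, one_mul]
  by_cases h : (r : P.T) = b * s
  · rw [if_pos h, if_pos (this.2 h)]
  · rw [if_neg h, if_neg (mt this.1 h)]

theorem Xa_one : S.Xa 1 = 1 := by
  simp [Xa]

theorem Xb_one : S.Xb 1 = 1 := by
  ext r s
  rw [Xb, Matrix.of_apply, one_mul]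
  by_cases h : r = s
  · rw [h, if_pos rfl, Matrix.one_apply_eq]
  · rw [if_neg fun h' => h (Subtype.ext h'), Matrix.one_apply_ne h]

/-- The element `c ⊗ X_a X_b`. -/
noncomputable def elt (c a b : P.T) : S.Alg := zeta P c ⊗ₜ[F] (S.Xa a * S.Xb b)

theorem elt_one : S.elt 1 1 1 = 1 := by
  rw [elt, Xa_one, Xb_one, Matrix.one_mul, zeta, if_pos rfl]
  rfl

theorem elt_mul {c c' a a' b b' : P.T} (hc : c ∈ Subgroup.zpowers P.f)
    (hc' : c' ∈ Subgroup.zpowers P.f) (hb' : b' ∈ S.B) :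
    S.elt c a b * S.elt c' a' b' = (P.β a' b : F) • S.elt (c * c') (a * a') (b * b') := by
  have h : S.Xa a * S.Xb b * (S.Xa a' * S.Xb b') =
      (P.β a' b : F) • (S.Xa (a * a') * S.Xb (b * b')) := by
    calc _ = S.Xa a * (S.Xb b * S.Xa a') * S.Xb b' := by simp only [Matrix.mul_assoc]
      _ = (P.β a' b : F) • (S.Xa a * S.Xa a' * (S.Xb b * S.Xb b')) := by
        rw [Xb_mul_Xa]
        simp only [Matrix.mul_assoc, Matrix.mul_smul, Matrix.smul_mul]
      _ = _ := by rw [Xa_mul, Xb_mul _ hb']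
  rw [elt, elt, Algebra.TensorProduct.tmul_mul_tmul, h, zeta_mul hc hc', TensorProduct.tmul_smul]
  rfl

theorem β_decomp {c c' a a' b b' : P.T} (hc : c ∈ Subgroup.zpowers P.f)
    (hc' : c' ∈ Subgroup.zpowers P.f) (ha : a ∈ S.A) (ha' : a' ∈ S.A) (hb : b ∈ S.B)
    (hb' : b' ∈ S.B) : P.β (c * a * b) (c' * a' * b') = P.β a b' * P.β a' b := by
  simp only [P.β_mul_left, P.β_mul_right, P.β_zpowers hc, P.β_symm _ c', P.β_zpowers hc',
    S.isotropic_A a ha a' ha', S.isotropic_B b hb b' hb', P.β_symm b a', one_mul, mul_one]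

/-- A nonzero element of the component of degree `t`. -/
noncomputable def Z (t : P.T) : S.Alg :=
  S.elt (S.exists_decomp t).choose (S.exists_decomp t).choose_spec.2.choose
    (S.exists_decomp t).choose_spec.2.choose_spec.2.choose

theorem Z_spec (t : P.T) : ∃ c ∈ Subgroup.zpowers P.f, ∃ a ∈ S.A, ∃ b ∈ S.B, c * a * b = t ∧
    S.Z t = S.elt c a b :=
  ⟨_, (S.exists_decomp t).choose_spec.1, _, (S.exists_decomp t).choose_spec.2.choose_spec.1, _,
    (S.exists_decomp t).choose_spec.2.choose_spec.2.choose_spec.1,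
    (S.exists_decomp t).choose_spec.2.choose_spec.2.choose_spec.2, rfl⟩

theorem Z_eq {c a b : P.T} (hc : c ∈ Subgroup.zpowers P.f) (ha : a ∈ S.A) (hb : b ∈ S.B) :
    S.Z (c * a * b) = S.elt c a b := by
  obtain ⟨c', hc', a', ha', b', hb', h, h'⟩ := S.Z_spec (c * a * b)
  obtain ⟨rfl, rfl, rfl⟩ := S.decomp_unique hc' hc ha' ha hb' hb h
  exact h'

theorem comp_eq (t : P.T) : S.comp t = Submodule.span F {S.Z t} := by
  rw [comp]
  congr 1
  ext d
  simp only [Set.mem_ofPred_eq, Set.mem_singleton_iff]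
  constructor
  · rintro ⟨c, hc, a, ha, b, hb, rfl, rfl⟩
    exact (S.Z_eq hc ha hb).symm
  · rintro rfl
    obtain ⟨c, hc, a, ha, b, hb, h, h'⟩ := S.Z_spec t
    exact ⟨c, hc, a, ha, b, hb, h, h'⟩

theorem Z_one : S.Z 1 = 1 := by
  have := S.Z_eq (one_mem _) (one_mem S.A) (one_mem S.B)
  rwa [mul_one, mul_one, elt_one] at this

theorem Z_mul (s t : P.T) : ∃ ε : F, (ε = 1 ∨ ε = -1) ∧ S.Z s * S.Z t = ε • S.Z (s * t) := by
  obtain ⟨c, hc, a, ha, b, hb, rfl, h⟩ := S.Z_spec s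
  obtain ⟨c', hc', a', ha', b', hb', rfl, h'⟩ := S.Z_spec t
  refine ⟨P.β a' b, P.β_eq _ _, ?_⟩
  have e : c * a * b * (c' * a' * b') = (c * c') * (a * a') * (b * b') := by
    apply Additive.ofMul.injective
    simp only [ofMul_mul]
    abel
  rw [h, h', S.elt_mul hc hc' hb', e, S.Z_eq (mul_mem hc hc') (mul_mem ha ha') (mul_mem hb hb')]

theorem Z_comm (s t : P.T) : S.Z s * S.Z t = (P.β s t : F) • (S.Z t * S.Z s) := by
  obtain ⟨c, hc, a, ha, b, hb, rfl, h⟩ := S.Z_spec s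
  obtain ⟨c', hc', a', ha', b', hb', rfl, h'⟩ := S.Z_spec t
  rw [h, h', S.elt_mul hc hc' hb', S.elt_mul hc' hc hb, S.β_decomp hc hc' ha ha' hb hb', smul_smul,
    mul_comm c, mul_comm a, mul_comm b, Units.val_mul, mul_comm (P.β a b' : F), mul_assoc,
    ← Units.val_mul (P.β a b'), P.β_sq, Units.val_one, mul_one]

theorem Z_isUnit (t : P.T) : IsUnit (S.Z t) := by
  obtain ⟨ε, hε, h⟩ := S.Z_mul t t
  rw [P.sq_eq_one, Z_one] at h
  exact isUnit_of_mul_self_eq hε h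

/-- The linear functional that is the sum of the traces of the two components. -/
noncomputable def tau : S.Alg →ₗ[F] F :=
  LinearMap.mul' F F ∘ₗ TensorProduct.map (LinearMap.fst F F F + LinearMap.snd F F F)
    (Matrix.traceLinearMap S.B F F)

theorem tau_tmul (c : F × F) (M : Matrix S.B S.B F) :
    S.tau (c ⊗ₜ[F] M) = (c.1 + c.2) * M.trace := rfl

theorem tau_comm (x y : S.Alg) : S.tau (x * y) = S.tau (y * x) := by
  induction x using TensorProduct.induction_on with
  | zero => simp
  | add x x' h h' => rw [add_mul, mul_add, map_add, map_add, h, h']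
  | tmul c M =>
    induction y using TensorProduct.induction_on with
    | zero => simp
    | add y y' h h' => rw [add_mul, mul_add, map_add, map_add, h, h']
    | tmul c' M' =>
      rw [Algebra.TensorProduct.tmul_mul_tmul, Algebra.TensorProduct.tmul_mul_tmul, tau_tmul,
        tau_tmul, mul_comm c, Matrix.trace_mul_comm]

theorem Z_f : S.Z P.f = (((1 : F), (-1 : F)) : F × F) ⊗ₜ[F] (1 : Matrix S.B S.B F) := by
  have := S.Z_eq (Subgroup.mem_zpowers P.f) (one_mem S.A) (one_mem S.B)
  rw [mul_one, mul_one] at this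
  rw [this, elt]
  rw [Xa_one, Xb_one, Matrix.one_mul, zeta, if_neg P.f_ne_one]

/-- In degree `f` the traces of the two factors cancel. Any other `t ≠ 1` lies outside the radical,
so `Z t` anticommutes with some invertible `Z u`. -/
theorem tau_Z (hF : (2 : F) ≠ 0) {t : P.T} (ht : t ≠ 1) : S.tau (S.Z t) = 0 := by
  by_cases htf : t = P.f
  · rw [htf, Z_f, tau_tmul]
    simp
  · obtain ⟨u, hu⟩ : ∃ u, P.β t u ≠ 1 := by
      by_contra! h
      rcases (P.mem_rad t).1 h with h | h
      · exact ht h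
      · exact htf h
    have hu' : (P.β t u : F) = -1 := by
      rcases P.β_eq t u with h | h
      · exact absurd (Units.ext h) hu
      · exact h
    exact trace_eq_zero_of_anticommute hF S.tau_comm (S.Z_isUnit u) (hu' ▸ S.Z_comm t u)

theorem tau_one (hF : (2 : F) ≠ 0) : S.tau 1 ≠ 0 := by
  have := P.finite_T
  have h : (1 : S.Alg) = ((1 : F × F) ⊗ₜ[F] (1 : Matrix S.B S.B F)) := rfl
  rw [h, tau_tmul, Matrix.trace_one, ← Nat.card_eq_fintype_card]
  refine mul_ne_zero ?_ (natCard_ne_zero_of_sq hF fun b => Subtype.ext (P.sq_eq_one b))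
  change (1 : F) + 1 ≠ 0
  rwa [one_add_one_eq_two]

/-- Multiplying a relation by `Z t` and applying `tau` isolates the coefficient at `t`: since `T`
has exponent 2, `s * t = 1` only for `s = t`. -/
theorem Z_linearIndependent (hF : (2 : F) ≠ 0) : LinearIndependent F S.Z := by
  have := P.finite_T
  have := Fintype.ofFinite P.T
  rw [Fintype.linearIndependent_iff]
  intro g hg t
  obtain ⟨w, h1, h2⟩ := exists_mul_eq_one (S.Z_isUnit t)
  have h3 : S.tau ((∑ s, g s • S.Z s) * S.Z t) = 0 := by rw [hg, zero_mul, map_zero]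
  rw [Finset.sum_mul, map_sum, Finset.sum_eq_single t] at h3
  · obtain ⟨ε, hε, h⟩ := S.Z_mul t t
    rw [smul_mul_assoc, map_smul, h, P.sq_eq_one, Z_one, map_smul] at h3
    have hε0 : ε ≠ 0 := by rcases hε with rfl | rfl <;> simp
    simpa [hε0, S.tau_one hF] using h3
  · intro s _ hs
    obtain ⟨ε, -, h⟩ := S.Z_mul s t
    rw [smul_mul_assoc, map_smul, h, map_smul, S.tau_Z hF, smul_zero, smul_zero]
    intro h'
    exact hs ((mul_eq_one_iff_eq_inv.1 h').trans (P.inv_eq t))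
  · simp

/-- Orthogonality for the character `β(·, b)` of `A`. If it were trivial, `b` would be in the
radical, which meets `K` only in `1`. -/
theorem sum_β_eq_zero {b : P.T} (hb : b ∈ S.B) (hb1 : b ≠ 1) [Fintype S.A] :
    ∑ a : S.A, (P.β a b : F) = 0 := by
  have h : ∃ a ∈ S.A, P.β a b ≠ 1 := by
    by_contra! h
    have h1 : ∀ t, P.β b t = 1 := fun t => by
      obtain ⟨c, hc, a, ha, b', hb', rfl⟩ := S.exists_decomp t
      rw [P.β_symm, map_mul, map_mul, MonoidHom.mul_apply, MonoidHom.mul_apply, P.β_zpowers hc,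
        h a ha, S.isotropic_B b' hb' b hb]
      simp
    have h2 : b ∈ S.K := S.sup_eq ▸ (le_sup_right : S.B ≤ _) hb
    exact hb1 (Subgroup.disjoint_def.1 S.isCompl_K.disjoint
      (P.mem_zpowers.2 ((P.mem_rad b).1 h1)) h2)
  obtain ⟨a, ha, hab⟩ := h
  let χ : S.A →* F := (Units.coeHom F).comp ((P.β.flip b).comp S.A.subtype)
  refine sum_hom_units_eq_zero χ fun h => hab ?_
  have := DFunLike.congr_fun h ⟨a, ha⟩
  exact Units.ext this

theorem span_Z (hF : (2 : F) ≠ 0) : Submodule.span F (Set.range S.Z) = ⊤ := by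
  have := P.finite_T
  have := Fintype.ofFinite S.A
  have hA : (Fintype.card S.A : F) ≠ 0 := by
    rw [← Nat.card_eq_fintype_card]
    exact natCard_ne_zero_of_sq hF fun b => Subtype.ext (P.sq_eq_one b)
  have h1 : ∀ c ∈ Subgroup.zpowers P.f, ∀ a ∈ S.A, ∀ b ∈ S.B,
      zeta P c ⊗ₜ[F] (S.Xa a * S.Xb b) ∈ Submodule.span F (Set.range S.Z) :=
    fun c hc a ha b hb => Submodule.subset_span ⟨c * a * b, S.Z_eq hc ha hb⟩
  have h2 : ∀ c ∈ Subgroup.zpowers P.f, ∀ r s : S.B,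
      zeta P c ⊗ₜ[F] (Matrix.single r s (1 : F)) ∈ Submodule.span F (Set.range S.Z) := by
    classical
    intro c hc r s
    -- Fourier inversion over `A`: averaging `X_a` against `β(a, r)` gives the projection onto
    -- `e_r`, and `X_{rs}` sends `e_s` to `e_r`.
    have e : Matrix.single r s (1 : F) = (Fintype.card S.A : F)⁻¹ •
        ∑ a : S.A, (P.β a r : F) • (S.Xa a * S.Xb (r * s)) := by
      ext x y
      rw [Matrix.smul_apply, Matrix.sum_apply]
      have e1 : ∀ a : S.A, ((P.β a r : F) • (S.Xa a * S.Xb (r * s))) x y =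
          if (x : P.T) = r * s * y then (P.β a (r * x) : F) else 0 := fun a => by
        rw [Matrix.smul_apply, Xa, Matrix.diagonal_mul, Xb, Matrix.of_apply, map_mul,
          Units.val_mul]
        simp
      simp only [e1]
      by_cases hxy : (x : P.T) = r * s * y
      · simp only [if_pos hxy]
        by_cases hx : x = r
        · subst hx
          have hy : s = y := by
            apply Subtype.ext
            rw [mul_assoc] at hxy
            have := left_eq_mul.1 hxy
            rw [mul_eq_one_iff_eq_inv.1 this, P.inv_eq]
          simp [hy, P.sq_eq_one, hA]
        · rw [S.sum_β_eq_zero (mul_mem r.2 x.2), Matrix.single_apply, if_neg]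
          · simp
          · exact fun h => hx h.1.symm
          · intro h
            apply hx
            apply Subtype.ext
            rw [mul_eq_one_iff_eq_inv.1 h, P.inv_eq]
      · simp only [if_neg hxy, Finset.sum_const_zero, smul_zero]
        rw [Matrix.single_apply, if_neg]
        rintro ⟨rfl, rfl⟩
        exact hxy (by rw [mul_assoc, P.sq_eq_one, mul_one])
    rw [e, TensorProduct.tmul_smul, TensorProduct.tmul_sum]
    refine Submodule.smul_mem _ _ (Submodule.sum_mem _ fun a _ => ?_)
    rw [TensorProduct.tmul_smul]
    exact Submodule.smul_mem _ _ (h1 c hc a a.2 _ (mul_mem r.2 s.2))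
  -- The vectors `(1, 1)` and `(1, -1)` span `F × F` because `2` is invertible.
  have h3 : ∀ x : F × F, ∃ p q : F, x = p • zeta P 1 + q • zeta P P.f := fun x => by
    refine ⟨(x.1 + x.2) / 2, (x.1 - x.2) / 2, ?_⟩
    rw [zeta, zeta, if_pos rfl, if_neg P.f_ne_one]
    ext
    · simp
      field_simp
      ring
    · simp
      field_simp
      ring
  rw [eq_top_iff]
  rintro x -
  induction x using TensorProduct.induction_on with
  | zero => exact Submodule.zero_mem _
  | add x y hx hy => exact Submodule.add_mem _ hx hy
  | tmul c M =>
    obtain ⟨p, q, rfl⟩ := h3 c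
    rw [Matrix.matrix_eq_sum_single M, TensorProduct.tmul_sum]
    refine Submodule.sum_mem _ fun r _ => ?_
    rw [TensorProduct.tmul_sum]
    refine Submodule.sum_mem _ fun s _ => ?_
    have : Matrix.single r s (M r s) = M r s • Matrix.single r s (1 : F) := by
      rw [Matrix.smul_single, smul_eq_mul, mul_one]
    rw [this, TensorProduct.tmul_smul, TensorProduct.add_tmul]
    refine Submodule.smul_mem _ _ (Submodule.add_mem _ ?_ ?_)
    · exact Submodule.smul_mem _ _ (h2 1 (one_mem _) r s)
    · exact Submodule.smul_mem _ _ (h2 P.f (Subgroup.mem_zpowers _) r s)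

theorem grading_mk (t : P.T) : S.grading (GSharp.mk (t : G) 0) = S.comp t := by
  rw [grading]
  apply le_antisymm
  · refine iSup₂_le fun s hs => ?_
    have : s = t := Subtype.ext (congrArg Prod.fst hs)
    rw [this]
  · exact le_iSup₂ (f := fun (s : P.T) (_ : GSharp.mk (s : G) 0 = GSharp.mk (t : G) 0) => S.comp s)
      t rfl

theorem Z_mem (t : P.T) : S.Z t ∈ S.grading (GSharp.mk (t : G) 0) := by
  rw [grading_mk, comp_eq]
  exact Submodule.mem_span_singleton_self _

theorem exists_of_mem_grading {g : GSharp G} {d : S.Alg} (hd : d ∈ S.grading g) (h0 : d ≠ 0) :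
    ∃ t : P.T, g = GSharp.mk (t : G) 0 ∧ ∃ x : F, d = x • S.Z t := by
  by_cases h : ∃ t : P.T, GSharp.mk (t : G) 0 = g
  · obtain ⟨t, rfl⟩ := h
    rw [grading_mk, comp_eq] at hd
    obtain ⟨x, rfl⟩ := Submodule.mem_span_singleton.1 hd
    exact ⟨t, rfl, x, rfl⟩
  · push Not at h
    have : S.grading g = ⊥ := by
      rw [grading, eq_bot_iff]
      exact iSup₂_le fun t ht => absurd ht (h t)
    rw [this] at hd
    exact absurd hd h0

theorem isAlgGrading (hF : (2 : F) ≠ 0) : IsAlgGrading S.grading := by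
  refine isAlgGrading_of_family (e := fun t : P.T => GSharp.mk (t : G) 0)
    (S.Z_linearIndependent hF) (S.span_Z hF) S.Z_mem
    (fun g d hd h0 => S.exists_of_mem_grading hd h0) fun s t => ?_
  obtain ⟨ε, -, h⟩ := S.Z_mul s t
  exact ⟨s * t, ε, rfl, h⟩

theorem nontrivial : Nontrivial S.Alg :=
  inferInstance

theorem phi0_tmul (c : F × F) (M : Matrix S.B S.B F) :
    S.phi0 (c ⊗ₜ[F] M) = c.swap ⊗ₜ[F] M.transpose := rfl

theorem phi0_mul (x y : S.Alg) : S.phi0 (x * y) = S.phi0 y * S.phi0 x := by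
  induction x using TensorProduct.induction_on with
  | zero => simp
  | add x x' h h' => rw [add_mul, map_add, map_add, mul_add, h, h']
  | tmul c M =>
    induction y using TensorProduct.induction_on with
    | zero => simp
    | add y y' h h' => rw [mul_add, map_add, map_add, add_mul, h, h']
    | tmul c' M' =>
      rw [Algebra.TensorProduct.tmul_mul_tmul, phi0_tmul, phi0_tmul, phi0_tmul,
        Algebra.TensorProduct.tmul_mul_tmul, mul_comm c, Matrix.transpose_mul, Prod.swap_mul]

theorem phi0_phi0 (x : S.Alg) : S.phi0 (S.phi0 x) = x := by
  induction x using TensorProduct.induction_on with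
  | zero => simp
  | add x x' h h' => rw [map_add, map_add, h, h']
  | tmul c M => rw [phi0_tmul, phi0_tmul, Prod.swap_swap, Matrix.transpose_transpose]

theorem phi0_Z (t : P.T) : ∃ ε : F, (ε = 1 ∨ ε = -1) ∧ S.phi0 (S.Z t) = ε • S.Z t := by
  obtain ⟨c, hc, a, ha, b, hb, rfl, h⟩ := S.Z_spec t
  have h1 : (S.Xa a * S.Xb b).transpose = (P.β a b : F) • (S.Xa a * S.Xb b) := by
    rw [Matrix.transpose_mul, Xb_transpose, Xa, Matrix.diagonal_transpose]
    exact S.Xb_mul_Xa a b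
  rw [h, elt, phi0_tmul, h1]
  rcases P.mem_zpowers.1 hc with rfl | rfl
  · refine ⟨P.β a b, P.β_eq _ _, ?_⟩
    have : (zeta P 1).swap = zeta P 1 := by simp [zeta]
    rw [this, TensorProduct.tmul_smul]
  · refine ⟨-P.β a b, ?_, ?_⟩
    · rcases P.β_eq a b with h | h <;> simp [h]
    · have : (zeta P P.f).swap = - zeta P P.f := by simp [zeta, P.f_ne_one]
      rw [this, TensorProduct.tmul_smul, TensorProduct.neg_tmul, smul_neg]
      exact (neg_smul _ _).symm

theorem Z_ne_zero (t : P.T) : S.Z t ≠ 0 :=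
  (S.Z_isUnit t).ne_zero

theorem phi0_Z_eta (t : P.T) : S.phi0 (S.Z t) = S.eta t • S.Z t := by
  obtain ⟨ε, -, h⟩ := S.phi0_Z t
  have h1 : ∃ s : F, ∀ d ∈ S.comp t, S.phi0 d = s • d := ⟨ε, fun d hd => by
    rw [comp_eq] at hd
    obtain ⟨x, rfl⟩ := Submodule.mem_span_singleton.1 hd
    rw [map_smul, h, smul_comm]⟩
  refine Classical.epsilon_spec h1 (S.Z t) ?_
  rw [comp_eq]
  exact Submodule.mem_span_singleton_self _

theorem phi0_eq_eta_smul {t : P.T} {d : S.Alg} (hd : d ∈ S.comp t) : S.phi0 d = S.eta t • d := by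
  rw [comp_eq] at hd
  obtain ⟨x, rfl⟩ := Submodule.mem_span_singleton.1 hd
  rw [map_smul, phi0_Z_eta, smul_comm]

theorem eta_eq (t : P.T) : S.eta t = 1 ∨ S.eta t = -1 := by
  obtain ⟨ε, hε, h⟩ := S.phi0_Z t
  rw [phi0_Z_eta] at h
  have := smul_left_injective F (S.Z_ne_zero t) h
  rwa [this]

theorem eta_f : S.eta P.f = -1 := by
  have h := S.phi0_Z_eta P.f
  have h1 : S.phi0 (S.Z P.f) = (-1 : F) • S.Z P.f := by
    have e : ((1 : F), (-1 : F)).swap = (-1 : F) • ((1 : F), (-1 : F)) := by simp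
    rw [Z_f, phi0_tmul, Matrix.transpose_one, e, TensorProduct.smul_tmul']
  rw [h1] at h
  exact (smul_left_injective F (S.Z_ne_zero P.f) h).symm

/-- Thus `eta` is a quadratic form on `T` with polarization `β`. -/
theorem eta_mul (s t : P.T) : S.eta (s * t) = S.eta s * S.eta t * P.β s t := by
  obtain ⟨ε, hε, h⟩ := S.Z_mul s t
  have hε0 : ε ≠ 0 := by rcases hε with rfl | rfl <;> simp
  exact antimul_scalar_mul S.phi0_mul (S.Z_ne_zero (s * t)) hε0 (S.phi0_Z_eta s) (S.phi0_Z_eta t)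
    (S.phi0_Z_eta (s * t)) (P.β_symm s t ▸ S.Z_comm t s) h

theorem isGradedDivision (hF : (2 : F) ≠ 0) : IsGradedDivision S.grading where
  grading := S.isAlgGrading hF
  nontrivial := S.nontrivial
  isUnit h d hd h0 := by
    obtain ⟨t, rfl, x, rfl⟩ := S.exists_of_mem_grading hd h0
    have hx : x ≠ 0 := by
      rintro rfl
      rw [zero_smul] at h0
      exact h0 rfl
    exact isUnit_smul_of_ne_zero hx (S.Z_isUnit t)

theorem isInvolutiveDivision (hF : (2 : F) ≠ 0) : IsInvolutiveDivision S.grading S.phi0 where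
  division := S.isGradedDivision hF
  even g hg := by
    rw [eq_bot_iff]
    intro d hd
    by_contra h0
    obtain ⟨t, rfl, -⟩ := S.exists_of_mem_grading hd h0
    exact hg rfl
  scalar d hd := by
    have : (1 : GSharp G) = GSharp.mk ((1 : P.T) : G) 0 := rfl
    rw [this, grading_mk, comp_eq, Z_one] at hd
    obtain ⟨x, rfl⟩ := Submodule.mem_span_singleton.1 hd
    exact ⟨x, rfl⟩
  antimul := S.phi0_mul
  invol := S.phi0_phi0
  map_mem h d hd := by
    by_cases h0 : d = 0
    · rw [h0, map_zero]
      exact Submodule.zero_mem _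
    obtain ⟨t, rfl, x, rfl⟩ := S.exists_of_mem_grading hd h0
    rw [map_smul, phi0_Z_eta]
    exact Submodule.smul_mem _ _ (Submodule.smul_mem _ _ (S.Z_mem t))
  sq h d hd h0 := by
    obtain ⟨t, rfl, -⟩ := S.exists_of_mem_grading hd h0
    refine Prod.ext ?_ ?_
    · exact congrArg Subtype.val (P.sq_eq_one t)
    · rfl

theorem Z_f_comm (d : S.Alg) : S.Z P.f * d = d * S.Z P.f := by
  rw [Z_f]
  induction d using TensorProduct.induction_on with
  | zero => simp
  | add x x' h h' => rw [mul_add, add_mul, h, h']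
  | tmul c M =>
    rw [Algebra.TensorProduct.tmul_mul_tmul, Algebra.TensorProduct.tmul_mul_tmul, Matrix.one_mul,
      Matrix.mul_one, mul_comm]

/-- Central homogeneous elements live in degrees `1` and `f`, and `phi0` negates the second. This is
the condition under which `IsSuperHermitian.degree_eq` determines the degree of a form. -/
theorem eq_one_of_central (hF : (2 : F) ≠ 0) (g : GSharp G) (z : S.Alg) (hz : z ∈ S.grading g)
    (hc : ∀ d, z * d = d * z) (hφ : S.phi0 z = z) (h0 : z ≠ 0) : g = 1 := by
  obtain ⟨t, rfl, x, rfl⟩ := S.exists_of_mem_grading hz h0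
  have hx : x ≠ 0 := by
    rintro rfl
    rw [zero_smul] at h0
    exact h0 rfl
  have h1 : ∀ s, P.β t s = 1 := fun s => by
    have h2 := hc (S.Z s)
    rw [smul_mul_assoc, mul_smul_comm, Z_comm] at h2
    have h3 := smul_right_injective S.Alg hx h2
    have h4 : (P.β t s : F) • (S.Z s * S.Z t) = (1 : F) • (S.Z s * S.Z t) := by rw [h3, one_smul]
    exact Units.ext (smul_left_injective F ((S.Z_isUnit s).mul (S.Z_isUnit t)).ne_zero h4)
  rcases (P.mem_rad t).1 h1 with rfl | rfl
  · rfl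
  · rw [map_smul, phi0_Z_eta, eta_f, smul_comm] at hφ
    exact absurd (eq_zero_of_neg_smul_eq hF hφ) h0

end StdRealization

end Std

/-! ### Fibres and monomial matrices -/

section Fibres

theorem exists_equiv_of_card_fiber {ι ι' Q : Type*} [Finite ι] [Finite ι'] (c : ι → Q) (c' : ι' → Q)
    (h : ∀ q, Nat.card {p // c p = q} = Nat.card {p // c' p = q}) :
    ∃ σ : ι ≃ ι', ∀ p, c' (σ p) = c p := by
  let e (q) : {p // c p = q} ≃ {p // c' p = q} := Classical.choice (Finite.card_eq.1 (h q))
  refine ⟨(Equiv.sigmaFiberEquiv c).symm.trans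
    ((Equiv.sigmaCongrRight e).trans (Equiv.sigmaFiberEquiv c')), fun p => ?_⟩
  exact (e (c p) ⟨p, rfl⟩).2

theorem sum_eq_sum_fiber {ι Q M : Type*} [Fintype ι] [AddCommMonoid M] {c : ι → Q} {q : Q}
    [DecidablePred fun i => c i = q] {f : ι → M} (h : ∀ i, c i ≠ q → f i = 0) :
    ∑ i, f i = ∑ i : {i // c i = q}, f i := by
  rw [← Finset.sum_subtype (Finset.univ.filter fun i => c i = q) (by simp) f, Finset.sum_filter]
  refine Finset.sum_congr rfl fun i _ => ?_
  split_ifs with hi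
  · rfl
  · exact h i hi

variable {D : Type*} [Ring D] {ι ι' : Type*} [Fintype ι] [DecidableEq ι] [Fintype ι']
  [DecidableEq ι']

/-- Nonzero entries join indices of equal class, so `P` and its inverse restrict to mutually inverse
blocks; each block is square by invariance of basis number. -/
theorem card_fiber_eq_of_invertible [InvariantBasisNumber D] {Q : Type*} {c : ι → Q} {c' : ι' → Q}
    {P : Matrix ι ι' D} {P' : Matrix ι' ι D} (h1 : P * P' = 1) (h2 : P' * P = 1)
    (h : ∀ i j, P i j ≠ 0 → c i = c' j) (q : Q) :
    Nat.card {i // c i = q} = Nat.card {j // c' j = q} := by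
  classical
  rw [Nat.card_eq_fintype_card, Nat.card_eq_fintype_card]
  let A : Matrix {i // c i = q} {j // c' j = q} D := P.submatrix Subtype.val Subtype.val
  let B : Matrix {j // c' j = q} {i // c i = q} D := P'.submatrix Subtype.val Subtype.val
  refine Matrix.square_of_invertible A B ?_ ?_
  · ext i k
    have h3 : (P * P') i k = ∑ j : {j // c' j = q}, P i j * P' j k := by
      rw [Matrix.mul_apply]
      refine sum_eq_sum_fiber fun j hj => ?_
      by_cases h0 : P i j = 0
      · rw [h0, zero_mul]
      · exact absurd ((h i j h0).symm.trans i.2) hj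
    change ∑ j : {j // c' j = q}, P i j * P' j k = _
    rw [← h3, h1, Matrix.one_apply, Matrix.one_apply]
    simp only [Subtype.ext_iff]
  · ext j k
    have h3 : (P' * P) j k = ∑ i : {i // c i = q}, P' j i * P i k := by
      rw [Matrix.mul_apply]
      refine sum_eq_sum_fiber fun i hi => ?_
      by_cases h0 : P i k = 0
      · rw [h0, mul_zero]
      · exact absurd ((h i k h0).trans k.2) hi
    change ∑ i : {i // c i = q}, P' j i * P i k = _
    rw [← h3, h2, Matrix.one_apply, Matrix.one_apply]
    simp only [Subtype.ext_iff]

theorem isUnit_of_monomial [Nontrivial D] {Φ : Matrix ι ι D}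
    (h : ∀ p, ∃ q, IsUnit (Φ p q) ∧ ∀ q', q' ≠ q → Φ p q' = 0)
    (hs : ∀ p q, Φ p q ≠ 0 → Φ q p ≠ 0) : IsUnit Φ := by
  choose π hπ hπ' using h
  choose v hv hv' using fun p => exists_mul_eq_one (hπ p)
  -- Each row has one nonzero entry, and the zero pattern is symmetric; hence the partner map is an
  -- involution, from which the inverse matrix can be written down.
  have hinv : ∀ p, π (π p) = p := fun p => by
    by_contra hne
    exact hs _ _ (hπ p).ne_zero (hπ' _ _ (Ne.symm hne))
  let Ψ : Matrix ι ι D := Matrix.of fun q p => if q = π p then v p else 0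
  have hΨ : ∀ q p, Ψ q p = if q = π p then v p else 0 := fun _ _ => rfl
  have h1 : Φ * Ψ = 1 := by
    ext p p'
    rw [Matrix.mul_apply, Finset.sum_eq_single (π p)]
    · rw [hΨ]
      by_cases hpp : p = p'
      · subst hpp
        rw [if_pos rfl, hv, Matrix.one_apply_eq]
      · rw [if_neg, mul_zero, Matrix.one_apply_ne hpp]
        intro h
        exact hpp (by rw [← hinv p, h, hinv])
    · intro q _ hq
      rw [hπ' p q hq, zero_mul]
    · simp
  have h2 : Ψ * Φ = 1 := by
    ext q s
    rw [Matrix.mul_apply, Finset.sum_eq_single (π q)]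
    · rw [hΨ, if_pos (hinv q).symm]
      by_cases hqs : q = s
      · subst hqs
        have := hv' (π q)
        rw [hinv] at this
        rw [this, Matrix.one_apply_eq]
      · rw [hπ' (π q) s (by rw [hinv]; exact Ne.symm hqs), mul_zero, Matrix.one_apply_ne hqs]
    · intro p _ hp
      rw [hΨ, if_neg, zero_mul]
      rintro rfl
      exact hp (hinv p).symm
    · simp
  exact ⟨⟨Φ, Ψ, h1, h2⟩, rfl⟩

end Fibres

/-! ### Nondegenerate skew-symmetric matrices. -/

section Skew

theorem even_card_of_skew {F : Type*} [Field F] (hF : (2 : F) ≠ 0) {ι : Type*} [Fintype ι]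
    [DecidableEq ι] {a : Matrix ι ι F} (h : ∀ i j, a j i = -a i j) (hdet : a.det ≠ 0) :
    Even (Fintype.card ι) := by
  by_contra hodd
  rw [Nat.not_even_iff_odd] at hodd
  have h1 : a.transpose = -a := Matrix.ext fun i j => h i j
  have h2 := Matrix.det_transpose a
  rw [h1, Matrix.det_neg, hodd.neg_one_pow] at h2
  have h3 : 2 * a.det = 0 := by linear_combination -h2
  exact hdet ((mul_eq_zero.1 h3).resolve_left hF)

end Skew

theorem mul_neg_one_smul {R M : Type*} [Ring R] [AddCommGroup M] [Module R M] (a : R) (x : M) :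
    (a * -1) • x = a • -x := by
  rw [mul_neg_one, neg_smul, smul_neg]

theorem neg_mul_neg_one_smul {R M : Type*} [Ring R] [AddCommGroup M] [Module R M] (a : R) (x : M) :
    -((a * -1) • x) = a • x := by
  rw [mul_neg_one, neg_smul, neg_neg]

/-! ### The models are defined by super-Hermitian forms -/

section Model

variable {F : Type u} [Field F] {G : Type v} [CommGroup G] {P : ExPair F G}

/-- The class of a degree modulo the support of the graded-division algebra. -/
def ExPair.cl (P : ExPair F G) (g : GSharp G) : (G ⧸ P.T) × ZMod 2 := (QuotientGroup.mk g.1, g.par)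

namespace ExChoices

variable (C : ExChoices P)

theorem X_isUnit (t : P.T) : IsUnit (C.X t) := by
  have h := C.X_mem t
  rw [StdRealization.comp_eq] at h
  obtain ⟨x, hx⟩ := Submodule.mem_span_singleton.1 h
  rw [← hx]
  refine isUnit_smul_of_ne_zero ?_ (C.Z_isUnit t)
  rintro rfl
  rw [zero_smul] at hx
  exact C.X_ne_zero t hx.symm

theorem X_mem_grading (t : P.T) : C.X t ∈ C.grading (GSharp.mk (t : G) 0) := by
  rw [StdRealization.grading_mk]
  exact C.X_mem t

theorem phi0_X (t : P.T) : C.phi0 (C.X t) = C.eta t • C.X t :=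
  C.phi0_eq_eta_smul (C.X_mem t)

theorem evenEntry_mem (h₀ : G) (i : ZMod 2) (x y : G ⧸ P.T) (k j j' : ℕ) :
    C.evenEntry h₀ i x y k j j' ∈ C.grading (GSharp.mk (h₀ * C.ξ x * C.ξ y) 0) := by
  unfold evenEntry
  split_ifs with ht
  · exact C.X_mem_grading ⟨_, ht⟩
  · exact Submodule.zero_mem _
  · exact C.X_mem_grading ⟨_, ht⟩
  · exact Submodule.neg_mem _ (C.X_mem_grading ⟨_, ht⟩)
  · exact Submodule.zero_mem _
  · exact C.X_mem_grading ⟨_, ht⟩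
  · exact Submodule.smul_mem _ _ (C.X_mem_grading ⟨_, ht⟩)
  · exact Submodule.zero_mem _
  · exact Submodule.zero_mem _

theorem mem_T_iff (h₀ : G) (x y : G ⧸ P.T) :
    h₀ * C.ξ x * C.ξ y ∈ P.T ↔ y = (QuotientGroup.mk h₀ : G ⧸ P.T)⁻¹ * x⁻¹ := by
  rw [← QuotientGroup.eq_one_iff, QuotientGroup.mk_mul, QuotientGroup.mk_mul, C.ξ_spec, C.ξ_spec,
    ← mul_inv_rev, mul_comm x, eq_comm (a := y), inv_eq_iff_mul_eq_one]

theorem parSign_mul_eta (i : ZMod 2) (t : P.T) :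
    parSign F i * C.eta t = 1 ∨ parSign F i * C.eta t = -1 := by
  rcases i.two_cases with rfl | rfl <;> rcases C.eta_eq t with h | h <;> simp [h]

theorem evenEntry_herm {h₀ : G} {i : ZMod 2} {x y : G ⧸ P.T} {k k' j j' : ℕ}
    (hk : x = y → k = k')
    (hev : ∀ h : h₀ * C.ξ x * C.ξ x ∈ P.T, parSign F i * C.eta ⟨_, h⟩ ≠ 1 → j < k → Even k)
    (hj : j < k) :
    C.phi0 (C.evenEntry h₀ i y x k' j' j) = parSign F i • C.evenEntry h₀ i x y k j j' := by
  have hcomm : h₀ * C.ξ y * C.ξ x = h₀ * C.ξ x * C.ξ y := by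
    rw [mul_assoc, mul_comm (C.ξ y), mul_assoc]
  have hss := parSign_mul_self (F := F) i
  by_cases ht : h₀ * C.ξ x * C.ξ y ∈ P.T
  · have ht' : h₀ * C.ξ y * C.ξ x ∈ P.T := hcomm ▸ ht
    have he : (⟨_, ht'⟩ : P.T) = ⟨_, ht⟩ := Subtype.ext hcomm
    unfold evenEntry
    rw [dif_pos ht, dif_pos ht', he]
    generalize htt : (⟨_, ht⟩ : P.T) = t at *
    have heta : C.eta t = parSign F i * (parSign F i * C.eta t) := by
      rw [← mul_assoc, hss, one_mul]
    by_cases hxy : x = y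
    · obtain rfl := hk hxy
      subst hxy
      rw [if_pos rfl, if_pos rfl]
      split_ifs with h1
      all_goals first | omega | skip
      · rw [phi0_X, heta, h1, mul_one]
      · rw [map_zero, smul_zero]
      -- Here both offsets occur at once, which forces `k / 2 = 0`; an even `k > j` rules this out.
      · have := hev ht (by rw [htt]; exact h1) hj
        obtain ⟨r, hr⟩ := this
        omega
      · rw [phi0_X, heta, (C.parSign_mul_eta i t).resolve_left h1]
        exact mul_neg_one_smul (parSign F i) (C.X t)
      · rw [map_neg, phi0_X, heta, (C.parSign_mul_eta i t).resolve_left h1]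
        exact neg_mul_neg_one_smul _ _
      · rw [map_zero, smul_zero]
    · rw [if_neg hxy, if_neg (Ne.symm hxy)]
      by_cases hjj : j = j'
      · rw [if_pos hjj, if_pos hjj.symm]
        let _ := C.order
        rcases lt_or_gt_of_ne hxy with hlt | hlt
        · rw [if_neg (show ¬ C.order.lt y x from not_lt_of_gt hlt), if_pos (show C.order.lt x y from hlt), map_smul, phi0_X, smul_smul]
          congr 1
          rcases C.eta_eq t with h | h <;> simp [h]
        · rw [if_pos (show C.order.lt y x from hlt), if_neg (show ¬ C.order.lt x y from not_lt_of_gt hlt), phi0_X, smul_smul]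
          congr 1
      · rw [if_neg hjj, if_neg (Ne.symm hjj), map_zero, smul_zero]
  · have ht' : h₀ * C.ξ y * C.ξ x ∉ P.T := hcomm ▸ ht
    unfold evenEntry
    rw [dif_neg ht, dif_neg ht', map_zero, smul_zero]

/-- The coset `x` pairs only with `h₀⁻¹x⁻¹`, which has the same multiplicity by duality. Within that
block the partner of `j` is `j` itself or, in the skew case, `j` displaced by half of the even block
size. -/
theorem evenEntry_row {h₀ : G} {i : ZMod 2} {m : G ⧸ P.T → ℕ}
    (hdual : ∀ x, m x = m ((QuotientGroup.mk h₀ : G ⧸ P.T)⁻¹ * x⁻¹))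
    (hev : ∀ x, ∀ h : h₀ * C.ξ x * C.ξ x ∈ P.T, parSign F i * C.eta ⟨_, h⟩ ≠ 1 → Even (m x))
    (x : G ⧸ P.T) {j : ℕ} (hj : j < m x) :
    ∃ y j', j' < m y ∧ IsUnit (C.evenEntry h₀ i x y (m x) j j') ∧
      ∀ y' j'', j'' < m y' → ¬ (y' = y ∧ j'' = j') → C.evenEntry h₀ i x y' (m x) j j'' = 0 := by
  set y := (QuotientGroup.mk h₀ : G ⧸ P.T)⁻¹ * x⁻¹ with hy
  have ht : h₀ * C.ξ x * C.ξ y ∈ P.T := (C.mem_T_iff h₀ x y).2 rfl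
  have hother : ∀ y', y' ≠ y → ∀ j'', C.evenEntry h₀ i x y' (m x) j j'' = 0 := fun y' hy' j'' => by
    unfold evenEntry
    rw [dif_neg]
    exact fun h => hy' ((C.mem_T_iff h₀ x y').1 h)
  suffices h : ∃ j', j' < m y ∧ IsUnit (C.evenEntry h₀ i x y (m x) j j') ∧
      ∀ j'', j'' < m y → j'' ≠ j' → C.evenEntry h₀ i x y (m x) j j'' = 0 by
    obtain ⟨j', h1, h2, h3⟩ := h
    refine ⟨y, j', h1, h2, fun y' j'' hj'' hne => ?_⟩
    by_cases hyy : y' = y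
    · subst hyy
      exact h3 j'' hj'' fun h => hne ⟨rfl, h⟩
    · exact hother y' hyy j''
  have hmy : m y = m x := (hdual x).symm
  unfold evenEntry
  simp only [dif_pos ht]
  by_cases hxy : x = y
  · simp only [if_pos hxy]
    by_cases h1 : parSign F i * C.eta ⟨_, ht⟩ = 1
    · simp only [if_pos h1]
      refine ⟨j, by omega, ?_, fun j'' _ hne => ?_⟩
      · rw [if_pos rfl]
        exact C.X_isUnit _
      · rw [if_neg (Ne.symm hne)]
    · simp only [if_neg h1]
      have hE : Even (m x) := by
        have ht2 : h₀ * C.ξ x * C.ξ x ∈ P.T := by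
          have := ht
          rwa [← hxy] at this
        refine hev x ht2 ?_
        have : (⟨_, ht2⟩ : P.T) = ⟨_, ht⟩ := 
          Subtype.ext (congrArg (fun z => h₀ * C.ξ x * C.ξ z) hxy)
        rwa [this]
      obtain ⟨r, hr⟩ := hE
      have hr2 : m x / 2 = r := by omega
      rw [hr2]
      by_cases hjr : j < r
      · refine ⟨j + r, by omega, ?_, fun j'' _ hne => ?_⟩
        · rw [if_pos rfl]
          exact C.X_isUnit _
        · rw [if_neg (Ne.symm hne), if_neg (by omega)]
      · refine ⟨j - r, by omega, ?_, fun j'' _ hne => ?_⟩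
        · rw [if_neg (by omega), if_pos (by omega)]
          exact (C.X_isUnit _).neg
        · rw [if_neg (by omega), if_neg (by omega)]
  · simp only [if_neg hxy]
    refine ⟨j, by omega, ?_, fun j'' _ hne => ?_⟩
    · rw [if_pos rfl]
      split_ifs
      · exact C.X_isUnit _
      · refine isUnit_smul_of_ne_zero ?_ (C.X_isUnit _)
        rcases C.parSign_mul_eta i ⟨_, ht⟩ with h | h <;> rw [h] <;> simp
    · rw [if_neg (Ne.symm hne)]

theorem idx_ext {μ : G ⧸ P.T →₀ ℕ} {a b : Idx (P := P) μ} (h1 : (a.1 : G ⧸ P.T) = b.1)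
    (h2 : (a.2 : ℕ) = b.2) : a = b := by
  obtain ⟨⟨x, hx⟩, j⟩ := a
  obtain ⟨⟨y, hy⟩, j'⟩ := b
  dsimp only at h1 h2
  subst h1
  obtain rfl : j = j' := Fin.ext h2
  rfl

theorem exists_idx {μ : G ⧸ P.T →₀ ℕ} {x : G ⧸ P.T} {j : ℕ} (h : j < μ x) :
    ∃ a : Idx (P := P) μ, (a.1 : G ⧸ P.T) = x ∧ (a.2 : ℕ) = j :=
  ⟨⟨⟨x, Finsupp.mem_support_iff.2 (by omega)⟩, ⟨j, h⟩⟩, rfl, rfl⟩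

variable {C}

theorem IsAdmissible.even' {κ : ZMod 2 → (G ⧸ P.T →₀ ℕ)} {g₀ : GSharp G}
    (hκ : C.IsAdmissible κ g₀) (h0 : g₀.par = 0) (i : ZMod 2) (x : G ⧸ P.T)
    (h : g₀.1 * C.ξ x * C.ξ x ∈ P.T) (hne : parSign F i * C.eta ⟨_, h⟩ ≠ 1) : Even (κ i x) := by
  have h' : g₀.1 * C.ξ x ^ 2 ∈ P.T := by
    rw [sq, ← mul_assoc]
    exact h
  have := hκ.even h0 i (C.ξ x) h' ?_
  · rwa [C.ξ_spec] at this
  · have e : (⟨_, h'⟩ : P.T) = ⟨_, h⟩ := Subtype.ext (by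
      change g₀.1 * C.ξ x ^ 2 = g₀.1 * C.ξ x * C.ξ x
      rw [sq, ← mul_assoc])
    rw [e]
    have := (C.parSign_mul_eta i ⟨_, h⟩).resolve_left hne
    rw [← one_mul (C.eta _), ← parSign_mul_self (F := F) i, mul_assoc, this, mul_neg_one]

end ExChoices

end Model

section ModelForm

theorem GSharp.ext_par {G : Type v} {a b : GSharp G} (h : a.1 = b.1) (h' : a.par = b.par) : a = b :=
  Prod.ext h h'

variable {F : Type u} [Field F] {G : Type v} [CommGroup G] {P : ExPair F G}

namespace ExChoices

variable {C : ExChoices P} {κ : ZMod 2 → (G ⧸ P.T →₀ ℕ)} {g₀ : GSharp G}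

theorem oddMult_of_even (h : g₀.par = 0) : oddMult κ g₀ = κ 1 := if_pos h

theorem oddMult_of_odd (h : g₀.par ≠ 0) : oddMult κ g₀ = κ 0 := if_neg h

theorem deg_inr_of_even (h : g₀.par = 0) (a : Idx (oddMult κ g₀)) :
    C.deg κ g₀ (Sum.inr a) = GSharp.mk (C.ξ a.1) 1 := if_pos h

theorem deg_inr_of_odd (h : g₀.par ≠ 0) (a : Idx (oddMult κ g₀)) :
    C.deg κ g₀ (Sum.inr a) = GSharp.mk ((C.ξ a.1)⁻¹ * g₀.1⁻¹) 1 := if_neg h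

theorem isUnit_Phi_of_row
    (h : ∀ p, ∃ q, IsUnit (C.Phi κ g₀ p q) ∧ ∀ q', q' ≠ q → C.Phi κ g₀ p q' = 0)
    (herm : ∀ p q, C.phi0 (C.Phi κ g₀ q p) =
      parSign F ((C.deg κ g₀ p).par * (C.deg κ g₀ q).par) • C.Phi κ g₀ p q) :
    IsUnit (C.Phi κ g₀) := by
  have := C.nontrivial
  refine isUnit_of_monomial h fun p q h0 h1 => ?_
  have := herm p q
  rw [h1, map_zero] at this
  exact h0 ((smul_eq_zero.1 this.symm).resolve_left (parSign_ne_zero _))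

theorem isSuperHermitian_Phi_of_even (hκ : C.IsAdmissible κ g₀)
    (h : g₀.par = 0) : IsSuperHermitian C.grading C.phi0 (C.deg κ g₀) g₀ (C.Phi κ g₀) := by
  have h11 (a b) : C.Phi κ g₀ (Sum.inl a) (Sum.inl b) =
      C.evenEntry g₀.1 0 a.1 b.1 (κ 0 a.1) a.2 b.2 := if_pos h
  have h22 (a b) : C.Phi κ g₀ (Sum.inr a) (Sum.inr b) =
      C.evenEntry g₀.1 1 a.1 b.1 (oddMult κ g₀ a.1) a.2 b.2 := if_pos h
  have h12 (a b) : C.Phi κ g₀ (Sum.inl a) (Sum.inr b) = 0 := if_pos h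
  have h21 (a b) : C.Phi κ g₀ (Sum.inr a) (Sum.inl b) = 0 := if_pos h
  have hd1 (a) : C.deg κ g₀ (Sum.inl a) = GSharp.mk (C.ξ a.1) 0 := rfl
  have hd2 := deg_inr_of_even (C := C) (κ := κ) h
  have hκ0 := fun x => hκ.dual 0 x
  have hκ1 := fun x => hκ.dual 1 x
  rw [h, add_zero] at hκ0 hκ1
  rw [← oddMult_of_even (κ := κ) h] at hκ1
  have hev0 := hκ.even' h 0
  have hev1 := hκ.even' h 1
  rw [← oddMult_of_even (κ := κ) h] at hev1
  have herm : ∀ p q, C.phi0 (C.Phi κ g₀ q p) =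
      parSign F ((C.deg κ g₀ p).par * (C.deg κ g₀ q).par) • C.Phi κ g₀ p q := by
    rintro (a | a) (b | b)
    · rw [h11, h11, hd1, hd1, C.evenEntry_herm (fun e => by rw [e])
        (fun ht hne _ => hev0 _ ht hne) a.2.2]
      rfl
    · rw [h21, h12, map_zero, smul_zero]
    · rw [h12, h21, map_zero, smul_zero]
    · rw [h22, h22, hd2, hd2, C.evenEntry_herm (fun e => by rw [e])
        (fun ht hne _ => hev1 _ ht hne) a.2.2]
      rfl
  refine ⟨?_, herm, isUnit_Phi_of_row ?_ herm⟩
  · rintro (a | a) (b | b)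
    · rw [h11, hd1, hd1]
      refine IsAlgGrading.mem_congr (C.evenEntry_mem _ _ _ _ _ _ _) (GSharp.ext_par rfl ?_)
      simp [GSharp.par_mul, GSharp.par_mk, h]
    · rw [h12]
      exact Submodule.zero_mem _
    · rw [h21]
      exact Submodule.zero_mem _
    · rw [h22, hd2, hd2]
      refine IsAlgGrading.mem_congr (C.evenEntry_mem _ _ _ _ _ _ _) (GSharp.ext_par rfl ?_)
      simp [GSharp.par_mul, GSharp.par_mk, h, ZMod.two_add_self]
  · rintro (a | a)
    · obtain ⟨y, j', hj', h1, h2⟩ := C.evenEntry_row hκ0 hev0 a.1 a.2.2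
      obtain ⟨b, rfl, rfl⟩ := exists_idx hj'
      refine ⟨Sum.inl b, by rw [h11]; exact h1, ?_⟩
      rintro (b' | b') hb'
      · rw [h11]
        exact h2 _ _ b'.2.2 fun h => hb' (congrArg Sum.inl (idx_ext h.1 h.2))
      · exact h12 _ _
    · obtain ⟨y, j', hj', h1, h2⟩ := C.evenEntry_row hκ1 hev1 a.1 a.2.2
      obtain ⟨b, rfl, rfl⟩ := exists_idx hj'
      refine ⟨Sum.inr b, by rw [h22]; exact h1, ?_⟩
      rintro (b' | b') hb'
      · exact h21 _ _
      · rw [h22]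
        exact h2 _ _ b'.2.2 fun h => hb' (congrArg Sum.inr (idx_ext h.1 h.2))

theorem isSuperHermitian_Phi_of_odd (hF : (2 : F) ≠ 0) (h : g₀.par ≠ 0) :
    IsSuperHermitian C.grading C.phi0 (C.deg κ g₀) g₀ (C.Phi κ g₀) := by
  classical
  have h' : g₀.par = 1 := g₀.par.two_cases.resolve_left h
  have h11 (a b) : C.Phi κ g₀ (Sum.inl a) (Sum.inl b) = 0 := if_neg h
  have h22 (a b) : C.Phi κ g₀ (Sum.inr a) (Sum.inr b) = 0 := if_neg h
  have h12 (a b) : C.Phi κ g₀ (Sum.inl a) (Sum.inr b) =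
    if (a.1 : G ⧸ P.T) = b.1 ∧ (a.2 : ℕ) = b.2 then 1 else 0 := if_neg h
  have h21 (a b) : C.Phi κ g₀ (Sum.inr a) (Sum.inl b) =
    if (a.1 : G ⧸ P.T) = b.1 ∧ (a.2 : ℕ) = b.2 then 1 else 0 := if_neg h
  have hd1 (a) : C.deg κ g₀ (Sum.inl a) = GSharp.mk (C.ξ a.1) 0 := rfl
  have hd2 := deg_inr_of_odd (C := C) (κ := κ) h
  have hone : (1 : C.Alg) ∈ C.grading 1 := (C.isAlgGrading hF).one_mem
  have hphi1 : C.phi0 (1 : C.Alg) = 1 := (C.isInvolutiveDivision hF).map_one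
  have hu1 : IsUnit (1 : C.Alg) := isUnit_one
  have herm : ∀ p q, C.phi0 (C.Phi κ g₀ q p) =
      parSign F ((C.deg κ g₀ p).par * (C.deg κ g₀ q).par) • C.Phi κ g₀ p q := by
    rintro (a | a) (b | b)
    · rw [h11, h11, map_zero, smul_zero]
    · rw [h21, h12, hd1, hd2, GSharp.par_mk, zero_mul, parSign_zero, one_smul]
      simp only [eq_comm (a := ((b.1 : G ⧸ P.T)))]
      simp only [eq_comm (a := (b.2 : ℕ))]
      split_ifs
      · exact hphi1
      · exact map_zero _
    · rw [h12, h21, hd1, hd2, GSharp.par_mk, GSharp.par_mk, mul_zero, parSign_zero, one_smul]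
      simp only [eq_comm (a := ((b.1 : G ⧸ P.T)))]
      simp only [eq_comm (a := (b.2 : ℕ))]
      split_ifs
      · exact hphi1
      · exact map_zero _
    · rw [h22, h22, map_zero, smul_zero]
  refine ⟨?_, herm, isUnit_Phi_of_row ?_ herm⟩
  · rintro (a | a) (b | b)
    · rw [h11]
      exact Submodule.zero_mem _
    · rw [h12, hd1, hd2]
      split_ifs with he
      · refine IsAlgGrading.mem_congr hone (GSharp.ext_par ?_ ?_)
        · change 1 = g₀.1 * C.ξ a.1 * ((C.ξ b.1)⁻¹ * g₀.1⁻¹)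
          rw [he.1]
          group
        · simp [GSharp.par_mul, GSharp.par_mk, GSharp.par_one, h', ZMod.two_add_self]
      · exact Submodule.zero_mem _
    · rw [h21, hd1, hd2]
      split_ifs with he
      · refine IsAlgGrading.mem_congr hone (GSharp.ext_par ?_ ?_)
        · change 1 = g₀.1 * ((C.ξ a.1)⁻¹ * g₀.1⁻¹) * C.ξ b.1
          rw [he.1, mul_comm (_)⁻¹, mul_inv_cancel_left, inv_mul_cancel]
        · simp [GSharp.par_mul, GSharp.par_mk, GSharp.par_one, h', ZMod.two_add_self]
      · exact Submodule.zero_mem _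
    · rw [h22]
      exact Submodule.zero_mem _
  · rintro (a | a)
    · have hj : (a.2 : ℕ) < oddMult κ g₀ a.1 := by
        rw [oddMult_of_odd h]
        exact a.2.2
      obtain ⟨b, hb1, hb2⟩ := exists_idx hj
      refine ⟨Sum.inr b, by rw [h12, if_pos ⟨hb1.symm, hb2.symm⟩]; exact hu1, ?_⟩
      rintro (b' | b') hb'
      · exact h11 _ _
      · rw [h12, if_neg]
        exact fun e => hb' (congrArg Sum.inr (idx_ext (e.1.symm.trans hb1.symm) (e.2.symm.trans hb2.symm)))
    · have hj : (a.2 : ℕ) < κ 0 a.1 := by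
        rw [← oddMult_of_odd (κ := κ) h]
        exact a.2.2
      obtain ⟨b, hb1, hb2⟩ := exists_idx hj
      refine ⟨Sum.inl b, by rw [h21, if_pos ⟨hb1.symm, hb2.symm⟩]; exact hu1, ?_⟩
      rintro (b' | b') hb'
      · rw [h21, if_neg]
        exact fun e => hb' (congrArg Sum.inl (idx_ext (e.1.symm.trans hb1.symm) (e.2.symm.trans hb2.symm)))
      · exact h22 _ _

theorem isSuperHermitian_Phi (hF : (2 : F) ≠ 0) (hκ : C.IsAdmissible κ g₀) :
    IsSuperHermitian C.grading C.phi0 (C.deg κ g₀) g₀ (C.Phi κ g₀) := by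
  by_cases h : g₀.par = 0
  · exact isSuperHermitian_Phi_of_even hκ h
  · exact isSuperHermitian_Phi_of_odd hF h

/-! ### Counting basis elements -/

theorem card_idx_fiber (μ : G ⧸ P.T →₀ ℕ) (x : G ⧸ P.T) :
    Nat.card {a : Idx (P := P) μ // (a.1 : G ⧸ P.T) = x} = μ x := by
  have e : {a : Idx (P := P) μ // (a.1 : G ⧸ P.T) = x} ≃ Fin (μ x) :=
    Equiv.ofBijective (fun a => ⟨a.1.2, a.1.2.2.trans_eq (congrArg μ a.2)⟩) ⟨fun a b hab =>
      Subtype.ext (idx_ext (a.2.trans b.2.symm) (congrArg Fin.val hab)), fun j => by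
        obtain ⟨a, ha, hj⟩ := exists_idx j.2
        exact ⟨⟨a, ha⟩, Fin.ext hj⟩⟩
  rw [Nat.card_congr e, Nat.card_fin]

/-- The parameter `κ` is recovered from the model as the multiplicities of basis degrees modulo `T`.
This is how it becomes an isomorphism invariant up to shift. -/
theorem card_deg_fiber (hκ : C.IsAdmissible κ g₀) (x : G ⧸ P.T) (i : ZMod 2) :
    Nat.card {p // P.cl (C.deg κ g₀ p) = (x, i)} = κ i x := by
  have hl (a) : P.cl (C.deg κ g₀ (Sum.inl a)) = ((a.1 : G ⧸ P.T), 0) := by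
    change (QuotientGroup.mk (C.ξ a.1), _) = _
    rw [C.ξ_spec]
    rfl
  have hr (a) : P.cl (C.deg κ g₀ (Sum.inr a)) = (if g₀.par = 0 then (a.1 : G ⧸ P.T) else
      (QuotientGroup.mk g₀.1 : G ⧸ P.T)⁻¹ * (a.1 : G ⧸ P.T)⁻¹, 1) := by
    split_ifs with h
    · rw [deg_inr_of_even h]
      change (QuotientGroup.mk (C.ξ a.1), _) = _
      rw [C.ξ_spec]
      rfl
    · rw [deg_inr_of_odd h]
      change (QuotientGroup.mk ((C.ξ a.1)⁻¹ * g₀.1⁻¹), _) = _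
      rw [QuotientGroup.mk_mul, QuotientGroup.mk_inv, QuotientGroup.mk_inv, C.ξ_spec, mul_comm]
      rfl
  rcases i.two_cases with rfl | rfl
  · rw [← card_idx_fiber (κ 0) x]
    refine (Nat.card_congr (Equiv.ofBijective
      (fun a => ⟨Sum.inl a.1, by rw [hl, a.2]⟩) ⟨fun a b hab => ?_, ?_⟩)).symm
    · exact Subtype.ext (Sum.inl_injective (congrArg Subtype.val hab))
    · rintro ⟨a | a, ha⟩
      · rw [hl] at ha
        exact ⟨⟨a, congrArg Prod.fst ha⟩, rfl⟩
      · rw [hr] at ha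
        exact absurd (congrArg Prod.snd ha) one_ne_zero
  · by_cases h : g₀.par = 0
    · rw [← oddMult_of_even (κ := κ) h, ← card_idx_fiber (oddMult κ g₀) x]
      refine (Nat.card_congr (Equiv.ofBijective
        (fun a => ⟨Sum.inr a.1, by rw [hr, if_pos h, a.2]⟩) ⟨fun a b hab => ?_, ?_⟩)).symm
      · exact Subtype.ext (Sum.inr_injective (congrArg Subtype.val hab))
      · rintro ⟨a | a, ha⟩
        · rw [hl] at ha
          exact absurd (congrArg Prod.snd ha) zero_ne_one
        · rw [hr, if_pos h] at ha
          exact ⟨⟨a, congrArg Prod.fst ha⟩, rfl⟩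
    · have h' : g₀.par = 1 := g₀.par.two_cases.resolve_left h
      -- For odd `g₀` the odd basis is indexed by `κ 0`. Duality rewrites `κ 1 x` as the value of `κ
      -- 0` at the dual coset, which the indices of that basis count.
      rw [hκ.dual, h', show (1 : ZMod 2) + 1 = 0 from rfl, ← oddMult_of_odd (κ := κ) h,
        ← card_idx_fiber (oddMult κ g₀)]
      have key (y : G ⧸ P.T) : (QuotientGroup.mk g₀.1 : G ⧸ P.T)⁻¹ * y⁻¹ = x ↔
          y = (QuotientGroup.mk g₀.1 : G ⧸ P.T)⁻¹ * x⁻¹ := by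
        constructor
        · rintro rfl
          rw [mul_inv, inv_inv, inv_inv, inv_mul_cancel_left]
        · rintro rfl
          rw [mul_inv, inv_inv, inv_inv, inv_mul_cancel_left]
      refine (Nat.card_congr (Equiv.ofBijective
        (fun a => ⟨Sum.inr a.1, by rw [hr, if_neg h, (key _).2 a.2]⟩) ⟨fun a b hab => ?_, ?_⟩)).symm
      · exact Subtype.ext (Sum.inr_injective (congrArg Subtype.val hab))
      · rintro ⟨a | a, ha⟩
        · rw [hl] at ha
          exact absurd (congrArg Prod.snd ha) zero_ne_one
        · rw [hr, if_neg h] at ha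
          exact ⟨⟨a, (key _).1 (congrArg Prod.fst ha)⟩, rfl⟩

theorem nonempty_modelIdx (hκ : C.IsAdmissible κ g₀) : Nonempty (ModelIdx κ g₀) := by
  obtain ⟨i, x, h⟩ : ∃ i x, κ i x ≠ 0 := by
    rcases hκ.ne_zero with h | h
    · exact ⟨0, Finsupp.ne_iff.1 h⟩
    · exact ⟨1, Finsupp.ne_iff.1 h⟩
  rw [← card_deg_fiber hκ] at h
  exact ⟨(Nat.card_ne_zero.1 h).1.some.1⟩

end ExChoices

end ModelForm

/-! ### Admissibility of an arbitrary form and its reduction to a model. -/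

section NormalForm

variable {F : Type u} [Field F] {G : Type v} [CommGroup G] {P : ExPair F G}

theorem ExPair.cl_eq_iff {a b : GSharp G} :
    P.cl a = P.cl b ↔ ∃ t : P.T, a⁻¹ * b = GSharp.mk (t : G) 0 := by
  constructor
  · intro h
    have h1 := congrArg Prod.fst h
    have h2 : a.par = b.par := congrArg (fun q : (G ⧸ P.T) × ZMod 2 => q.2) h
    refine ⟨⟨a.1⁻¹ * b.1, QuotientGroup.eq.1 h1⟩, GSharp.ext_par rfl ?_⟩
    rw [GSharp.par_mul, GSharp.par_inv, h2, ZMod.two_add_self]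
    rfl
  · rintro ⟨t, ht⟩
    refine Prod.ext ?_ ?_
    · refine QuotientGroup.eq.2 ?_
      have := congrArg Prod.fst ht
      change a.1⁻¹ * b.1 = t at this
      rw [this]
      exact t.2
    · have := congrArg GSharp.par ht
      rw [GSharp.par_mul, GSharp.par_inv, GSharp.par_mk] at this
      change a.par = b.par
      rw [← add_zero a.par, ← this, ← add_assoc, ZMod.two_add_self, zero_add]

namespace StdRealization

variable (S : StdRealization P)

theorem exists_ne_zero_iff {a b : GSharp G} :
    (∃ d ∈ S.grading (a⁻¹ * b), d ≠ 0) ↔ P.cl a = P.cl b := by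
  rw [ExPair.cl_eq_iff]
  constructor
  · rintro ⟨d, hd, h0⟩
    obtain ⟨t, ht, -⟩ := S.exists_of_mem_grading hd h0
    exact ⟨t, ht⟩
  · rintro ⟨t, ht⟩
    exact ⟨S.Z t, ht ▸ S.Z_mem t, S.Z_ne_zero t⟩

instance : FiniteDimensional F S.Alg := inferInstance

instance : InvariantBasisNumber S.Alg :=
  have := S.nontrivial
  have : IsNoetherianRing S.Alg := IsNoetherianRing.of_finite F S.Alg
  inferInstance

/-- The class dual to a given one with respect to a form of degree `g₀`. -/
def dualCl (P : ExPair F G) (g₀ : GSharp G) (q : (G ⧸ P.T) × ZMod 2) : (G ⧸ P.T) × ZMod 2 :=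
  ((QuotientGroup.mk g₀.1 : G ⧸ P.T)⁻¹ * q.1⁻¹, q.2 + g₀.par)

theorem dualCl_dualCl (g₀ : GSharp G) (q : (G ⧸ P.T) × ZMod 2) :
    dualCl P g₀ (dualCl P g₀ q) = q := by
  refine Prod.ext ?_ ?_
  · simp only [dualCl, mul_inv, inv_inv, inv_mul_cancel_left]
  · simp only [dualCl, add_assoc, ZMod.two_add_self, add_zero]

variable {S} {ι ι' : Type*} [Fintype ι] [DecidableEq ι] [Fintype ι'] [DecidableEq ι']
  {γ : ι → GSharp G} {γ' : ι' → GSharp G} {g₀ : GSharp G} {Φ : Matrix ι ι S.Alg}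
  {Φ' : Matrix ι' ι' S.Alg}

theorem cl_eq_dualCl (hΦ : IsSuperHermitian S.grading S.phi0 γ g₀ Φ) {p q : ι} (h : Φ p q ≠ 0) :
    P.cl (γ p) = dualCl P g₀ (P.cl (γ q)) := by
  have h1 : dualCl P g₀ (P.cl (γ q)) = P.cl ((g₀ * γ q)⁻¹) := by
    refine Prod.ext ?_ ?_
    · change _ = QuotientGroup.mk ((g₀.1 * (γ q).1)⁻¹)
      rw [mul_inv, QuotientGroup.mk_mul]
      rfl
    · change (γ q).par + g₀.par = ((g₀ * γ q)⁻¹).par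
      rw [GSharp.par_inv, GSharp.par_mul, add_comm]
  rw [h1, eq_comm, ← S.exists_ne_zero_iff]
  refine ⟨_, IsAlgGrading.mem_congr (hΦ.mem p q) ?_, h⟩
  rw [inv_inv, mul_right_comm]

/-- A nonzero entry of `Φ` links a class only with its dual, so invertibility of `Φ` equates the two
multiplicities. -/
theorem card_fiber_dual (hΦ : IsSuperHermitian S.grading S.phi0 γ g₀ Φ)
    (q : (G ⧸ P.T) × ZMod 2) :
    Nat.card {p // P.cl (γ p) = q} = Nat.card {p // P.cl (γ p) = dualCl P g₀ q} := by
  obtain ⟨Ψ, h1, h2⟩ := exists_mul_eq_one hΦ.isUnit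
  rw [card_fiber_eq_of_invertible (c := fun p => P.cl (γ p))
    (c' := fun p => dualCl P g₀ (P.cl (γ p))) h1 h2 (fun p q => cl_eq_dualCl hΦ) q]
  refine Nat.card_congr (Equiv.subtypeEquivRight fun p => ?_)
  constructor
  · intro h
    rw [← h, dualCl_dualCl]
  · intro h
    rw [h, dualCl_dualCl]

/-- On this self-dual class, rescaling the basis vectors to the common degree `(g, i)` turns the
Gram block into a scalar matrix `a` times `Z t`. The sign of `eta t` makes `a` skew-symmetric, and
nondegeneracy of `Φ` makes it invertible. -/
theorem even_card_fiber (hF : (2 : F) ≠ 0) (hΦ : IsSuperHermitian S.grading S.phi0 γ g₀ Φ)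
    (h0 : g₀.par = 0) (i : ZMod 2) (g : G) (ht : g₀.1 * g ^ 2 ∈ P.T)
    (heta : S.eta ⟨g₀.1 * g ^ 2, ht⟩ = -parSign F i) :
    Even (Nat.card {p // P.cl (γ p) = P.cl (GSharp.mk g i)}) := by
  classical
  set q₀ := P.cl (GSharp.mk g i) with hq₀
  set t : P.T := ⟨g₀.1 * g ^ 2, ht⟩ with htt
  have hs : ∀ p : {p // P.cl (γ p) = q₀}, ∃ s : P.T, (GSharp.mk g i)⁻¹ * γ p = GSharp.mk (s : G) 0 :=
    fun p => ExPair.cl_eq_iff.1 p.2.symm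
  choose s hs using hs
  have hγ : ∀ p : {p // P.cl (γ p) = q₀}, γ p = GSharp.mk g i * GSharp.mk (s p : G) 0 := fun p => by
    rw [← hs, mul_inv_cancel_left]
  have hpar : ∀ p : {p // P.cl (γ p) = q₀}, (γ p).par = i := fun p => by
    rw [hγ, GSharp.par_mul, GSharp.par_mk, GSharp.par_mk, add_zero]
  have hD := S.isInvolutiveDivision hF
  -- The factors `Z (s p)` and `Z (s q)` cancel the degrees by which the basis vectors deviate from
  -- `(g, i)`, since `T` has exponent 2.
  have hmem : ∀ p q : {p // P.cl (γ p) = q₀},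
      S.phi0 (S.Z (s p)) * Φ p q * S.Z (s q) ∈ S.comp t := fun p q => by
    rw [← grading_mk]
    refine IsAlgGrading.mem_congr (hD.division.grading.mul_mem _ _ _
      (hD.division.grading.mul_mem _ _ _ (hD.map_mem _ _ (S.Z_mem (s p))) _ (hΦ.mem p q)) _
      (S.Z_mem (s q))) (GSharp.ext_par ?_ ?_)
    · rw [hγ, hγ]
      change (s p : G) * (g₀.1 * (g * s p) * (g * s q)) * s q = g₀.1 * g ^ 2
      have h1 : (s p : G) * s p = 1 := congrArg Subtype.val (P.sq_eq_one (s p))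
      have h2 : (s q : G) * s q = 1 := congrArg Subtype.val (P.sq_eq_one (s q))
      calc (s p : G) * (g₀.1 * (g * s p) * (g * s q)) * s q
          = g₀.1 * g ^ 2 * ((s p : G) * s p) * ((s q : G) * s q) := by
            rw [sq]
            simp only [mul_comm, mul_left_comm]
        _ = _ := by rw [h1, h2, mul_one, mul_one]
    · simp only [GSharp.par_mul, GSharp.par_mk, hpar, h0, zero_add, add_zero, ZMod.two_add_self]
  have ha : ∀ p q : {p // P.cl (γ p) = q₀}, ∃ x : F,
      S.phi0 (S.Z (s p)) * Φ p q * S.Z (s q) = x • S.Z t := fun p q => by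
    have := hmem p q
    rw [comp_eq] at this
    obtain ⟨x, hx⟩ := Submodule.mem_span_singleton.1 this
    exact ⟨x, hx.symm⟩
  choose a ha using ha
  have hskew : ∀ p q, a q p = -a p q := fun p q => by
    have h1 := congrArg S.phi0 (ha p q)
    rw [phi0_mul, phi0_mul, phi0_phi0, map_smul, S.phi0_Z_eta t, heta, hΦ.herm q p, hpar, hpar,
      ZMod.two_mul_self, smul_mul_assoc, mul_smul_comm, ← mul_assoc, ha q p, smul_smul,
      smul_smul] at h1
    have h2 := smul_left_injective F (S.Z_ne_zero t) h1
    have h3 : parSign F i * (a q p + a p q) = 0 := by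
      linear_combination h2
    have := (mul_eq_zero.1 h3).resolve_left (parSign_ne_zero _)
    linear_combination this
  rw [Nat.card_eq_fintype_card]
  refine even_card_of_skew hF (a := Matrix.of a) hskew fun hdet => ?_
  obtain ⟨v, hv0, hv⟩ := Matrix.exists_vecMul_eq_zero_iff.2 hdet
  -- A kernel vector of `a`, extended by zero and multiplied by the rescaling factors, is
  -- annihilated by `Φ`: the class is its own dual, so columns outside it contribute nothing.
  let w : ι → S.Alg := fun p => if h : P.cl (γ p) = q₀ then v ⟨p, h⟩ • S.phi0 (S.Z (s ⟨p, h⟩)) else 0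
  have hw1 : ∀ p : {p // P.cl (γ p) = q₀}, w p = v p • S.phi0 (S.Z (s p)) := fun p => dif_pos p.2
  have hw0 : ∀ p, P.cl (γ p) ≠ q₀ → w p = 0 := fun p hp => dif_neg hp
  have hdual : dualCl P g₀ q₀ = q₀ := by
    refine Prod.ext ?_ ?_
    · change (QuotientGroup.mk g₀.1 : G ⧸ P.T)⁻¹ * (QuotientGroup.mk g : G ⧸ P.T)⁻¹ =
        QuotientGroup.mk g
      rw [← QuotientGroup.mk_inv, ← QuotientGroup.mk_inv, ← QuotientGroup.mk_mul]
      refine QuotientGroup.eq.2 ?_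
      rwa [mul_inv, inv_inv, inv_inv, mul_assoc, ← sq]
    · change i + g₀.par = i
      rw [h0, add_zero]
  have hwΦ : Matrix.vecMul w Φ = 0 := by
    funext q
    change ∑ p, w p * Φ p q = 0
    by_cases hq : P.cl (γ q) = q₀
    · rw [sum_eq_sum_fiber (c := fun p => P.cl (γ p)) (q := q₀)
        (fun p hp => by rw [hw0 p hp, zero_mul])]
      obtain ⟨z, hz, -⟩ := exists_mul_eq_one (S.Z_isUnit (s ⟨q, hq⟩))
      have h1 : ∀ p : {p // P.cl (γ p) = q₀}, w p * Φ p q = (v p * a p ⟨q, hq⟩) • (S.Z t * z) :=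
        fun p => by
        have h2 : S.phi0 (S.Z (s p)) * Φ p q = a p ⟨q, hq⟩ • (S.Z t * z) := by
          rw [← smul_mul_assoc, ← ha, mul_assoc, hz, mul_one]
        rw [hw1, smul_mul_assoc, h2, smul_smul]
      rw [Finset.sum_congr rfl fun p _ => h1 p, ← Finset.sum_smul]
      have h3 := congrFun hv ⟨q, hq⟩
      change ∑ p, v p * a p ⟨q, hq⟩ = 0 at h3
      rw [h3, zero_smul]
    · refine Finset.sum_eq_zero fun p _ => ?_
      by_cases hp : P.cl (γ p) = q₀
      · by_cases hz : Φ p q = 0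
        · rw [hz, mul_zero]
        · refine absurd ?_ hq
          have h1 := cl_eq_dualCl hΦ hz
          rw [hp] at h1
          rw [← dualCl_dualCl g₀ (P.cl (γ q)), ← h1, hdual]
      · rw [hw0 p hp, zero_mul]
  obtain ⟨Ψ, h1, -⟩ := exists_mul_eq_one hΦ.isUnit
  have hw : w = 0 := by
    have := congrArg (fun x => Matrix.vecMul x Ψ) hwΦ
    simpa only [Matrix.vecMul_vecMul, h1, Matrix.vecMul_one, Matrix.zero_vecMul] using this
  refine hv0 (funext fun p => ?_)
  have h2 : v p • S.phi0 (S.Z (s p)) = 0 := by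
    rw [← hw1, hw]
    rfl
  rw [phi0_Z_eta] at h2
  refine (smul_eq_zero.1 h2).resolve_right ?_
  rw [smul_eq_zero]
  rintro (h3 | h3)
  · rcases S.eta_eq (s p) with h | h <;> rw [h] at h3 <;> simp at h3
  · exact S.Z_ne_zero _ h3

theorem gradedSuperinvIso_of_card [IsAlgClosed F] (hF : (2 : F) ≠ 0)
    (hΦ : IsSuperHermitian S.grading S.phi0 γ g₀ Φ)
    (hΦ' : IsSuperHermitian S.grading S.phi0 γ' g₀ Φ')
    (h : ∀ q, Nat.card {p // P.cl (γ p) = q} = Nat.card {p // P.cl (γ' p) = q}) :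
    GradedSuperinvIso (endGrading S.grading γ) (superAdj S.phi0 (fun p => (γ p).par) Φ)
      (endGrading S.grading γ') (superAdj S.phi0 (fun p => (γ' p).par) Φ') := by
  obtain ⟨σ, hσ⟩ := exists_equiv_of_card_fiber (fun p => P.cl (γ p)) (fun p => P.cl (γ' p)) h
  exact hΦ.gradedSuperinvIso hF (S.isInvolutiveDivision hF) hΦ' σ fun p =>
    S.exists_ne_zero_iff.2 (hσ p)

end StdRealization

namespace ExChoices

open StdRealization

variable (C : ExChoices P) {ι : Type*} [Fintype ι] [DecidableEq ι]
  {γ : ι → GSharp G} {g₀ : GSharp G} {Φ : Matrix ι ι C.Alg}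

theorem exists_isAdmissible_gradedSuperinvIso [IsAlgClosed F] (hF : (2 : F) ≠ 0) [Nonempty ι]
    (hΦ : IsSuperHermitian C.grading C.phi0 γ g₀ Φ) :
    ∃ κ, C.IsAdmissible κ g₀ ∧ GradedSuperinvIso (endGrading C.grading γ)
      (superAdj C.phi0 (fun p => (γ p).par) Φ) (C.modelGrading κ g₀) (C.modelInv κ g₀) := by
  let κ : ZMod 2 → (G ⧸ P.T →₀ ℕ) := fun i =>
    Finsupp.ofSupportFinite (fun x => Nat.card {p // P.cl (γ p) = (x, i)}) (by
      refine (Set.finite_range fun p => (P.cl (γ p)).1).subset fun x hx => ?_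
      obtain ⟨⟨p, hp⟩⟩ := (Nat.card_ne_zero.1 hx).1
      exact ⟨p, congrArg Prod.fst hp⟩)
  have hκ' : ∀ i x, κ i x = Nat.card {p // P.cl (γ p) = (x, i)} := fun _ _ => rfl
  have hκ : C.IsAdmissible κ g₀ := by
    refine ⟨fun i x => ?_, fun h0 i g h heta => ?_, ?_⟩
    · rw [hκ', hκ', card_fiber_dual hΦ]
      rfl
    · exact even_card_fiber hF hΦ h0 i g h heta
    · obtain ⟨p⟩ := ‹Nonempty ι›
      have h1 : κ (P.cl (γ p)).2 (P.cl (γ p)).1 ≠ 0 := by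
        rw [hκ', Nat.card_ne_zero]
        exact ⟨⟨⟨p, rfl⟩⟩, inferInstance⟩
      have h2 : κ (P.cl (γ p)).2 ≠ 0 := fun h => h1 (by rw [h]; rfl)
      rcases (P.cl (γ p)).2.two_cases with h | h <;> rw [h] at h2
      · exact Or.inl h2
      · exact Or.inr h2
  exact ⟨κ, hκ, gradedSuperinvIso_of_card hF hΦ (isSuperHermitian_Phi hF hκ) fun q =>
    (card_deg_fiber hκ q.1 q.2).symm⟩

end ExChoices

end NormalForm

/-! ### Algebra isomorphisms compatible with gradings. -/

section GradedEquiv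

/-- By the modular law, `B i` is the join of `A i` with a part of `⨆ j ≠ i, B j` lying in `B i`, and
that part is `⊥`. Hence an isomorphism that maps components into components maps them onto. -/
theorem eq_of_le_of_iSupIndep {L κ : Type*} [CompleteLattice L] [IsModularLattice L] {A B : κ → L}
    (hAB : ∀ i, A i ≤ B i) (hB : iSupIndep B) (hA : ⨆ i, A i = ⊤) (i : κ) : A i = B i := by
  refine le_antisymm (hAB i) ?_
  have h1 : A i ⊔ ⨆ (j) (_ : j ≠ i), A j = ⊤ := by
    rw [eq_top_iff, ← hA]
    refine iSup_le fun j => ?_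
    by_cases hj : j = i
    · exact hj ▸ le_sup_left
    · exact le_sup_of_le_right (le_iSup₂_of_le j hj le_rfl)
  have h2 := sup_inf_assoc_of_le (⨆ (j) (_ : j ≠ i), A j) (hAB i)
  rw [h1, top_inf_eq] at h2
  rw [h2]
  refine sup_le le_rfl (le_trans ?_ bot_le)
  exact (le_inf (inf_le_right) (inf_le_left.trans (iSup₂_mono fun j _ => hAB j))).trans
    (hB i).le_bot

variable {F : Type u} [Field F] {R R' : Type*} [Ring R] [Algebra F R] [Ring R'] [Algebra F R']
  {H : Type*}

theorem map_eq_of_iSupIndep {𝒜 : H → Submodule F R} {𝒜' : H → Submodule F R'}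
    (h𝒜 : ⨆ h, 𝒜 h = ⊤) (h𝒜' : iSupIndep 𝒜') (ψ : R ≃ₐ[F] R') (h : ∀ g, ∀ r ∈ 𝒜 g, ψ r ∈ 𝒜' g)
    (g : H) : (𝒜 g).map (ψ : R →ₗ[F] R') = 𝒜' g := by
  refine eq_of_le_of_iSupIndep (A := fun g => (𝒜 g).map (ψ : R →ₗ[F] R')) (fun g => ?_) h𝒜' ?_ g
  · rintro _ ⟨r, hr, rfl⟩
    exact h g r hr
  · rw [← Submodule.map_iSup, h𝒜, Submodule.map_top, LinearMap.range_eq_top]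
    exact ψ.surjective

theorem symm_mem_of_iSupIndep {𝒜 : H → Submodule F R} {𝒜' : H → Submodule F R'}
    (h𝒜 : ⨆ h, 𝒜 h = ⊤) (h𝒜' : iSupIndep 𝒜') (ψ : R ≃ₐ[F] R') (h : ∀ g, ∀ r ∈ 𝒜 g, ψ r ∈ 𝒜' g)
    (g : H) (r : R') (hr : r ∈ 𝒜' g) : ψ.symm r ∈ 𝒜 g := by
  rw [← map_eq_of_iSupIndep h𝒜 h𝒜' ψ h g] at hr
  obtain ⟨s, hs, rfl⟩ := hr
  exact (ψ.symm_apply_apply s).symm ▸ hs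

end GradedEquiv

/-! ### Invariants of a graded isomorphism. -/

section Classification

variable {F : Type u} [Field F] {G : Type v} [CommGroup G]

theorem ExPair.ext_of_eq {P P' : ExPair F G} (hT : P.T = P'.T)
    (hβ : ∀ (s t : G) (hs : s ∈ P.T) (ht : t ∈ P.T) (hs' : s ∈ P'.T) (ht' : t ∈ P'.T),
      P.β ⟨s, hs⟩ ⟨t, ht⟩ = P'.β ⟨s, hs'⟩ ⟨t, ht'⟩) : P = P' := by
  obtain ⟨T, hfin, hsq, β, halt, f, hf, hrad⟩ := P
  obtain ⟨T', hfin', hsq', β', halt', f', hf', hrad'⟩ := P'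
  dsimp only at hT
  subst hT
  have hββ : β = β' := by
    ext s t
    exact congrArg Units.val (hβ s t s.2 t.2 s.2 t.2)
  subst hββ
  -- The element `f` carries no information beyond `β`: it is the nontrivial element of the radical.
  have : f = f' := ((hrad' f).1 ((hrad f).2 (Or.inr rfl))).resolve_left hf
  subst this
  rfl

variable {P : ExPair F G}

namespace StdRealization

variable {S : StdRealization P}

/-- `T` is the support of the grading and `β` the commutation factor of its homogeneous elements, so
both are visible in the graded algebra. -/
theorem eq_of_gradedEquiv {P' : ExPair F G} {S' : StdRealization P'}
    (ψ : S.Alg ≃ₐ[F] S'.Alg) (hψ : ∀ h, ∀ d ∈ S.grading h, ψ d ∈ S'.grading h)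
    (hψ' : ∀ h, ∀ d ∈ S'.grading h, ψ.symm d ∈ S.grading h) : P = P' := by
  have hZ : ∀ t : P.T, ∃ t' : P'.T, (t : G) = t' ∧ ∃ x : F, x ≠ 0 ∧ ψ (S.Z t) = x • S'.Z t' := fun t => by
    have h0 : ψ (S.Z t) ≠ 0 := by
      rw [Ne, EmbeddingLike.map_eq_zero_iff]
      exact S.Z_ne_zero t
    obtain ⟨t', h1, x, hx⟩ := S'.exists_of_mem_grading (hψ _ _ (S.Z_mem t)) h0
    refine ⟨t', congrArg Prod.fst h1, x, ?_, hx⟩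
    rintro rfl
    rw [zero_smul] at hx
    exact h0 hx
  refine ExPair.ext_of_eq (le_antisymm (fun t ht => ?_) fun t ht => ?_) ?_
  · obtain ⟨t', h, -⟩ := hZ ⟨t, ht⟩
    change t = _ at h
    rw [h]
    exact t'.2
  · have h0 : ψ.symm (S'.Z ⟨t, ht⟩) ≠ 0 := by
      rw [Ne, EmbeddingLike.map_eq_zero_iff]
      exact S'.Z_ne_zero _
    obtain ⟨t', h1, -⟩ := S.exists_of_mem_grading (hψ' _ _ (S'.Z_mem ⟨t, ht⟩)) h0
    have h2 : t = t' := congrArg Prod.fst h1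
    rw [h2]
    exact t'.2
  · intro s t hs ht hs' ht'
    obtain ⟨s₁, h1, x, hx, hs1⟩ := hZ ⟨s, hs⟩
    obtain ⟨t₁, h2, y, hy, ht1⟩ := hZ ⟨t, ht⟩
    obtain rfl : (⟨s, hs'⟩ : P'.T) = s₁ := Subtype.ext h1
    obtain rfl : (⟨t, ht'⟩ : P'.T) = t₁ := Subtype.ext h2
    have h3 := congrArg ψ (S.Z_comm ⟨s, hs⟩ ⟨t, ht⟩)
    rw [map_mul, map_smul, map_mul, hs1, ht1, smul_mul_smul_comm, smul_mul_smul_comm,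
      S'.Z_comm ⟨s, hs'⟩, smul_smul, smul_smul] at h3
    have h4 : S'.Z ⟨t, ht'⟩ * S'.Z ⟨s, hs'⟩ ≠ 0 := ((S'.Z_isUnit _).mul (S'.Z_isUnit _)).ne_zero
    have h5 := smul_left_injective F h4 h3
    have h6 : x * y * ((P'.β ⟨s, hs'⟩ ⟨t, ht'⟩ : F) - (P.β ⟨s, hs⟩ ⟨t, ht⟩ : F)) = 0 := by
      linear_combination h5
    refine Units.ext ?_
    exact (sub_eq_zero.1 ((mul_eq_zero.1 h6).resolve_left (mul_ne_zero hx hy))).symm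

/-- On each component `phi0` is the scalar `eta t`, and scalars commute with any degree-preserving
linear map. So the coefficient automorphism of a semilinear map is automatically compatible with
`phi0`. -/
theorem gradedEquiv_phi0 (hF : (2 : F) ≠ 0) (ψ : S.Alg ≃ₐ[F] S.Alg)
    (hψ : ∀ h, ∀ d ∈ S.grading h, ψ d ∈ S.grading h) (d : S.Alg) :
    ψ (S.phi0 d) = S.phi0 (ψ d) := by
  have h : d ∈ Submodule.span F (Set.range S.Z) := by
    rw [S.span_Z hF]
    trivial
  induction h using Submodule.span_induction with
  | mem x hx =>
    obtain ⟨t, rfl⟩ := hx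
    have h1 := hψ _ _ (S.Z_mem t)
    rw [grading_mk] at h1
    rw [phi0_Z_eta, map_smul, phi0_eq_eta_smul _ h1]
  | zero => simp
  | add x y _ _ hx hy => rw [map_add, map_add, map_add, map_add, hx, hy]
  | smul a x _ hx => rw [map_smul, map_smul, map_smul, map_smul, hx]

variable {ι ι' : Type*} [Fintype ι] [DecidableEq ι] [Fintype ι'] [DecidableEq ι']
  {γ : ι → GSharp G} {γ' : ι' → GSharp G} {g₀ g₀' : GSharp G} {Φ : Matrix ι ι S.Alg}
  {Φ' : Matrix ι' ι' S.Alg}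

/-- The degree of the form obtained by shifting the degree of the module by `(g, ε)`. -/
def shiftDeg (P : ExPair F G) (g : G) (ε : ZMod 2) (g₀ : GSharp G) : GSharp G :=
  GSharp.mk ((if ε = 0 then 1 else (P.f : G)) * g⁻¹ ^ 2) 0 * g₀

theorem exists_shift (hF : (2 : F) ≠ 0) (hΦ : IsSuperHermitian S.grading S.phi0 γ g₀ Φ) (g : G)
    (ε : ZMod 2) : ∃ Φ₂ : Matrix ι ι S.Alg,
      IsSuperHermitian S.grading S.phi0 (fun p => GSharp.mk g ε * γ p) (shiftDeg P g ε g₀) Φ₂ ∧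
      superAdj S.phi0 (fun p => (GSharp.mk g ε * γ p).par) Φ₂ =
        superAdj S.phi0 (fun p => (γ p).par) Φ := by
  rcases ε.two_cases with rfl | rfl
  · refine ⟨Φ, ?_, ?_⟩
    · rw [shiftDeg, if_pos rfl, one_mul]
      exact hΦ.shift g
    · congr 1
      funext p
      rw [GSharp.par_mul, GSharp.par_mk, zero_add]
  · have hφf : S.phi0 (S.Z P.f) = -S.Z P.f := by
      rw [phi0_Z_eta, eta_f]
      exact neg_one_smul F (S.Z P.f)
    refine ⟨_, ?_, superAdj_parityShift hΦ.isUnit (S.Z_isUnit P.f) S.Z_f_comm γ g⟩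
    rw [shiftDeg, if_neg one_ne_zero]
    exact hΦ.parityShift (S.isInvolutiveDivision hF) g (S.Z_mem P.f) (S.Z_ne_zero _) S.Z_f_comm hφf

omit [Fintype ι] [DecidableEq ι] in
theorem card_shift (γ : ι → GSharp G) (g u : G) (i ε : ZMod 2) :
    Nat.card {p // P.cl (GSharp.mk g ε * γ p) = (QuotientGroup.mk (g * u), i)} =
      Nat.card {p // P.cl (γ p) = (QuotientGroup.mk u, i + ε)} := by
  refine Nat.card_congr (Equiv.subtypeEquivRight fun p => ?_)
  have h1 : P.cl (GSharp.mk g ε * γ p) =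
      (QuotientGroup.mk g * QuotientGroup.mk (γ p).1, ε + (γ p).par) := by
    refine Prod.ext (QuotientGroup.mk_mul _ _ _) ?_
    change (GSharp.mk g ε * γ p).par = _
    rw [GSharp.par_mul, GSharp.par_mk]
  rw [h1, QuotientGroup.mk_mul, Prod.ext_iff, Prod.ext_iff]
  refine and_congr mul_left_cancel_iff ?_
  change ε + (γ p).par = i ↔ (γ p).par = i + ε
  constructor
  · rintro rfl
    rw [add_right_comm, ZMod.two_add_self, zero_add]
  · intro h
    rw [h, add_left_comm, ZMod.two_add_self, add_zero]

theorem exists_shift_of_gradedSuperinvIso (hF : (2 : F) ≠ 0) [Nonempty ι]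
    (hΦ : IsSuperHermitian S.grading S.phi0 γ g₀ Φ)
    (hΦ' : IsSuperHermitian S.grading S.phi0 γ' g₀' Φ')
    (h : GradedSuperinvIso (endGrading S.grading γ) (superAdj S.phi0 (fun p => (γ p).par) Φ)
      (endGrading S.grading γ') (superAdj S.phi0 (fun p => (γ' p).par) Φ')) :
    ∃ g ε, (∀ (i : ZMod 2) (u : G),
        Nat.card {p // P.cl (γ' p) = (QuotientGroup.mk (g * u), i)} =
          Nat.card {p // P.cl (γ p) = (QuotientGroup.mk u, i + ε)}) ∧
      g₀' = shiftDeg P g ε g₀ := by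
  have hD := S.isInvolutiveDivision hF
  obtain ⟨ψ, h1, h2⟩ := h
  obtain ⟨g, ψ₀, A, B, hψ₀, hAB, hBA, hA, -, hψ⟩ := exists_semilinear_of_gradedIso hD.division
    hD.division γ γ' ψ (fun k X hX => by rw [← h1 k]; exact ⟨X, hX, rfl⟩) (fun k X hX => by
      rw [← h1 k] at hX
      obtain ⟨Y, hY, rfl⟩ := hX
      exact (ψ.symm_apply_apply Y).symm ▸ hY)
  obtain ⟨a, ε, rfl⟩ : ∃ a ε, g = GSharp.mk a ε := ⟨g.1, g.par, rfl⟩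
  -- After this shift the change of basis `A` has degree `1`, while the superinvolution of the
  -- source is unchanged. Counting classes and `IsSuperHermitian.degree_eq` then apply.
  obtain ⟨Φ₂, hΦ₂, hadj⟩ := exists_shift hF hΦ a ε
  have hA' : ∀ p i, A p i ∈ S.grading ((γ' p)⁻¹ * (GSharp.mk a ε * γ i)) := fun p i =>
    IsAlgGrading.mem_congr (hA p i) (mul_assoc _ _ _)
  refine ⟨a, ε, fun i u => ?_, ?_⟩
  · rw [← card_shift γ]
    exact card_fiber_eq_of_invertible (c := fun p => P.cl (γ' p)) hAB hBA
      (fun p i h0 => S.exists_ne_zero_iff.1 ⟨_, hA' p i, h0⟩) _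
  · refine (hΦ₂.degree_eq hD (S.eq_one_of_central hF) hΦ' ψ₀ hψ₀ ?_ hAB hBA hA' fun X => ?_).symm
    · intro d
      exact gradedEquiv_phi0 hF ψ₀ hψ₀ d
    · rw [hadj, ← hψ, ← hψ, h2]

end StdRealization

end Classification

/-! ### The isomorphism problem for models. -/

section ModelIso

open StdRealization ExChoices

variable {F : Type u} [Field F] {G : Type v} [CommGroup G]

theorem ExChoices.eq_of_gradedSuperinvIso (hF : (2 : F) ≠ 0) {P P' : ExPair F G} {C : ExChoices P}
    {C' : ExChoices P'} {κ : ZMod 2 → (G ⧸ P.T →₀ ℕ)} {κ' : ZMod 2 → (G ⧸ P'.T →₀ ℕ)}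
    {g₀ g₀' : GSharp G} (hκ : C.IsAdmissible κ g₀)
    (h : GradedSuperinvIso (C.modelGrading κ g₀) (C.modelInv κ g₀)
      (C'.modelGrading κ' g₀') (C'.modelInv κ' g₀')) : P = P' := by
  have := nonempty_modelIdx hκ
  obtain ⟨ψ, h1, -⟩ := h
  have hD := C.isGradedDivision hF
  have hD' := C'.isGradedDivision hF
  obtain ⟨g, ψ₀, A, B, hψ₀, -⟩ := exists_semilinear_of_gradedIso hD
    hD' (C.deg κ g₀) (C'.deg κ' g₀') ψ
    (fun k X hX => by
      have := h1 k
      rw [modelGrading, modelGrading] at this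
      rw [← this]
      exact ⟨X, hX, rfl⟩) (fun k X hX => by
      have := h1 k
      rw [modelGrading, modelGrading] at this
      rw [← this] at hX
      obtain ⟨Y, hY, rfl⟩ := hX
      exact (ψ.symm_apply_apply Y).symm ▸ hY)
  exact eq_of_gradedEquiv ψ₀ hψ₀
    (symm_mem_of_iSupIndep hD.grading.iSup_eq hD'.grading.indep ψ₀ hψ₀)

theorem ExChoices.gradedSuperinvIso_iff_shift [IsAlgClosed F] (hF : (2 : F) ≠ 0) {P : ExPair F G}
    {C : ExChoices P} {κ κ' : ZMod 2 → (G ⧸ P.T →₀ ℕ)} {g₀ g₀' : GSharp G}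
    (hκ : C.IsAdmissible κ g₀) (hκ' : C.IsAdmissible κ' g₀') :
    GradedSuperinvIso (C.modelGrading κ g₀) (C.modelInv κ g₀) (C.modelGrading κ' g₀')
      (C.modelInv κ' g₀') ↔ ∃ (g : G) (ε : ZMod 2),
        (∀ i (u : G), κ' i (QuotientGroup.mk (g * u)) = κ (i + ε) (QuotientGroup.mk u)) ∧
          g₀' = shiftDeg P g ε g₀ := by
  have := nonempty_modelIdx hκ
  have hΦ := isSuperHermitian_Phi hF hκ
  have hΦ' := isSuperHermitian_Phi hF hκ'
  constructor
  · intro h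
    obtain ⟨g, ε, h1, h2⟩ := exists_shift_of_gradedSuperinvIso hF hΦ hΦ' h
    refine ⟨g, ε, fun i u => ?_, h2⟩
    rw [← card_deg_fiber hκ, ← card_deg_fiber hκ', h1]
  · rintro ⟨g, ε, h1, rfl⟩
    -- The shift alters neither the grading of the endomorphism algebra nor the superinvolution, and
    -- brings the first form to the degree and multiplicities of the second.
    obtain ⟨Φ₂, hΦ₂, hadj⟩ := exists_shift hF hΦ g ε
    have h2 := gradedSuperinvIso_of_card hF hΦ₂ hΦ' fun ⟨x, i⟩ => by
      obtain ⟨u, rfl⟩ : ∃ u, x = QuotientGroup.mk (g * u) := by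
        obtain ⟨y, rfl⟩ := QuotientGroup.mk_surjective x
        exact ⟨g⁻¹ * y, by rw [mul_inv_cancel_left]⟩
      rw [card_shift, card_deg_fiber hκ, card_deg_fiber hκ', h1]
    rw [hadj, endGrading_shift] at h2
    exact h2

theorem ExChoices.gradedSuperinvIso_model_iff [IsAlgClosed F] (hF : (2 : F) ≠ 0)
    (C : ∀ P : ExPair F G, ExChoices P) (P P' : ExPair F G) (κ : ZMod 2 → (G ⧸ P.T →₀ ℕ))
    (κ' : ZMod 2 → (G ⧸ P'.T →₀ ℕ)) (g₀ g₀' : GSharp G) (hκ : (C P).IsAdmissible κ g₀)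
    (hκ' : (C P').IsAdmissible κ' g₀') :
      GradedSuperinvIso ((C P).modelGrading κ g₀) ((C P).modelInv κ g₀)
          ((C P').modelGrading κ' g₀') ((C P').modelInv κ' g₀') ↔
        P.T = P'.T ∧
        (∀ (s t : G) (hs : s ∈ P.T) (ht : t ∈ P.T) (hs' : s ∈ P'.T) (ht' : t ∈ P'.T),
          P.β ⟨s, hs⟩ ⟨t, ht⟩ = P'.β ⟨s, hs'⟩ ⟨t, ht'⟩) ∧
        ∃ g : G,
          ((∀ u : G, κ' 0 (QuotientGroup.mk (g * u)) = κ 0 (QuotientGroup.mk u)) ∧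
            (∀ u : G, κ' 1 (QuotientGroup.mk (g * u)) = κ 1 (QuotientGroup.mk u)) ∧
            g₀' = GSharp.mk (g⁻¹ ^ 2) 0 * g₀) ∨
          ((∀ u : G, κ' 0 (QuotientGroup.mk (g * u)) = κ 1 (QuotientGroup.mk u)) ∧
            (∀ u : G, κ' 1 (QuotientGroup.mk (g * u)) = κ 0 (QuotientGroup.mk u)) ∧
            g₀' = GSharp.mk ((P.f : G) * g⁻¹ ^ 2) 0 * g₀) := by
  have h11 : (1 : ZMod 2) + 1 = 0 := rfl
  constructor
  · intro h
    obtain rfl := eq_of_gradedSuperinvIso hF hκ h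
    refine ⟨rfl, fun _ _ _ _ _ _ => rfl, ?_⟩
    obtain ⟨g, ε, h1, h2⟩ := (gradedSuperinvIso_iff_shift hF hκ hκ').1 h
    refine ⟨g, ?_⟩
    rw [shiftDeg] at h2
    rcases ε.two_cases with rfl | rfl
    · rw [if_pos rfl, one_mul] at h2
      exact Or.inl ⟨h1 0, fun u => (h1 1 u).trans (by rw [add_zero]), h2⟩
    · rw [if_neg one_ne_zero] at h2
      exact Or.inr ⟨fun u => (h1 0 u).trans (by rw [zero_add]),
        fun u => (h1 1 u).trans (by rw [h11]), h2⟩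
  · rintro ⟨hT, hβ, g, h⟩
    obtain rfl := ExPair.ext_of_eq hT hβ
    refine (gradedSuperinvIso_iff_shift hF hκ hκ').2 ⟨g, ?_⟩
    rcases h with ⟨h0, h1, h2⟩ | ⟨h0, h1, h2⟩
    · refine ⟨0, fun i u => ?_, ?_⟩
      · rw [add_zero]
        rcases i.two_cases with rfl | rfl
        · exact h0 u
        · exact h1 u
      · rw [shiftDeg, if_pos rfl, one_mul, h2]
    · refine ⟨1, fun i u => ?_, ?_⟩
      · rcases i.two_cases with rfl | rfl
        · rw [zero_add]
          exact h0 u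
        · rw [h11]
          exact h1 u
      · rw [shiftDeg, if_neg one_ne_zero, h2]

end ModelIso

/-! ### Superinvolutions on graded matrix algebras -/

section OpGrading

variable {F : Type u} [Field F] {D : Type*} [Ring D] [Algebra F D] {H : Type*} [CommGroup H]
  {𝒟 : H → Submodule F D}

/-- The grading on the opposite algebra of a graded algebra. -/
def opGrading (𝒟 : H → Submodule F D) (h : H) : Submodule F Dᵐᵒᵖ :=
  (𝒟 h).map (MulOpposite.opLinearEquiv F).toLinearMap

omit [CommGroup H] in
theorem mem_opGrading {h : H} {d : Dᵐᵒᵖ} : d ∈ opGrading 𝒟 h ↔ d.unop ∈ 𝒟 h := by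
  constructor
  · rintro ⟨e, he, rfl⟩
    exact he
  · intro hd
    exact ⟨d.unop, hd, rfl⟩

theorem IsGradedDivision.op (h𝒟 : IsGradedDivision 𝒟) : IsGradedDivision (opGrading 𝒟) where
  grading :=
    { indep := h𝒟.grading.indep.map_orderIso
        (Submodule.orderIsoMapComap (MulOpposite.opLinearEquiv F : D ≃ₗ[F] Dᵐᵒᵖ))
      iSup_eq := by
        have := congrArg (Submodule.map (MulOpposite.opLinearEquiv F : D ≃ₗ[F] Dᵐᵒᵖ).toLinearMap)
          h𝒟.grading.iSup_eq
        rw [Submodule.map_iSup, Submodule.map_top, LinearEquiv.range] at this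
        exact this
      mul_mem := fun g h a ha b hb => by
        rw [mem_opGrading] at ha hb ⊢
        exact IsAlgGrading.mem_congr (h𝒟.grading.mul_mem _ _ _ hb _ ha) (mul_comm _ _) }
  nontrivial :=
    have := h𝒟.nontrivial
    inferInstance
  isUnit h d hd h0 := by
    rw [mem_opGrading] at hd
    have := (h𝒟.isUnit h _ hd fun h1 => h0 (MulOpposite.unop_injective h1)).op
    exact this

end OpGrading

/-! ### Superinvolutions as adjunctions of sesquilinear forms. -/

section Form

variable {F : Type u} [Field F] {G : Type v} [CommGroup G]

/-- A degree-preserving superinvolution on a `G^#`-graded algebra. -/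
structure IsSuperinvolution {R : Type*} [Ring R] [Algebra F R] (𝒜 : GSharp G → Submodule F R)
    (φ : R →ₗ[F] R) : Prop where
  iSup_eq : ⨆ h, 𝒜 h = ⊤
  map_mem : ∀ h, ∀ r ∈ 𝒜 h, φ r ∈ 𝒜 h
  antimul : ∀ g h, ∀ r ∈ 𝒜 g, ∀ s ∈ 𝒜 h, φ (r * s) = parSign F (g.par * h.par) • (φ s * φ r)
  invol : ∀ r, φ (φ r) = r

variable {D : Type*} [Ring D] [Algebra F D] {𝒟 : GSharp G → Submodule F D} {ι : Type*}
  [Fintype ι] [DecidableEq ι] {γ : ι → GSharp G}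

omit [DecidableEq ι] in
-- The sign produced here is the one in the superinvolution axiom, so composing the two yields an
-- ordinary algebra homomorphism. Evenness of `D` lets the parities of basis vectors account for the
-- parities of `X` and `Y` at nonzero entries.
theorem superTr_mul_op (heven : ∀ g : GSharp G, g.par ≠ 0 → 𝒟 g = ⊥) {g h : GSharp G}
    {X Y : Matrix ι ι D} (hX : X ∈ endGrading 𝒟 γ g) (hY : Y ∈ endGrading 𝒟 γ h) :
    (superTr F (fun p => (γ p).par) (X * Y)).map MulOpposite.op =
      parSign F (g.par * h.par) • ((superTr F (fun p => (γ p).par) Y).map MulOpposite.op *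
        (superTr F (fun p => (γ p).par) X).map MulOpposite.op) := by
  ext p q
  rw [Matrix.smul_apply, Matrix.mul_apply, Finset.smul_sum]
  simp only [Matrix.map_apply, superTr, Matrix.of_apply, Matrix.mul_apply, Finset.smul_sum]
  rw [Finset.op_sum]
  refine Finset.sum_congr rfl fun r _ => ?_
  rw [← MulOpposite.op_mul, smul_mul_smul_comm, ← MulOpposite.op_smul, smul_smul]
  by_cases h1 : X q r = 0
  · rw [h1, zero_mul, smul_zero, smul_zero]
  by_cases h2 : Y r p = 0
  · rw [h2, mul_zero, smul_zero, smul_zero]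
  congr 2
  have h3 := par_eq_zero_of_mem heven (hX q r) h1
  have h4 := par_eq_zero_of_mem heven (hY r p) h2
  simp only [GSharp.par_mul, GSharp.par_inv] at h3 h4
  rw [← parSign_add, ← parSign_add]
  congr 1
  revert h3 h4
  generalize (γ p).par = a
  generalize (γ q).par = b
  generalize (γ r).par = c
  generalize g.par = d
  generalize h.par = e
  revert a b c d e
  decide

theorem IsSuperinvolution.map_one {R : Type*} [Ring R] [Algebra F R]
    {𝒜 : GSharp G → Submodule F R} {φ : R →ₗ[F] R} (h : IsSuperinvolution 𝒜 φ)
    (h1 : (1 : R) ∈ 𝒜 1) : φ 1 = 1 := by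
  have := h.antimul 1 1 1 h1 _ (h.map_mem _ _ h1)
  rw [one_mul, h.invol, GSharp.par_one, zero_mul, parSign_zero, one_smul, one_mul] at this
  exact this.symm

theorem IsSuperinvolution.exists_semilinear [Nonempty ι] (h𝒟 : IsGradedDivision 𝒟)
    (heven : ∀ g : GSharp G, g.par ≠ 0 → 𝒟 g = ⊥)
    {φ : Matrix ι ι D →ₗ[F] Matrix ι ι D} (hφ : IsSuperinvolution (endGrading 𝒟 γ) φ) :
    ∃ (φ₀ : D →ₗ[F] D) (g : GSharp G) (P Q : Matrix ι ι D),
      (∀ a b, φ₀ (a * b) = φ₀ b * φ₀ a) ∧ Function.Bijective φ₀ ∧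
      (∀ h, ∀ d ∈ 𝒟 h, φ₀ d ∈ 𝒟 h) ∧ P * Q = 1 ∧ Q * P = 1 ∧
      (∀ p i, P p i ∈ 𝒟 ((γ p)⁻¹ * g⁻¹ * (γ i)⁻¹)) ∧ (∀ i p, Q i p ∈ 𝒟 (g * γ i * γ p)) ∧
      ∀ Y, φ Y = P * (superTr F (fun p => (γ p).par) Y).map φ₀ * Q := by
  let π : ι → ZMod 2 := fun p => (γ p).par
  let Θ : Matrix ι ι D →ₗ[F] Matrix ι ι Dᵐᵒᵖ :=
    { toFun := fun Y => (superTr F π Y).map MulOpposite.op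
      map_add' := fun X Y => by
        ext p q
        simp [superTr]
      map_smul' := fun c X => by
        ext p q
        simp [superTr, smul_comm c] }
  have hΘ : ∀ Y p q, Θ Y p q = MulOpposite.op (parSign F ((π p + π q) * π p) • Y q p) :=
    fun _ _ _ => rfl
  let Θ' : Matrix ι ι Dᵐᵒᵖ → Matrix ι ι D := fun X =>
    Matrix.of fun p q => parSign F ((π p + π q) * π q) • (X q p).unop
  have hΘ' : ∀ X p q, Θ' X p q = parSign F ((π p + π q) * π q) • (X q p).unop := fun _ _ _ => rfl
  have hΘΘ' : ∀ X, Θ (Θ' X) = X := fun X => by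
    ext p q
    rw [hΘ, hΘ', smul_smul, add_comm (π q), parSign_mul_self, one_smul, MulOpposite.op_unop]
  have hΘ'Θ : ∀ Y, Θ' (Θ Y) = Y := fun Y => by
    ext p q
    rw [hΘ', hΘ, MulOpposite.unop_op, smul_smul, add_comm (π q), parSign_mul_self, one_smul]
  have hdeg : ∀ (h : GSharp G) (p q : ι), (γ q)⁻¹ * h * γ p = ((γ p)⁻¹)⁻¹ * h * (γ q)⁻¹ :=
    fun h p q => by
      rw [inv_inv, mul_comm (γ p), mul_assoc, mul_comm (γ q)⁻¹]
  have hΘmem : ∀ h, ∀ Y ∈ endGrading 𝒟 γ h, Θ Y ∈ endGrading (opGrading 𝒟) (fun p => (γ p)⁻¹) h :=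
    fun h Y hY p q => by
      rw [mem_opGrading, hΘ, MulOpposite.unop_op]
      exact Submodule.smul_mem _ _ (IsAlgGrading.mem_congr (hY q p) (hdeg _ _ _))
  have hΘ'mem : ∀ h, ∀ X ∈ endGrading (opGrading 𝒟) (fun p => (γ p)⁻¹) h,
      Θ' X ∈ endGrading 𝒟 γ h := fun h X hX p q => by
    rw [hΘ']
    exact Submodule.smul_mem _ _ (IsAlgGrading.mem_congr (mem_opGrading.1 (hX q p))
      (hdeg _ _ _).symm)
  have hone : φ 1 = 1 := hφ.map_one (one_mem_endGrading h𝒟.grading γ)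
  have hΘone : Θ 1 = 1 := by
    ext p q
    rw [hΘ]
    by_cases hpq : p = q
    · subst hpq
      rw [Matrix.one_apply_eq, Matrix.one_apply_eq, ZMod.two_add_self, zero_mul, parSign_zero,
        one_smul, MulOpposite.op_one]
    · rw [Matrix.one_apply_ne hpq, Matrix.one_apply_ne (Ne.symm hpq), smul_zero,
        MulOpposite.op_zero]
  have hmul : ∀ X Y, (Θ ∘ₗ φ) (X * Y) = (Θ ∘ₗ φ) X * (Θ ∘ₗ φ) Y := by
    have htop : ∀ X : Matrix ι ι D, X ∈ ⨆ h, endGrading 𝒟 γ h := fun X => by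
      rw [hφ.iSup_eq]
      trivial
    intro X Y
    induction htop X using Submodule.iSup_induction' with
    | zero => simp
    | add X X' _ _ hX hX' => rw [add_mul, map_add, map_add, hX, hX', add_mul]
    | mem g X hX =>
      induction htop Y using Submodule.iSup_induction' with
      | zero => simp
      | add Y Y' _ _ hY hY' => rw [mul_add, map_add, map_add, hY, hY', mul_add]
      | mem h Y hY =>
        have h1 : Θ (φ Y * φ X) = parSign F (h.par * g.par) • (Θ (φ X) * Θ (φ Y)) :=
          superTr_mul_op heven (hφ.map_mem _ _ hY) (hφ.map_mem _ _ hX)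
        rw [LinearMap.comp_apply, hφ.antimul g h X hX Y hY, map_smul, h1, smul_smul,
          mul_comm h.par, parSign_mul_self, one_smul]
        rfl
  let ρ : Matrix ι ι D ≃ₐ[F] Matrix ι ι Dᵐᵒᵖ :=
    AlgEquiv.ofBijective (AlgHom.ofLinearMap (Θ ∘ₗ φ) (by rw [LinearMap.comp_apply, hone, hΘone])
      hmul) ⟨fun X Y hXY => by
        have h1 : Θ (φ X) = Θ (φ Y) := hXY
        rw [← hφ.invol X, ← hΘ'Θ (φ X), h1, hΘ'Θ, hφ.invol], fun X => ⟨φ (Θ' X), by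
        change Θ (φ (φ (Θ' X))) = X
        rw [hφ.invol, hΘΘ']⟩⟩
  have hρ : ∀ X, ρ X = Θ (φ X) := fun _ => rfl
  have hρ' : ∀ X, ρ.symm X = φ (Θ' X) := fun X => by
    rw [AlgEquiv.symm_apply_eq, hρ, hφ.invol, hΘΘ']
  -- The inverse `ρ.symm` is used because `ρ.symm (Θ Y) = φ Y`: its semilinear description is
  -- already a formula for `φ`. The coefficient isomorphism from `Dᵐᵒᵖ` to `D` is read as an
  -- antiautomorphism of `D`.
  obtain ⟨g, ψ₀, P, Q, hψ₀, hPQ, hQP, hP, hQ, h⟩ := exists_semilinear_of_gradedIso h𝒟.op h𝒟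
    (fun p => (γ p)⁻¹) γ ρ.symm (fun k X hX => by
      rw [hρ']
      exact hφ.map_mem _ _ (hΘ'mem _ _ hX)) (fun k X hX => by
      rw [AlgEquiv.symm_symm, hρ]
      exact hΘmem _ _ (hφ.map_mem _ _ hX))
  refine ⟨ψ₀.toLinearMap ∘ₗ (MulOpposite.opLinearEquiv F).toLinearMap, g⁻¹, P, Q, fun a b => ?_,
    ψ₀.bijective.comp (MulOpposite.opLinearEquiv F).bijective, fun k d hd => ?_, hPQ, hQP,
    fun p i => ?_, fun i p => ?_, fun Y => ?_⟩
  · exact map_mul ψ₀ _ _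
  · exact hψ₀ k _ (mem_opGrading.2 hd)
  · rw [inv_inv]
    exact hP p i
  · refine IsAlgGrading.mem_congr (hQ i p) ?_
    rw [inv_inv, mul_comm (γ i)]
  · have h1 := h (Θ Y)
    rw [hρ', hΘ'Θ] at h1
    rw [h1]
    congr 2

/-- All information comes from `φ² = 1`, which says that `N = P Q* S` intertwines `φ₀²` with the
identity. On matrix units this makes `N` a scalar `ν` in `F`; hence `φ₀² = 1` and `Q* = ν Q S`, the
Hermitian symmetry up to `ν`. -/
theorem IsSuperinvolution.exists_form [Nonempty ι] (h𝒟 : IsGradedDivision 𝒟)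
    (heven : ∀ g : GSharp G, g.par ≠ 0 → 𝒟 g = ⊥) (hscalar : ∀ d ∈ 𝒟 1, ∃ c : F, d = c • (1 : D))
    {φ : Matrix ι ι D →ₗ[F] Matrix ι ι D} (hφ : IsSuperinvolution (endGrading 𝒟 γ) φ) :
    ∃ (φ₀ : D →ₗ[F] D) (g₀ : GSharp G) (Φ : Matrix ι ι D) (ν : F),
      (∀ a b, φ₀ (a * b) = φ₀ b * φ₀ a) ∧ (∀ a, φ₀ (φ₀ a) = a) ∧
      (∀ h, ∀ d ∈ 𝒟 h, φ₀ d ∈ 𝒟 h) ∧ IsUnit Φ ∧ (∀ p q, Φ p q ∈ 𝒟 (g₀ * γ p * γ q)) ∧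
      (ν = 1 ∨ ν = -1) ∧
      (∀ p q, φ₀ (Φ q p) = (ν * parSign F ((γ p).par * (γ q).par)) • Φ p q) ∧
      ∀ Y, φ Y = superAdj φ₀ (fun p => (γ p).par) Φ Y := by
  obtain ⟨φ₀, g, P, Q, hanti, hbij, hmem, hPQ, hQP, hP, hQ, h⟩ := hφ.exists_semilinear h𝒟 heven
  have hnt := h𝒟.nontrivial
  set π : ι → ZMod 2 := fun p => (γ p).par with hπ
  have hφone := map_one_of_antimul hanti hbij.surjective
  have hPpar : ∀ p i, P p i ≠ 0 → π p = g.par + π i := fun p i h0 => by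
    have := par_eq_zero_of_mem heven (hP p i) h0
    simp only [GSharp.par_mul, GSharp.par_inv] at this
    change (γ p).par = g.par + (γ i).par
    revert this
    generalize (γ p).par = a
    generalize (γ i).par = b
    generalize g.par = c
    revert a b c
    decide
  have hQpar : ∀ i p, Q i p ≠ 0 → π p = g.par + π i := fun i p h0 => by
    have := par_eq_zero_of_mem heven (hQ i p) h0
    simp only [GSharp.par_mul] at this
    change (γ p).par = g.par + (γ i).par
    revert this
    generalize (γ p).par = a
    generalize (γ i).par = b
    generalize g.par = c
    revert a b c
    decide
  set ε := g.par
  set S := signM F D (1 + ε) π with hS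
  have hSS : S * S = 1 := signM_mul_self _ _
  have hsign : ∀ Z : Matrix ι ι D, signM F D ε π * (signM F D 1 π * Z * signM F D 1 π) *
      signM F D ε π = S * Z * S := fun Z => by
    ext p q
    simp only [mul_signM_apply, signM_mul_apply, hS, smul_smul, ← parSign_add]
    congr 2
    ring
  have hsq : ∀ Y : Matrix ι ι D,
      P * (starM φ₀ Q * (S * (Y.map fun a => φ₀ (φ₀ a)) * S) * starM φ₀ P) * Q = Y := fun Y => by
    have h1 := hφ.invol Y
    rw [h Y, h, superTr_conj hanti hPpar hQpar, superTr_superTr, hsign] at h1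
    exact h1
  have hstar1 : starM φ₀ Q * starM φ₀ P = 1 := by
    rw [← starM_mul hanti, hPQ, starM_one hφone]
  have hstar2 : starM φ₀ P * starM φ₀ Q = 1 := by
    rw [← starM_mul hanti, hQP, starM_one hφone]
  set N := P * starM φ₀ Q * S with hN
  have hNY : ∀ Y : Matrix ι ι D, N * (Y.map fun a => φ₀ (φ₀ a)) = Y * N := fun Y => by
    have h1 : Y * N = P * (starM φ₀ Q * (S * (Y.map fun a => φ₀ (φ₀ a)) * S) * starM φ₀ P) *
        (Q * P) * starM φ₀ Q * S := by
      nth_rewrite 1 [← hsq Y]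
      simp only [hN, mul_assoc]
    rw [h1, hQP, mul_one]
    have h2 : P * (starM φ₀ Q * (S * (Y.map fun a => φ₀ (φ₀ a)) * S) * starM φ₀ P) * starM φ₀ Q * S
        = P * starM φ₀ Q * S * (Y.map fun a => φ₀ (φ₀ a)) * (S * (starM φ₀ P * starM φ₀ Q) * S) := by
      simp only [mul_assoc]
    rw [h2, hstar2, mul_one, hSS, mul_one]
  -- `φ₀` fixes `0` and `1`, so `N` commutes with the matrix units and is diagonal with equal
  -- entries. These have degree `1`, hence lie in `F`.
  obtain ⟨ν, hν⟩ : ∃ ν : F, N = algebraMap F _ ν := by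
    have hNmem : ∀ p q, N p q ∈ 𝒟 ((γ p)⁻¹ * γ q) := fun p q => by
      rw [hN, hS, mul_signM_apply]
      refine Submodule.smul_mem _ _ ?_
      refine IsAlgGrading.mem_congr (homogeneous_mul (a := fun p => (γ p)⁻¹ * g⁻¹)
        (b := fun i => (γ i)⁻¹) (b' := γ) (c := fun q => g * γ q) h𝒟.grading hP (fun i q => ?_)
        (fun i => inv_mul_cancel _) p q) ?_
      · rw [starM_apply]
        refine hmem _ _ (IsAlgGrading.mem_congr (hQ q i) ?_)
        rw [mul_comm (g * γ q)]
      · rw [mul_assoc, inv_mul_cancel_left]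
    have hcomm : ∀ i j, N * Matrix.single i j (1 : D) = Matrix.single i j 1 * N := fun i j => by
      rw [← hNY]
      congr 1
      ext p q
      rw [Matrix.map_apply, Matrix.single_apply]
      split_ifs
      · rw [hφone, hφone]
      · rw [map_zero, map_zero]
    obtain ⟨i₀⟩ := ‹Nonempty ι›
    have h1 : ∀ i, N i i = N i₀ i₀ := fun i => by
      have := congrFun (congrFun (hcomm i i₀) i) i₀
      rwa [Matrix.mul_single_apply_same, Matrix.single_mul_apply_same, mul_one, one_mul] at this
    have h2 : ∀ a i, a ≠ i → N a i = 0 := fun a i hai => by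
      have := congrFun (congrFun (hcomm i i) a) i
      rwa [Matrix.mul_single_apply_same, Matrix.single_mul_apply_of_ne _ _ _ _ _ hai,
        mul_one] at this
    obtain ⟨ν, hν⟩ := hscalar (N i₀ i₀) (IsAlgGrading.mem_congr (hNmem i₀ i₀) (inv_mul_cancel _))
    refine ⟨ν, ?_⟩
    ext p q
    rw [Matrix.algebraMap_matrix_apply]
    split_ifs with hpq
    · rw [← hpq, h1, hν, Algebra.algebraMap_eq_smul_one]
    · exact h2 p q hpq
  have hNunit : N * (S * starM φ₀ P * Q) = 1 := by
    have : N * (S * starM φ₀ P * Q) = P * (starM φ₀ Q * ((S * S) * starM φ₀ P)) * Q := by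
      simp only [hN, mul_assoc]
    rw [this, hSS, one_mul, hstar1, mul_one, hPQ]
  have hν0 : ν ≠ 0 := by
    rintro rfl
    rw [hν, map_zero, zero_mul] at hNunit
    exact zero_ne_one hNunit
  have hinvol : ∀ a, φ₀ (φ₀ a) = a := fun a => by
    obtain ⟨i₀⟩ := ‹Nonempty ι›
    have h1 := congrFun (congrFun (hNY (Matrix.diagonal fun _ => a)) i₀) i₀
    rw [hν, ← Algebra.smul_def, ← Algebra.commutes, ← Algebra.smul_def, Matrix.smul_apply,
      Matrix.smul_apply, Matrix.map_apply, Matrix.diagonal_apply_eq] at h1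
    exact smul_right_injective D hν0 h1
  have hstarQ : starM φ₀ Q = ν • (Q * S) := by
    have h1 : Q * N * S = starM φ₀ Q := by
      have : Q * N * S = (Q * P) * starM φ₀ Q * (S * S) := by simp only [hN, mul_assoc]
      rw [this, hQP, hSS, one_mul, mul_one]
    rw [← h1, hν, ← Algebra.commutes, ← Algebra.smul_def, smul_mul_assoc]
  have hherm : ∀ p q, φ₀ (Q q p) = (ν * parSign F ((γ p).par * (γ q).par)) • Q p q := fun p q => by
    have h1 := congrFun (congrFun hstarQ p) q
    rw [starM_apply, Matrix.smul_apply, hS, mul_signM_apply, smul_smul] at h1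
    rw [h1]
    by_cases h0 : Q p q = 0
    · rw [h0, smul_zero, smul_zero]
    · congr 3
      have := hQpar p q h0
      change (1 + ε) * (γ q).par = _
      change (γ q).par = ε + (γ p).par at this
      rw [this]
      generalize (γ p).par = a
      generalize ε = b
      revert a b
      decide
  have hQu : IsUnit Q := ⟨⟨Q, P, hQP, hPQ⟩, rfl⟩
  refine ⟨φ₀, g, Q, ν, hanti, hinvol, hmem, hQu, hQ, ?_, hherm, fun Y => ?_⟩
  -- Applying the symmetry relation twice to a nonzero entry multiplies it by `ν²`.
  · obtain ⟨p, q, hpq⟩ : ∃ p q, Q p q ≠ 0 := by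
      by_contra! h0
      have : Q = 0 := Matrix.ext h0
      exact hQu.ne_zero this
    have h1 := congrArg φ₀ (hherm q p)
    rw [hinvol, map_smul, hherm, smul_smul, mul_comm (γ p).par] at h1
    have h2 : (ν * ν) • Q p q = (1 : F) • Q p q := by
      rw [one_smul]
      nth_rewrite 2 [h1]
      congr 1
      have := parSign_mul_self (F := F) ((γ q).par * (γ p).par)
      linear_combination (-ν * ν) * this
    exact mul_self_eq_one_iff.1 (smul_left_injective F hpq h2)
  · rw [superAdj_eq hQP hPQ, h]

end Form

/-! ### Graded-division algebras over an algebraically closed field -/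

section Character

variable {F : Type u} [Field F] [IsAlgClosed F]

theorem exists_algHom_of_finiteDimensional {A : Type*} [CommRing A] [Algebra F A] [Nontrivial A]
    [FiniteDimensional F A] : Nonempty (A →ₐ[F] F) := by
  obtain ⟨m, hm⟩ := Ideal.exists_maximal A
  let _ := Ideal.Quotient.field m
  have : FiniteDimensional F (A ⧸ m) :=
    Module.Finite.of_surjective (Ideal.Quotient.mkₐ F m).toLinearMap Ideal.Quotient.mk_surjective
  have h := IsAlgClosed.algebraMap_bijective_of_isIntegral (k := F) (K := A ⧸ m)
  exact ⟨((AlgEquiv.ofBijective (Algebra.ofId F (A ⧸ m)) h).symm : (A ⧸ m) →ₐ[F] F).comp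
    (Ideal.Quotient.mkₐ F m)⟩

/-- A commutative twisted group algebra has a character. -/
theorem exists_character {B : Type*} [Ring B] [Algebra F B] [Nontrivial B] [FiniteDimensional F B]
    {T : Type*} [Mul T] {W : T → B} {ω : T → T → F} {x : T → F}
    (hcomm : ∀ s t, W s * W t = W t * W s) (hω : ∀ s t, W s * W t = ω s t • W (s * t))
    (hx : ∀ t, x t ≠ 0) (hsq : ∀ t, W t * W t = x t • (1 : B)) :
    ∃ l : T → F, (∀ t, l t ≠ 0) ∧ ∀ s t, l s * l t = ω s t * l (s * t) := by
  let A := Algebra.adjoin F (Set.range W)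
  have : IsMulCommutative A := Algebra.isMulCommutative_adjoin F (by
    rintro _ ⟨s, rfl⟩ _ ⟨t, rfl⟩
    exact hcomm s t)
  let _ : CommRing A := { (inferInstance : Ring A) with mul_comm := mul_comm' }
  obtain ⟨χ⟩ := exists_algHom_of_finiteDimensional (F := F) (A := A)
  let V : T → A := fun t => ⟨W t, Algebra.subset_adjoin ⟨t, rfl⟩⟩
  have h1 : ∀ s t, V s * V t = ω s t • V (s * t) := fun s t => Subtype.ext (hω s t)
  have h2 : ∀ t, V t * V t = x t • (1 : A) := fun t => Subtype.ext (hsq t)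
  refine ⟨fun t => χ (V t), fun t h0 => ?_, fun s t => ?_⟩
  · change χ (V t) = 0 at h0
    have := congrArg χ (h2 t)
    rw [map_mul, map_smul, map_one, h0, zero_mul, smul_eq_mul, mul_one] at this
    exact hx t this.symm
  · change χ (V s) * χ (V t) = ω s t * χ (V (s * t))
    rw [← map_mul, h1, map_smul, smul_eq_mul]

end Character

/-! ### Components and centre of a graded-division algebra. -/

section Division

variable {F : Type u} [Field F] {D : Type*} [Ring D] [Algebra F D] {H : Type*} [Group H]
  {𝒟 : H → Submodule F D}

/-- For `c` in the spectrum of `d`, the element `c - d` is homogeneous of degree `1` and not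
invertible, so it is zero. -/
theorem IsGradedDivision.exists_eq_smul_one [IsAlgClosed F] [FiniteDimensional F D]
    (h𝒟 : IsGradedDivision 𝒟) {d : D} (hd : d ∈ 𝒟 1) : ∃ c : F, d = c • (1 : D) := by
  have := h𝒟.nontrivial
  obtain ⟨c, hc⟩ := spectrum.nonempty_of_isAlgClosed_of_finiteDimensional F d
  refine ⟨c, ?_⟩
  rw [spectrum.mem_iff] at hc
  by_contra hne
  refine hc (h𝒟.isUnit 1 _ (Submodule.sub_mem _ ?_ hd) ?_)
  · rw [Algebra.algebraMap_eq_smul_one]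
    exact Submodule.smul_mem _ _ h𝒟.grading.one_mem
  · rw [Algebra.algebraMap_eq_smul_one]
    exact fun h => hne (sub_eq_zero.1 h).symm

theorem IsGradedDivision.exists_eq_smul (h𝒟 : IsGradedDivision 𝒟)
    (hscalar : ∀ d ∈ 𝒟 1, ∃ c : F, d = c • (1 : D)) {g : H} {d e : D} (hd : d ∈ 𝒟 g)
    (he : e ∈ 𝒟 g) (h0 : e ≠ 0) : ∃ c : F, d = c • e := by
  obtain ⟨e', he', h1, h2⟩ := h𝒟.exists_inv he h0
  obtain ⟨c, hc⟩ := hscalar (d * e') (by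
    have := h𝒟.grading.mul_mem _ _ _ hd _ he'
    rwa [mul_inv_cancel] at this)
  refine ⟨c, ?_⟩
  rw [← mul_one d, ← h2, ← mul_assoc, hc, smul_mul_assoc, one_mul]

theorem IsAlgGrading.commute_of_homogeneous (h𝒟 : IsAlgGrading 𝒟) {z : D}
    (h : ∀ g, ∀ d ∈ 𝒟 g, z * d = d * z) (d : D) : z * d = d * z := by
  induction d using h𝒟.induction with
  | zero => simp
  | mem g d hd => exact h g d hd
  | add x y hx hy => rw [mul_add, add_mul, hx, hy]

end Division

section Center

variable {F : Type u} [Field F] {D : Type*} [Ring D] [Algebra F D] {H : Type*} [CommGroup H]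
  {𝒟 : H → Submodule F D}

/-- The centre is graded: compare components of `z * d = d * z` for homogeneous `d`, using
commutativity of `H` to match their degrees. -/
theorem IsAlgGrading.proj_central (h𝒟 : IsAlgGrading 𝒟) {z : D} (hz : ∀ d, z * d = d * z) (g : H)
    (d : D) : h𝒟.proj g z * d = d * h𝒟.proj g z :=
  h𝒟.commute_of_homogeneous (fun k d hd => by
    rw [h𝒟.proj_mul _ _ hd, h𝒟.mul_proj _ _ hd, hz, mul_comm g]) d

end Center

/-! ### A homogeneous central element negated by the superinvolution. -/

section ExchangeCenter

variable {F : Type u} [Field F] {G : Type v} [CommGroup G]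

/-- The center of `R` is spanned by `1` and an element which is negated by `φ`. -/
structure HasExchangeCenter {R : Type*} [Ring R] [Algebra F R] (φ : R →ₗ[F] R) : Prop where
  exists_center : ∃ c : R, (∀ r, c * r = r * c) ∧ c ≠ 0 ∧ φ c = -c ∧
    ∀ z : R, (∀ r, z * r = r * z) → ∃ a b : F, z = a • 1 + b • c

variable {D : Type*} [Ring D] [Algebra F D] {𝒟 : GSharp G → Submodule F D} {ι : Type*}
  [Fintype ι] [DecidableEq ι] {γ : ι → GSharp G}

omit [Fintype ι] in
theorem diagonal_mem_endGrading {H : Type*} [CommGroup H] {ℰ : H → Submodule F D} {δ : ι → H}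
    {g : H} {d : D} (hd : d ∈ ℰ g) : (Matrix.diagonal fun _ : ι => d) ∈ endGrading ℰ δ g := by
  intro i j
  rw [Matrix.diagonal_apply]
  split_ifs with hij
  · subst hij
    refine IsAlgGrading.mem_congr hd ?_
    rw [mul_comm _ g, mul_assoc, inv_mul_cancel, mul_one]
  · exact Submodule.zero_mem _

/-- The generator negated by `φ` need not be homogeneous at first. It is not a scalar, as scalars
are fixed, so some component `c` of degree `g ≠ 1` is nonzero; and `c` is central, so it is a
combination of `1` and the generator. -/
theorem HasExchangeCenter.exists_homogeneous [Nonempty ι] (hF : (2 : F) ≠ 0)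
    (h𝒟 : IsGradedDivision 𝒟) (hscalar : ∀ d ∈ 𝒟 1, ∃ c : F, d = c • (1 : D))
    {φ : Matrix ι ι D →ₗ[F] Matrix ι ι D} (hφ : IsSuperinvolution (endGrading 𝒟 γ) φ)
    (hc : HasExchangeCenter φ) : ∃ (g : GSharp G) (c : D), c ∈ 𝒟 g ∧ c ≠ 0 ∧ g ≠ 1 ∧
      (∀ d, c * d = d * c) ∧
      φ (Matrix.diagonal fun _ => c) = -(Matrix.diagonal fun _ => c) ∧
      ∀ k, ∀ z ∈ 𝒟 k, (∀ d, z * d = d * z) → z ≠ 0 → k = 1 ∨ k = g := by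
  obtain ⟨c₀, hc₀, hc₀0, hφc₀, hspan⟩ := hc.exists_center
  obtain ⟨i₀⟩ := id ‹Nonempty ι›
  have hone := hφ.map_one (one_mem_endGrading h𝒟.grading γ)
  obtain ⟨z₀, hz₀, rfl⟩ := exists_central_of_commute hc₀
  have hdiag : ∀ z : D, (∀ d, z * d = d * z) → ∀ X : Matrix ι ι D,
      (Matrix.diagonal fun _ => z) * X = X * Matrix.diagonal fun _ => z := fun z hz X => by
    ext p q
    rw [Matrix.diagonal_mul, Matrix.mul_diagonal, hz]
  have hspan' : ∀ z : D, (∀ d, z * d = d * z) → ∃ a b : F, z = a • 1 + b • z₀ := fun z hz => by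
    obtain ⟨a, b, h⟩ := hspan _ (hdiag z hz)
    refine ⟨a, b, ?_⟩
    have := congrFun (congrFun h i₀) i₀
    simpa using this
  have hz₀s : ∀ a : F, z₀ ≠ a • 1 := by
    rintro a rfl
    have h1 : (Matrix.diagonal fun _ : ι => a • (1 : D)) = a • 1 := by
      rw [← Matrix.diagonal_one, ← Matrix.diagonal_smul]
      rfl
    rw [h1] at hφc₀ hc₀0
    rw [map_smul, hone] at hφc₀
    exact hc₀0 (eq_zero_of_neg_smul_eq hF (by rw [neg_smul, one_smul]; exact hφc₀.symm))
  obtain ⟨g, hg1, hg0⟩ : ∃ g, g ≠ 1 ∧ h𝒟.grading.proj g z₀ ≠ 0 := by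
    by_contra! h
    obtain ⟨s, hs⟩ := h𝒟.grading.exists_sum_proj z₀
    have h1 : z₀ ∈ 𝒟 1 := by
      rw [hs]
      refine Submodule.sum_mem _ fun k _ => ?_
      by_cases hk : k = 1
      · rw [hk]
        exact h𝒟.grading.proj_mem _ _
      · rw [h k hk]
        exact Submodule.zero_mem _
    obtain ⟨a, ha⟩ := hscalar _ h1
    exact hz₀s a ha
  set c := h𝒟.grading.proj g z₀ with hcdef
  have hcg : c ∈ 𝒟 g := h𝒟.grading.proj_mem _ _
  have hcc : ∀ d, c * d = d * c := h𝒟.grading.proj_central hz₀ g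
  obtain ⟨a, b, hab⟩ := hspan' c hcc
  have hb : b ≠ 0 := by
    rintro rfl
    rw [zero_smul, add_zero] at hab
    refine hg1 (h𝒟.grading.eq_of_mem hcg ?_ hg0)
    rw [hab]
    exact Submodule.smul_mem _ _ h𝒟.grading.one_mem
  have hdc : (Matrix.diagonal fun _ : ι => c) = a • 1 + b • Matrix.diagonal fun _ => z₀ := by
    ext p q
    by_cases hpq : p = q
    · subst hpq
      simpa using hab
    · simp [hpq]
  -- The sum `φ(c) + c = 2a` is a scalar and is homogeneous of degree `g ≠ 1`.
  have ha : a = 0 := by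
    have h1 : φ (Matrix.diagonal fun _ => c) + Matrix.diagonal (fun _ => c) =
        (2 * a) • (1 : Matrix ι ι D) := by
      rw [hdc, map_add, map_smul, map_smul, hone, hφc₀, smul_neg, two_mul, add_smul]
      abel
    have h2 : (2 * a) • (1 : Matrix ι ι D) ∈ endGrading 𝒟 γ g := by
      rw [← h1]
      exact Submodule.add_mem _ (hφ.map_mem _ _ (diagonal_mem_endGrading hcg))
        (diagonal_mem_endGrading hcg)
    have h3 := h2 i₀ i₀
    rw [Matrix.smul_apply, Matrix.one_apply_eq, mul_comm _ g, inv_mul_cancel_right] at h3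
    by_contra ha
    have h4 : (1 : D) ∈ 𝒟 g := by
      have := Submodule.smul_mem _ (2 * a)⁻¹ h3
      rwa [smul_smul, inv_mul_cancel₀ (mul_ne_zero hF ha), one_smul] at this
    have := h𝒟.nontrivial
    exact hg1 (h𝒟.grading.eq_of_mem h4 h𝒟.grading.one_mem one_ne_zero)
  refine ⟨g, c, hcg, hg0, hg1, hcc, ?_, fun k z hz hzc hz0 => ?_⟩
  · rw [hdc, ha, zero_smul, zero_add, map_smul, hφc₀, smul_neg]
  · obtain ⟨a', b', h⟩ := hspan' z hzc
    rw [ha, zero_smul, zero_add] at hab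
    by_contra! hk
    have h1 : z = a' • (1 : D) + (b' * b⁻¹) • c := by
      rw [h, hab, smul_smul, mul_assoc, inv_mul_cancel₀ hb, mul_one]
    have h2 := h𝒟.grading.proj_same hz
    rw [h1, map_add, map_smul, map_smul, h𝒟.grading.proj_ne hk.1 h𝒟.grading.one_mem,
      h𝒟.grading.proj_ne hk.2 hcg, smul_zero, smul_zero, add_zero, ← h1] at h2
    exact hz0 h2.symm

end ExchangeCenter

/-! ### Support and commutation factor of the coefficient algebra. -/

section Support

variable {F : Type u} [Field F] {G : Type v} [CommGroup G]
variable {D : Type*} [Ring D] [Algebra F D] {𝒟 : GSharp G → Submodule F D}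

/-- The support of an even graded-division algebra, as a subgroup of `G`. -/
def IsGradedDivision.support (h𝒟 : IsGradedDivision 𝒟) : Subgroup G where
  carrier := {g | ∃ d ∈ 𝒟 (GSharp.mk g 0), d ≠ 0}
  one_mem' :=
    have := h𝒟.nontrivial
    ⟨1, h𝒟.grading.one_mem, one_ne_zero⟩
  mul_mem' := by
    rintro a b ⟨d, hd, hd0⟩ ⟨e, he, he0⟩
    exact ⟨d * e, h𝒟.grading.mul_mem _ _ _ hd _ he, h𝒟.mul_ne_zero hd hd0 he0⟩
  inv_mem' := by
    rintro a ⟨d, hd, hd0⟩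
    obtain ⟨e, he, h1, -⟩ := h𝒟.exists_inv hd hd0
    have := h𝒟.nontrivial
    exact ⟨e, IsAlgGrading.mem_congr he (GSharp.ext_par rfl (GSharp.par_inv _)),
      right_ne_zero_of_mul_eq_one h1⟩

theorem IsGradedDivision.finite_support [FiniteDimensional F D] (h𝒟 : IsGradedDivision 𝒟) :
    Finite h𝒟.support := by
  have h1 := WellFoundedGT.finite_ne_bot_of_iSupIndep h𝒟.grading.indep
  have := h1.to_subtype
  refine Finite.of_injective (β := {g | 𝒟 g ≠ ⊥}) (fun t => ⟨GSharp.mk (t : G) 0, ?_⟩)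
    fun s t hst => ?_
  · obtain ⟨d, hd, hd0⟩ := t.2
    exact (Submodule.ne_bot_iff _).2 ⟨d, hd, hd0⟩
  · exact Subtype.ext (congrArg (fun x : {g | 𝒟 g ≠ ⊥} => x.1.1) hst)

/-- A basis of a graded-division algebra with support `T` and commutation factor `β`. -/
structure ExPair.IsCommBasis (P : ExPair F G) (𝒟 : GSharp G → Submodule F D) (Y : P.T → D) :
    Prop where
  mem : ∀ t : P.T, Y t ∈ 𝒟 (GSharp.mk (t : G) 0)
  ne_zero : ∀ t, Y t ≠ 0
  exists_eq : ∀ g, ∀ d ∈ 𝒟 g, d ≠ 0 → ∃ t : P.T, g = GSharp.mk (t : G) 0 ∧ ∃ x : F, d = x • Y t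
  comm : ∀ s t, Y s * Y t = (P.β s t : F) • (Y t * Y s)

/-- Components are one-dimensional, so commutators of homogeneous elements define a bicharacter `b`,
whose radical is the support of the centre. The involution is what makes `b` sign-valued and `T`
elementary. -/
theorem IsGradedDivision.exists_exPair [FiniteDimensional F D] (hF : (2 : F) ≠ 0)
    (h𝒟 : IsGradedDivision 𝒟) (heven : ∀ g : GSharp G, g.par ≠ 0 → 𝒟 g = ⊥)
    (hscalar : ∀ d ∈ 𝒟 1, ∃ c : F, d = c • (1 : D)) {φ : D →ₗ[F] D}
    (hanti : ∀ a b, φ (a * b) = φ b * φ a) (hinvol : ∀ a, φ (φ a) = a)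
    (hmem : ∀ h, ∀ d ∈ 𝒟 h, φ d ∈ 𝒟 h) {g : GSharp G} {c : D} (hc : c ∈ 𝒟 g) (hc0 : c ≠ 0)
    (hg : g ≠ 1) (hcc : ∀ d, c * d = d * c) (hφc : φ c = -c)
    (hcenter : ∀ k, ∀ z ∈ 𝒟 k, (∀ d, z * d = d * z) → z ≠ 0 → k = 1 ∨ k = g) :
    ∃ (P : ExPair F G) (Y : P.T → D), P.IsCommBasis 𝒟 Y := by
  have hnt := h𝒟.nontrivial
  have h2D : ∀ d : D, d = -d → d = 0 := fun d hd =>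
    eq_zero_of_neg_smul_eq hF (by rw [neg_smul, one_smul]; exact hd.symm)
  choose Y hY hY0 using fun t : h𝒟.support => t.2
  have hsupp : ∀ k, ∀ d ∈ 𝒟 k, d ≠ 0 →
      ∃ t : h𝒟.support, k = GSharp.mk (t : G) 0 ∧ ∃ x : F, d = x • Y t := fun k d hd hd0 => by
    have h1 : k = GSharp.mk k.1 0 := by
      rw [← par_eq_zero_of_mem heven hd hd0]
      rfl
    rw [h1] at hd
    let t : h𝒟.support := ⟨k.1, d, hd, hd0⟩
    exact ⟨t, h1, h𝒟.exists_eq_smul hscalar hd (hY t) (hY0 t)⟩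
  have hYY : ∀ s t : h𝒟.support, Y s * Y t ∈ 𝒟 (GSharp.mk ((s * t : h𝒟.support) : G) 0) :=
    fun s t => h𝒟.grading.mul_mem _ _ _ (hY s) _ (hY t)
  have hYY0 : ∀ s t, Y s * Y t ≠ 0 := fun s t => h𝒟.mul_ne_zero (hY s) (hY0 s) (hY0 t)
  have hb : ∀ s t, ∃ b : Fˣ, Y s * Y t = (b : F) • (Y t * Y s) := fun s t => by
    obtain ⟨b, hb⟩ := h𝒟.exists_eq_smul hscalar (hYY s t)
      (IsAlgGrading.mem_congr (hYY t s) (by rw [mul_comm])) (hYY0 t s)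
    refine ⟨Units.mk0 b ?_, hb⟩
    rintro rfl
    rw [zero_smul] at hb
    exact hYY0 _ _ hb
  choose b hb using hb
  have hbeq : ∀ s t (x : F), Y s * Y t = x • (Y t * Y s) → (b s t : F) = x := fun s t x h =>
    smul_left_injective F (hYY0 t s) ((hb s t).symm.trans h)
  have hσ : ∀ s t, ∃ x : F, x ≠ 0 ∧ Y (s * t) = x • (Y s * Y t) := fun s t => by
    obtain ⟨x, hx⟩ := h𝒟.exists_eq_smul hscalar (hY (s * t)) (hYY s t) (hYY0 s t)
    refine ⟨x, ?_, hx⟩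
    rintro rfl
    rw [zero_smul] at hx
    exact hY0 _ hx
  have hbsymm : ∀ s t, b s t * b t s = 1 := fun s t => by
    refine Units.ext ?_
    have h1 := hb s t
    rw [hb t s, smul_smul] at h1
    exact smul_left_injective F (hYY0 s t) (by
      change ((b s t : F) * (b t s : F)) • _ = (1 : F) • _
      rw [← h1, one_smul])
  have hbmul : ∀ s s' t, b (s * s') t = b s t * b s' t := fun s s' t => by
    obtain ⟨x, -, hx⟩ := hσ s s'
    refine Units.ext (hbeq _ _ _ ?_)
    rw [hx, smul_mul_assoc, mul_assoc, hb s' t, mul_smul_comm, ← mul_assoc, hb s t, smul_mul_assoc,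
      mul_smul_comm, smul_smul, smul_smul, smul_smul, mul_assoc (Y t)]
    congr 1
    rw [Units.val_mul]
    ring
  have hbmul' : ∀ s t t', b s (t * t') = b s t * b s t' := fun s t t' => by
    have h1 := hbsymm s (t * t')
    rw [hbmul] at h1
    rw [← mul_left_inj, h1, mul_mul_mul_comm, hbsymm, hbsymm, one_mul]
  let β : h𝒟.support →* h𝒟.support →* Fˣ :=
    MonoidHom.mk' (fun s => MonoidHom.mk' (b s) (hbmul' s)) fun s s' =>
      MonoidHom.ext fun t => hbmul s s' t
  have hβ : ∀ s t, β s t = b s t := fun _ _ => rfl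
  have hμ : ∀ t, ∃ x : F, φ (Y t) = x • Y t ∧ x * x = 1 := fun t => by
    obtain ⟨x, hx⟩ := h𝒟.exists_eq_smul hscalar (hmem _ _ (hY t)) (hY t) (hY0 t)
    refine ⟨x, hx, ?_⟩
    have h1 := hinvol (Y t)
    rw [hx, map_smul, hx, smul_smul] at h1
    exact smul_left_injective F (hY0 t) (h1.trans (one_smul F _).symm)
  -- Applying `φ`, which is `±1` on components, to `Y s * Y t = b • (Y t * Y s)` reverses the
  -- products and gives the same relation with `s` and `t` interchanged.
  have hbsq : ∀ s t, b s t * b s t = 1 := fun s t => by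
    obtain ⟨x, hx, hxx⟩ := hμ s
    obtain ⟨y, hy, hyy⟩ := hμ t
    have h1 := congrArg φ (hb s t)
    rw [map_smul, hanti, hanti, hx, hy, smul_mul_smul_comm, smul_mul_smul_comm, smul_smul] at h1
    have h2 : Y t * Y s = (b s t : F) • (Y s * Y t) := by
      have := congrArg (fun z => (x * y) • z) h1
      simp only [smul_smul] at this
      have e1 : x * y * (y * x) = 1 := by linear_combination y * y * hxx + hyy
      have e2 : x * y * ((b s t : F) * (x * y)) = b s t := by
        linear_combination (b s t : F) * y * y * hxx + (b s t : F) * hyy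
      rwa [e1, e2, one_smul] at this
    rw [← hbsymm s t]
    congr 1
    exact Units.ext (hbeq _ _ _ h2).symm
  have hrad : ∀ t, (∀ s, b t s = 1) → GSharp.mk (t : G) 0 = 1 ∨ GSharp.mk (t : G) 0 = g :=
    fun t ht => hcenter _ _ (hY t) (h𝒟.grading.commute_of_homogeneous fun k d hd => by
      by_cases hd0 : d = 0
      · rw [hd0, mul_zero, zero_mul]
      · obtain ⟨s, -, x, rfl⟩ := hsupp k d hd hd0
        rw [mul_smul_comm, smul_mul_assoc, hb t s, ht, Units.val_one, one_smul]) (hY0 t)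
  -- Since `b² = 1`, squares lie in the radical. If `t²` were the degree of `c`, then `(Y t)²`,
  -- which `φ` fixes, would be a multiple of `c`, which `φ` negates.
  have hsq : ∀ t : h𝒟.support, t * t = 1 := fun t => by
    rcases hrad (t * t) (fun s => by rw [hbmul, hbsq]) with h | h
    · exact Subtype.ext (congrArg Prod.fst h)
    · exfalso
      obtain ⟨x, hx⟩ := h𝒟.exists_eq_smul hscalar (hYY t t) (IsAlgGrading.mem_congr hc h.symm) hc0
      obtain ⟨y, hy, hyy⟩ := hμ t
      have h1 := congrArg φ hx
      rw [hanti, hy, smul_mul_smul_comm, hyy, one_smul, map_smul, hφc, smul_neg, ← hx] at h1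
      exact hYY0 t t (h2D _ h1)
  obtain ⟨f, hf, x, hx⟩ := hsupp g c hc hc0
  have hx0 : x ≠ 0 := by
    rintro rfl
    rw [zero_smul] at hx
    exact hc0 hx
  have hfb : ∀ s, b f s = 1 := fun s => Units.ext (hbeq _ _ _ (by
    have := hcc (Y s)
    rw [hx, smul_mul_assoc, mul_smul_comm] at this
    rw [Units.val_one, one_smul]
    exact smul_right_injective D hx0 this))
  refine ⟨⟨h𝒟.support, h𝒟.finite_support, hsq, β, fun t => ?_, f, ?_, fun t => ?_⟩, Y, hY, hY0,
    hsupp, hb⟩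
  · exact Units.ext (hbeq _ _ _ (by rw [Units.val_one, one_smul]))
  · rintro rfl
    exact hg hf
  · constructor
    · intro h
      rcases hrad t h with h1 | h1
      · exact Or.inl (Subtype.ext (congrArg Prod.fst h1))
      · rw [hf] at h1
        exact Or.inr (Subtype.ext (congrArg Prod.fst h1))
    · rintro (rfl | rfl) s
      · rw [map_one, MonoidHom.one_apply]
      · exact hfb s

end Support

/-! ### Recognition of the standard realization. -/

section Recognition

variable {F : Type u} [Field F] {G : Type v} [CommGroup G] {P : ExPair F G}
variable {D : Type*} [Ring D] [Algebra F D] {𝒟 : GSharp G → Submodule F D}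

/-- The elements `Y t ⊗ Z t` commute, because `β² = 1`, and each squares to a nonzero scalar. A
character `l` of the algebra they generate trivializes the product of the two cocycles, so `(l t)⁻¹
• Y t` has the structure constants of `Z t`. -/
theorem StdRealization.exists_gradedEquiv [IsAlgClosed F] [FiniteDimensional F D]
    (hF : (2 : F) ≠ 0) (S : StdRealization P) (h𝒟 : IsGradedDivision 𝒟) {Y : P.T → D}
    (hY : P.IsCommBasis 𝒟 Y) : ∃ ψ : D ≃ₐ[F] S.Alg, ∀ h, ∀ d ∈ 𝒟 h, ψ d ∈ S.grading h := by
  have hnt := h𝒟.nontrivial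
  have hspan : ∀ g : P.T, ∀ d ∈ 𝒟 (GSharp.mk (g : G) 0), ∃ x : F, d = x • Y g := fun g d hd => by
    by_cases hd0 : d = 0
    · exact ⟨0, by rw [hd0, zero_smul]⟩
    · obtain ⟨t, ht, x, hx⟩ := hY.exists_eq _ d hd hd0
      obtain rfl : g = t := Subtype.ext (congrArg Prod.fst ht)
      exact ⟨x, hx⟩
  have hYY : ∀ s t : P.T, Y s * Y t ∈ 𝒟 (GSharp.mk ((s * t : P.T) : G) 0) :=
    fun s t => h𝒟.grading.mul_mem _ _ _ (hY.mem s) _ (hY.mem t)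
  have hYY0 : ∀ s t, Y s * Y t ≠ 0 := fun s t =>
    h𝒟.mul_ne_zero (hY.mem s) (hY.ne_zero s) (hY.ne_zero t)
  choose σ hσ using fun s t => hspan _ _ (hYY s t)
  have hσ0 : ∀ s t, σ s t ≠ 0 := fun s t h => by
    have := hσ s t
    rw [h, zero_smul] at this
    exact hYY0 _ _ this
  choose ε hε1 hε using S.Z_mul
  have hε0 : ∀ s t, ε s t * ε s t = 1 := fun s t => by
    rcases hε1 s t with h | h <;> rw [h] <;> ring
  have hY1 : ∃ y : F, y ≠ 0 ∧ Y 1 = y • (1 : D) := by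
    obtain ⟨y, hy⟩ := hspan 1 1 h𝒟.grading.one_mem
    have hy0 : y ≠ 0 := by
      rintro rfl
      rw [zero_smul] at hy
      exact one_ne_zero hy
    exact ⟨y⁻¹, inv_ne_zero hy0, by rw [hy, smul_smul, inv_mul_cancel₀ hy0, one_smul]⟩
  obtain ⟨y, hy0, hy⟩ := hY1
  obtain ⟨l, hl0, hl⟩ := exists_character (F := F) (W := fun t => Y t ⊗ₜ[F] S.Z t)
    (ω := fun s t => σ s t * ε s t) (x := fun t => σ t t * ε t t * y)
    (fun s t => by
      rw [Algebra.TensorProduct.tmul_mul_tmul, Algebra.TensorProduct.tmul_mul_tmul, hY.comm s t,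
        S.Z_comm s t, TensorProduct.smul_tmul_smul]
      have : (P.β s t : F) * (P.β s t : F) = 1 := by
        rw [← Units.val_mul, P.β_sq, Units.val_one]
      rw [this, one_smul])
    (fun s t => by
      rw [Algebra.TensorProduct.tmul_mul_tmul, hσ, hε, TensorProduct.smul_tmul_smul])
    (fun t => mul_ne_zero (mul_ne_zero (hσ0 t t) (left_ne_zero_of_mul_eq_one (hε0 t t))) hy0)
    (fun t => by
      rw [Algebra.TensorProduct.tmul_mul_tmul, hσ, hε, TensorProduct.smul_tmul_smul, P.sq_eq_one,
        hy, S.Z_one, ← TensorProduct.smul_tmul', smul_smul]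
      rfl)
  have hbasis : LinearIndependent F fun t => (l t)⁻¹ • Y t := by
    refine (h𝒟.grading.indep.comp (f := fun t : P.T => GSharp.mk (t : G) 0) fun s t hst => ?_)
      |>.linearIndependent _ (fun t => Submodule.smul_mem _ _ (hY.mem t)) fun t => ?_
    · exact Subtype.ext (congrArg Prod.fst hst)
    · exact smul_ne_zero (inv_ne_zero (hl0 t)) (hY.ne_zero t)
  have htop : ⊤ ≤ Submodule.span F (Set.range fun t => (l t)⁻¹ • Y t) := by
    rw [← h𝒟.grading.iSup_eq]
    refine iSup_le fun g d hd => ?_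
    by_cases hd0 : d = 0
    · rw [hd0]
      exact Submodule.zero_mem _
    · obtain ⟨t, -, x, rfl⟩ := hY.exists_eq g d hd hd0
      have : x • Y t = (x * l t) • ((l t)⁻¹ • Y t) := by
        rw [smul_smul, mul_assoc, mul_inv_cancel₀ (hl0 t), mul_one]
      rw [this]
      exact Submodule.smul_mem _ _ (Submodule.subset_span ⟨t, rfl⟩)
  let b := Module.Basis.mk hbasis htop
  let b' := Module.Basis.mk (S.Z_linearIndependent hF) (S.span_Z hF).ge
  have hb : ∀ t, b t = (l t)⁻¹ • Y t := fun t => Module.Basis.mk_apply _ _ _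
  have hb' : ∀ t, b' t = S.Z t := fun t => Module.Basis.mk_apply _ _ _
  let e : D ≃ₗ[F] S.Alg := b.equiv b' (Equiv.refl _)
  have he : ∀ t, e (b t) = S.Z t := fun t => by
    rw [Module.Basis.equiv_apply, Equiv.refl_apply, hb']
  have heY : ∀ t, e (Y t) = l t • S.Z t := fun t => by
    rw [← he, hb, ← map_smul, smul_smul, mul_inv_cancel₀ (hl0 t), one_smul]
  have hmul : ∀ x z, e (x * z) = e x * e z := fun x z => by
    induction x using h𝒟.grading.induction with
    | zero => simp
    | add x x' h h' => rw [add_mul, map_add, map_add, h, h', add_mul]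
    | mem g x hx =>
      induction z using h𝒟.grading.induction with
      | zero => simp
      | add z z' h h' => rw [mul_add, map_add, map_add, h, h', mul_add]
      | mem k z hz =>
        by_cases hx0 : x = 0
        · simp [hx0]
        by_cases hz0 : z = 0
        · simp [hz0]
        obtain ⟨s, -, a, rfl⟩ := hY.exists_eq g x hx hx0
        obtain ⟨t, -, c, rfl⟩ := hY.exists_eq k z hz hz0
        rw [smul_mul_smul_comm, hσ, map_smul, map_smul, map_smul, map_smul, heY, heY, heY,
          smul_mul_smul_comm, smul_mul_smul_comm, hε, smul_smul, smul_smul, smul_smul, smul_smul]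
        congr 1
        linear_combination (-(a * c * ε s t)) * hl s t + (-(a * c * σ s t * l (s * t))) * hε0 s t
  have hone : e 1 = 1 := by
    obtain ⟨d, hd⟩ := e.surjective 1
    have := hmul 1 d
    rwa [one_mul, hd, mul_one, eq_comm] at this
  refine ⟨AlgEquiv.ofLinearEquiv e hone hmul, fun h d hd => ?_⟩
  change e d ∈ _
  by_cases hd0 : d = 0
  · rw [hd0, map_zero]
    exact Submodule.zero_mem _
  · obtain ⟨t, rfl, x, rfl⟩ := hY.exists_eq h d hd hd0
    rw [map_smul, heY]
    exact Submodule.smul_mem _ _ (Submodule.smul_mem _ _ (S.Z_mem t))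

end Recognition

/-! ### Effect of the adjunction on central scalars; change of coefficient involution. -/

section AdjoinedSign

variable {F : Type u} [Field F] {D : Type*} [Ring D] [Algebra F D] {ι : Type*} [Fintype ι]
  [DecidableEq ι]

omit [Fintype ι] in
theorem superTr_diagonal (π : ι → ZMod 2) (d : D) :
    superTr F π (Matrix.diagonal fun _ => d) = Matrix.diagonal fun _ => d := by
  ext p q
  rw [superTr, Matrix.of_apply]
  by_cases hpq : p = q
  · subst hpq
    rw [ZMod.two_add_self, zero_mul, parSign_zero, one_smul]
  · rw [Matrix.diagonal_apply_ne _ hpq, Matrix.diagonal_apply_ne _ (Ne.symm hpq), smul_zero]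

/-- An antiautomorphism preserves the centre, so the scalar matrix `φ c` passes through `Φ`, and the
adjunction acts on central scalars as `φ` does. -/
theorem eq_neg_of_superAdj_diagonal [Nonempty ι] {φ : D →ₗ[F] D}
    (hanti : ∀ a b, φ (a * b) = φ b * φ a) (hinvol : ∀ a, φ (φ a) = a) {π : ι → ZMod 2}
    {Φ : Matrix ι ι D} (hΦ : IsUnit Φ) {c : D} (hc : ∀ d, c * d = d * c)
    (h : superAdj φ π Φ (Matrix.diagonal fun _ => c) = -(Matrix.diagonal fun _ => c)) :
    φ c = -c := by
  obtain ⟨Ψ, h1, h2⟩ := exists_mul_eq_one hΦ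
  have hφc : ∀ d, φ c * d = d * φ c := fun d => by
    rw [← hinvol d, ← hanti, ← hanti, hc]
  have hdiag : (Matrix.diagonal fun _ : ι => φ c) * Φ = Φ * Matrix.diagonal fun _ => φ c := by
    ext p q
    rw [Matrix.diagonal_mul, Matrix.mul_diagonal, hφc]
  rw [superAdj_eq h1 h2, superTr_diagonal, Matrix.diagonal_map (map_zero φ), mul_assoc, hdiag,
    ← mul_assoc, h2, one_mul] at h
  obtain ⟨i⟩ := ‹Nonempty ι›
  have := congrFun (congrFun h i) i
  simpa using this

/-- Replacing the involution of the coefficients by a conjugate one. -/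
theorem superAdj_conj_left {φ φ' : D →ₗ[F] D} {z : D} (hz : IsUnit z)
    (h : ∀ d, z * φ d = φ' d * z) (π : ι → ZMod 2) {Φ : Matrix ι ι D} (hΦ : IsUnit Φ)
    (Y : Matrix ι ι D) :
    superAdj φ' π ((Matrix.diagonal fun _ => z) * Φ) Y = superAdj φ π Φ Y := by
  obtain ⟨Ψ, h1, h2⟩ := exists_mul_eq_one hΦ
  obtain ⟨w, hzw, hwz⟩ := exists_mul_eq_one hz
  have hd1 : (Matrix.diagonal fun _ : ι => z) * (Matrix.diagonal fun _ => w) = 1 := by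
    rw [Matrix.diagonal_mul_diagonal, hzw, Matrix.diagonal_one]
  have hd2 : (Matrix.diagonal fun _ : ι => w) * (Matrix.diagonal fun _ => z) = 1 := by
    rw [Matrix.diagonal_mul_diagonal, hwz, Matrix.diagonal_one]
  have h3 : (Matrix.diagonal fun _ => z) * Φ * (Ψ * Matrix.diagonal fun _ => w) = 1 := by
    rw [mul_assoc, ← mul_assoc Φ, h1, one_mul, hd1]
  have h4 : (Ψ * Matrix.diagonal fun _ => w) * ((Matrix.diagonal fun _ => z) * Φ) = 1 := by
    rw [mul_assoc, ← mul_assoc _ _ Φ, hd2, one_mul, h2]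
  rw [superAdj_eq h3 h4, superAdj_eq h1 h2]
  have h5 : (superTr F π Y).map φ' * (Matrix.diagonal fun _ => z) =
      (Matrix.diagonal fun _ => z) * (superTr F π Y).map φ := by
    ext p q
    rw [Matrix.mul_diagonal, Matrix.diagonal_mul, Matrix.map_apply, Matrix.map_apply, h]
  rw [mul_assoc, ← mul_assoc _ _ Φ, h5, mul_assoc Ψ, mul_assoc Ψ, ← mul_assoc _ _ Φ,
    ← mul_assoc (Matrix.diagonal fun _ => w), hd2,
    one_mul]

end AdjoinedSign

/-! ### Comparison with the standard involution. -/

section Comparison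

variable {F : Type u} [Field F] {G : Type v} [CommGroup G] {P : ExPair F G}

/-- Since `β` is nondegenerate modulo `⟨f⟩`, it realizes every character trivial on `f`. If `χ` were
missed, orthogonality would make the double sum of `χ(t) β(u, t)` vanish when taken over `t` first;
taken over `u` first it is `2|T|`, which is nonzero in `F`. -/
theorem ExPair.exists_eq_β (P : ExPair F G) (hF : (2 : F) ≠ 0) {χ : P.T → F}
    (h1 : χ 1 = 1) (hmul : ∀ s t, χ (s * t) = χ s * χ t) (hf : χ P.f = 1) :
    ∃ u : P.T, ∀ t, χ t = P.β u t := by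
  classical
  have := P.finite_T
  have := Fintype.ofFinite P.T
  by_contra! hne
  let X : P.T →* F := { toFun := χ, map_one' := h1, map_mul' := hmul }
  have hβ1 (u t : P.T) : (P.β u t : F) * (P.β u t : F) = 1 := by
    rw [← Units.val_mul, P.β_sq, Units.val_one]
  have hzero : ∀ u, ∑ t, χ t * (P.β u t : F) = 0 := fun u => by
    obtain ⟨t, ht⟩ := hne u
    have := sum_hom_units_eq_zero (X * (Units.coeHom F).comp (P.β u)) fun h => ht (by
      have h2 : χ t * (P.β u t : F) = 1 := congrArg (fun g : P.T →* F => g t) h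
      linear_combination (P.β u t : F) * h2 - χ t * hβ1 u t)
    exact this
  have hsum : ∀ t, ∑ u, (P.β u t : F) = if t = 1 ∨ t = P.f then (Fintype.card P.T : F) else 0 :=
    fun t => by
    split_ifs with ht
    · have h2 : ∀ u, (P.β u t : F) = 1 := fun u => by
        rw [P.β_symm, (P.mem_rad t).2 ht u, Units.val_one]
      simp [h2]
    · have h2 := sum_hom_units_eq_zero ((Units.coeHom F).comp (P.β t)) fun h => ht (by
        refine (P.mem_rad t).1 fun s => Units.ext ?_
        exact congrArg (fun g : P.T →* F => g s) h)
      rw [← h2]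
      exact Finset.sum_congr rfl fun u _ => by rw [P.β_symm]; rfl
  have h2 : ∑ u, ∑ t, χ t * (P.β u t : F) = 0 := Finset.sum_eq_zero fun u _ => hzero u
  rw [Finset.sum_comm] at h2
  simp only [← Finset.mul_sum, hsum] at h2
  have h3 : ∑ t, χ t * (if t = 1 ∨ t = P.f then (Fintype.card P.T : F) else 0) =
      2 * Fintype.card P.T := by
    rw [← Finset.sum_subset (Finset.subset_univ {1, P.f}) fun t _ ht => by
      rw [if_neg, mul_zero]
      simpa using ht]
    rw [Finset.sum_pair P.f_ne_one.symm, h1, hf, if_pos (Or.inl rfl), if_pos (Or.inr rfl)]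
    ring
  rw [h3, ← Nat.card_eq_fintype_card] at h2
  exact mul_ne_zero hF (natCard_ne_zero_of_sq hF P.sq_eq_one) h2

namespace StdRealization

variable {S : StdRealization P} {ι : Type*} [Fintype ι] [DecidableEq ι] [Nonempty ι]
  {γ : ι → GSharp G}

/-- The involutions `φ₀` and `phi0` act on components by signs with the same polarization `β`, and
both negate degree `f`. The ratio of these signs is a character `β(u, ·)`, so the involutions are
conjugate by `Z u`, which can be moved into `Φ`. -/
theorem exists_isSuperHermitian (hF : (2 : F) ≠ 0)
    {φ : Matrix ι ι S.Alg →ₗ[F] Matrix ι ι S.Alg}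
    (hφ : IsSuperinvolution (endGrading S.grading γ) φ) (hc : HasExchangeCenter φ) :
    ∃ (g₀ : GSharp G) (Φ : Matrix ι ι S.Alg), IsSuperHermitian S.grading S.phi0 γ g₀ Φ ∧
      ∀ Y, φ Y = superAdj S.phi0 (fun p => (γ p).par) Φ Y := by
  have hD := S.isInvolutiveDivision hF
  obtain ⟨φ₀, g₀, Φ, ν, hanti, hinvol, hmem, hΦ, hΦmem, hν, hherm, hadj⟩ :=
    hφ.exists_form hD.division hD.even hD.scalar
  obtain ⟨g, c, hcg, hc0, hg, hcc, hφc, -⟩ := hc.exists_homogeneous hF hD.division hD.scalar hφ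
  rw [hadj] at hφc
  have hφ₀c := eq_neg_of_superAdj_diagonal hanti hinvol hΦ hcc hφc
  have hμ : ∀ t, ∃ x : F, φ₀ (S.Z t) = x • S.Z t := fun t => by
    have := hmem _ _ (S.Z_mem t)
    rw [grading_mk, comp_eq] at this
    obtain ⟨x, hx⟩ := Submodule.mem_span_singleton.1 this
    exact ⟨x, hx.symm⟩
  choose μ hμ using hμ
  have hμmul : ∀ s t, μ (s * t) = μ s * μ t * P.β s t := fun s t => by
    obtain ⟨ε, hε, h⟩ := S.Z_mul s t
    have hε0 : ε ≠ 0 := by rcases hε with rfl | rfl <;> simp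
    exact antimul_scalar_mul hanti (S.Z_ne_zero (s * t)) hε0 (hμ s) (hμ t) (hμ (s * t))
      (P.β_symm s t ▸ S.Z_comm t s) h
  have hμsq : ∀ t, μ t * μ t = 1 := fun t => by
    have h1 := hinvol (S.Z t)
    rw [hμ, map_smul, hμ, smul_smul] at h1
    exact smul_left_injective F (S.Z_ne_zero t) (h1.trans (one_smul F _).symm)
  have hμ1 : μ 1 = 1 := by
    have h1 := hμmul 1 1
    rw [mul_one, hμsq, map_one, Units.val_one, one_mul] at h1
    exact h1
  have hη1 : S.eta 1 = 1 := by
    have h1 := S.eta_mul 1 1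
    rw [mul_one, map_one, Units.val_one, mul_one] at h1
    rcases S.eta_eq 1 with h | h
    · exact h
    · rw [h] at h1 ⊢
      linear_combination h1
  have hμf : μ P.f = -1 := by
    obtain ⟨t, rfl, x, hx⟩ := S.exists_of_mem_grading hcg hc0
    have hx0 : x ≠ 0 := by
      rintro rfl
      rw [zero_smul] at hx
      exact hc0 hx
    have ht : t = P.f := by
      refine ((P.mem_rad t).1 fun s => Units.ext ?_).resolve_left ?_
      · have h1 := hcc (S.Z s)
        rw [hx, smul_mul_assoc, mul_smul_comm, S.Z_comm t s, smul_smul] at h1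
        have h2 := smul_left_injective F ((S.Z_isUnit s).mul (S.Z_isUnit t)).ne_zero h1
        rw [Units.val_one]
        exact mul_left_cancel₀ hx0 (h2.trans (mul_one x).symm)
      · rintro rfl
        exact hg rfl
    subst ht
    have h1 : x • (μ P.f • S.Z P.f) = x • ((-1 : F) • S.Z P.f) := by
      rw [← hμ, ← map_smul, ← hx, hφ₀c, hx, smul_smul, mul_neg_one, neg_smul]
    exact smul_left_injective F (S.Z_ne_zero _) (smul_right_injective _ hx0 h1)
  obtain ⟨u, hu⟩ : ∃ u : P.T, ∀ t, μ t * S.eta t = P.β u t := by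
    refine P.exists_eq_β hF (by rw [hμ1, hη1, one_mul]) (fun s t => ?_) (by
      rw [hμf, S.eta_f]
      ring)
    rw [hμmul, S.eta_mul]
    have : (P.β s t : F) * (P.β s t : F) = 1 := by
      rw [← Units.val_mul, P.β_sq, Units.val_one]
    linear_combination (μ s * μ t * S.eta s * S.eta t) * this
  -- Replacing `u` by `u * f` keeps the character `β(u, ·)` and reverses the sign of `eta u`, so `ν`
  -- can always be compensated.
  obtain ⟨u, hu, huν⟩ : ∃ u : P.T, (∀ t, μ t * S.eta t = P.β u t) ∧ S.eta u * ν = 1 := by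
    rcases S.eta_eq u with h | h <;> rcases hν with h' | h'
    · exact ⟨u, hu, by rw [h, h', one_mul]⟩
    · refine ⟨u * P.f, fun t => by rw [hu, P.β_mul_left, P.β_f, mul_one], ?_⟩
      rw [S.eta_mul, h, h', S.eta_f, P.β_f', Units.val_one]
      ring
    · refine ⟨u * P.f, fun t => by rw [hu, P.β_mul_left, P.β_f, mul_one], ?_⟩
      rw [S.eta_mul, h, h', S.eta_f, P.β_f', Units.val_one]
      ring
    · refine ⟨u, hu, ?_⟩
      rw [h, h']
      ring
  have hconj : ∀ d, S.Z u * φ₀ d = S.phi0 d * S.Z u := fun d => by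
    have h : d ∈ Submodule.span F (Set.range S.Z) := by
      rw [S.span_Z hF]
      trivial
    induction h using Submodule.span_induction with
    | mem x hx =>
      obtain ⟨t, rfl⟩ := hx
      rw [hμ, phi0_Z_eta, mul_smul_comm, smul_mul_assoc, S.Z_comm u t, smul_smul, ← hu t]
      congr 1
      linear_combination S.eta t * hμsq t
    | zero => simp
    | add x y _ _ hx hy => rw [map_add, map_add, mul_add, add_mul, hx, hy]
    | smul a x _ hx => rw [map_smul, map_smul, mul_smul_comm, smul_mul_assoc, hx]
  have hdu : IsUnit (Matrix.diagonal fun _ : ι => S.Z u) := (S.Z_isUnit u).map (Matrix.scalar ι)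
  refine ⟨GSharp.mk (u : G) 0 * g₀, (Matrix.diagonal fun _ => S.Z u) * Φ,
    ⟨fun p q => ?_, fun p q => ?_, hdu.mul hΦ⟩, fun Y => ?_⟩
  · rw [Matrix.diagonal_mul]
    refine IsAlgGrading.mem_congr
      (hD.division.grading.mul_mem _ _ _ (S.Z_mem u) _ (hΦmem p q)) ?_
    simp only [mul_assoc]
  · rw [Matrix.diagonal_mul, Matrix.diagonal_mul, phi0_mul, phi0_Z_eta, mul_smul_comm, ← hconj,
      hherm, mul_smul_comm, smul_smul, ← mul_assoc, huν, one_mul]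
  · rw [hadj, superAdj_conj_left (S.Z_isUnit u) hconj _ hΦ]

end StdRealization

end Comparison

/-! ### The exchange superinvolution -/

section Exchange

variable {F : Type u} [Field F] {m n : ℕ}

theorem SuperMat.par_eq_of_mem {i : ZMod 2} {X : SuperMat F m n} (hX : X ∈ SuperMat.parity F m n i)
    {a b : Fin m ⊕ Fin n} (h : X a b ≠ 0) : blockPar m n a + blockPar m n b = i := by
  by_contra h'
  exact h (hX a b h')

namespace MxMsop

/-- The exchange superinvolution as a linear map. -/
noncomputable def exchangeLin (F : Type u) [Field F] (m n : ℕ) : MxMsop F m n →ₗ[F] MxMsop F m n where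
  toFun := exchange F m n
  map_add' _ _ := rfl
  map_smul' _ _ := rfl

omit [Field F] in
theorem ext_val {X Y : MxMsop F m n} (h1 : ∀ a b, X.1 a b = Y.1 a b)
    (h2 : ∀ a b, X.2.val a b = Y.2.val a b) : X = Y :=
  Prod.ext (Matrix.ext h1) (SuperMatOp.ext' h2)

theorem exchange_mul {i j : ZMod 2} {X Y : MxMsop F m n} (hX : X ∈ MxMsop.parity F m n i)
    (hY : Y ∈ MxMsop.parity F m n j) :
    exchange F m n (X * Y) = parSign F (i * j) • (exchange F m n Y * exchange F m n X) := by
  refine ext_val (fun a b => ?_) fun a b => ?_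
  · change (X.2 * Y.2).val a b = parSign F (i * j) * (Y.2.val * X.2.val : SuperMat F m n) a b
    rw [SuperMatOp.mul_val, Matrix.mul_apply, Finset.mul_sum]
    refine Finset.sum_congr rfl fun k _ => ?_
    by_cases h1 : Y.2.val a k = 0
    · rw [h1]
      ring
    by_cases h2 : X.2.val k b = 0
    · rw [h2]
      ring
    rw [SuperMat.par_eq_of_mem hX.2 h2, SuperMat.par_eq_of_mem hY.2 h1, mul_comm i j]
  · change (X.1 * Y.1 : SuperMat F m n) a b =
      parSign F (i * j) * (SuperMatOp.of Y.1 * SuperMatOp.of X.1).val a b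
    rw [SuperMatOp.mul_val, Matrix.mul_apply, Finset.mul_sum]
    refine Finset.sum_congr rfl fun k _ => ?_
    change X.1 a k * Y.1 k b = parSign F (i * j) *
      (parSign F ((blockPar m n a + blockPar m n k) * (blockPar m n k + blockPar m n b)) *
        (X.1 a k * Y.1 k b))
    by_cases h1 : X.1 a k = 0
    · rw [h1]
      ring
    by_cases h2 : Y.1 k b = 0
    · rw [h2]
      ring
    rw [SuperMat.par_eq_of_mem hX.1 h1, SuperMat.par_eq_of_mem hY.1 h2, ← mul_assoc,
      parSign_mul_self, one_mul]

theorem exchange_mem {i : ZMod 2} {X : MxMsop F m n} (hX : X ∈ MxMsop.parity F m n i) :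
    exchange F m n X ∈ MxMsop.parity F m n i :=
  ⟨hX.2, hX.1⟩

theorem isSuperinvolution_exchange {G : Type v} [CommGroup G] {Γ : G → Submodule F (MxMsop F m n)}
    (hΓ : IsSuperinvGrading (MxMsop.parity F m n) (MxMsop.exchange F m n) Γ) :
    IsSuperinvolution (sharpGrading (MxMsop.parity F m n) Γ) (exchangeLin F m n) where
  iSup_eq := by
    rw [eq_top_iff, ← hΓ.grading.iSup_eq]
    refine iSup_le fun g => ?_
    rw [hΓ.superspace g]
    exact sup_le (le_iSup (sharpGrading (MxMsop.parity F m n) Γ) (GSharp.mk g 0))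
      (le_iSup (sharpGrading (MxMsop.parity F m n) Γ) (GSharp.mk g 1))
  map_mem g r hr := ⟨hΓ.map_mem _ _ hr.1, exchange_mem hr.2⟩
  antimul _ _ _ hr _ hs := exchange_mul hr.2 hs.2
  invol _ := rfl

theorem mul_single_val (Z : SuperMatOp F m n) (i j a b : Fin m ⊕ Fin n) :
    (Z * SuperMatOp.of (Matrix.single i j (1 : F))).val a b =
      if i = a then parSign F ((blockPar m n i + blockPar m n j) * (blockPar m n j + blockPar m n b)) *
        Z.val j b else 0 := by
  rw [SuperMatOp.mul_val, Finset.sum_eq_single j]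
  · change _ * (Matrix.single i j (1 : F) a j * _) = _
    rw [Matrix.single_apply]
    split_ifs with h h' h'
    · rw [h', one_mul]
    · exact absurd h.1 h'
    · exact absurd ⟨h', rfl⟩ h
    · rw [zero_mul, mul_zero]
  · intro k _ hk
    change _ * (Matrix.single i j (1 : F) a k * _) = _
    rw [Matrix.single_apply, if_neg fun h => hk h.2.symm, zero_mul, mul_zero]
  · simp

theorem single_mul_val (Z : SuperMatOp F m n) (i j a b : Fin m ⊕ Fin n) :
    (SuperMatOp.of (Matrix.single i j (1 : F)) * Z).val a b =
      if j = b then parSign F ((blockPar m n a + blockPar m n i) * (blockPar m n i + blockPar m n j)) *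
        Z.val a i else 0 := by
  rw [SuperMatOp.mul_val, Finset.sum_eq_single i]
  · change _ * (_ * Matrix.single i j (1 : F) i b) = _
    rw [Matrix.single_apply]
    split_ifs with h h' h'
    · rw [h', mul_one]
    · exact absurd h.2 h'
    · exact absurd ⟨rfl, h'⟩ h
    · rw [mul_zero, mul_zero]
  · intro k _ hk
    change _ * (_ * Matrix.single i j (1 : F) k b) = _
    rw [Matrix.single_apply, if_neg fun h => hk h.1.symm, mul_zero, mul_zero]
  · simp

/-- The centre is `F × F`, and the exchange negates `(1, -1)`. -/
theorem hasExchangeCenter [Nonempty (Fin m ⊕ Fin n)] (hF : (2 : F) ≠ 0) :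
    HasExchangeCenter (exchangeLin F m n) := by
  obtain ⟨i₀⟩ := id ‹Nonempty (Fin m ⊕ Fin n)›
  refine ⟨⟨((1 : SuperMat F m n), (-1 : SuperMatOp F m n)), fun r => ?_, fun h => ?_, ?_,
    fun z hz => ?_⟩⟩
  · refine Prod.ext ?_ ?_
    · change 1 * r.1 = r.1 * 1
      rw [one_mul, mul_one]
    · change -1 * r.2 = r.2 * -1
      rw [neg_one_mul, mul_neg_one]
  · have h1 : (1 : SuperMat F m n) i₀ i₀ = 0 := congrFun (congrFun (congrArg Prod.fst h) i₀) i₀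
    rw [Matrix.one_apply_eq] at h1
    exact one_ne_zero h1
  · refine ext_val (fun a b => rfl) fun a b => ?_
    change (1 : SuperMat F m n) a b = -(-(1 : SuperMat F m n) a b)
    rw [neg_neg]
  · have h1 : ∀ Z : SuperMat F m n, z.1 * Z = Z * z.1 := fun Z =>
      congrArg Prod.fst (hz (Z, 0))
    have h2 : ∀ Z : SuperMatOp F m n, z.2 * Z = Z * z.2 := fun Z =>
      congrArg Prod.snd (hz (0, Z))
    obtain ⟨x, -, hx⟩ := exists_central_of_commute h1
    have h3 : ∀ a b, a ≠ b → z.2.val a b = 0 := fun a b hab => by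
      have := congrArg (fun Z : SuperMatOp F m n => Z.val a b)
        (h2 (SuperMatOp.of (Matrix.single a a 1)))
      rw [mul_single_val, single_mul_val, if_pos rfl, if_neg hab] at this
      exact (mul_eq_zero.1 this).resolve_left (parSign_ne_zero _)
    have h4 : ∀ a, z.2.val a a = z.2.val i₀ i₀ := fun a => by
      have := congrArg (fun Z : SuperMatOp F m n => Z.val i₀ a)
        (h2 (SuperMatOp.of (Matrix.single i₀ a 1)))
      rw [mul_single_val, single_mul_val, if_pos rfl, if_pos rfl, ZMod.two_add_self, mul_zero,
        ZMod.two_add_self, zero_mul, parSign_zero, one_mul, one_mul] at this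
      exact this
    set y := z.2.val i₀ i₀
    refine ⟨(x + y) / 2, (x - y) / 2, ext_val (fun a b => ?_) fun a b => ?_⟩
    · change z.1 a b = (x + y) / 2 * (1 : SuperMat F m n) a b + (x - y) / 2 *
        (1 : SuperMat F m n) a b
      rw [hx, Matrix.diagonal_apply, Matrix.one_apply]
      split_ifs
      · field_simp
        ring
      · ring
    · change z.2.val a b = (x + y) / 2 * (1 : SuperMat F m n) a b + (x - y) / 2 *
        -(1 : SuperMat F m n) a b
      rw [Matrix.one_apply]
      split_ifs with hab
      · rw [← hab, h4]
        field_simp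
        ring
      · rw [h3 a b hab]
        ring

end MxMsop

end Exchange

/-! ### Transport of the structure along algebra isomorphisms. -/

section Transport

variable {F : Type u} [Field F]

theorem endGrading_iSupIndep {D : Type*} [Ring D] [Algebra F D] {H : Type*} [Group H] {ι : Type*}
    {𝒟 : H → Submodule F D} (h𝒟 : iSupIndep 𝒟) (γ : ι → H) : iSupIndep (endGrading 𝒟 γ) := by
  intro g
  rw [Submodule.disjoint_def]
  intro X hX hX'
  ext i j
  have h1 : (⨆ (h) (_ : h ≠ g), endGrading 𝒟 γ h).map (Matrix.entryLinearMap F D i j) ≤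
      ⨆ (h) (_ : h ≠ (γ i)⁻¹ * g * γ j), 𝒟 h := by
    simp only [Submodule.map_iSup]
    refine iSup₂_le fun h hh => ?_
    rintro _ ⟨Y, hY, rfl⟩
    refine Submodule.mem_iSup_of_mem ((γ i)⁻¹ * h * γ j) (Submodule.mem_iSup_of_mem ?_ (hY i j))
    exact fun e => hh (mul_left_cancel (mul_right_cancel e))
  exact (Submodule.disjoint_def.1 (h𝒟 ((γ i)⁻¹ * g * γ j))) _ (hX i j) (h1 ⟨X, hX', rfl⟩)

variable {G : Type v} [CommGroup G] {R R' : Type*} [Ring R] [Algebra F R] [Ring R'] [Algebra F R']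

/-- Transport of a linear map along an algebra isomorphism. -/
def conjLin (ψ : R ≃ₐ[F] R') (φ : R →ₗ[F] R) : R' →ₗ[F] R' :=
  ψ.toLinearMap ∘ₗ φ ∘ₗ ψ.symm.toLinearMap

theorem conjLin_apply (ψ : R ≃ₐ[F] R') (φ : R →ₗ[F] R) (r : R') :
    conjLin ψ φ r = ψ (φ (ψ.symm r)) := rfl

omit [CommGroup G] in
theorem IsSuperinvolution.conj {𝒜 : GSharp G → Submodule F R} {𝒜' : GSharp G → Submodule F R'}
    {φ : R →ₗ[F] R} (hφ : IsSuperinvolution 𝒜 φ) (ψ : R ≃ₐ[F] R')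
    (hψ : ∀ g, (𝒜 g).map (ψ : R →ₗ[F] R') = 𝒜' g) : IsSuperinvolution 𝒜' (conjLin ψ φ) where
  iSup_eq := by
    simp only [← hψ]
    rw [← Submodule.map_iSup, hφ.iSup_eq, Submodule.map_top, LinearMap.range_eq_top]
    exact ψ.surjective
  map_mem h r hr := by
    rw [← hψ] at hr ⊢
    obtain ⟨s, hs, rfl⟩ := hr
    refine ⟨φ s, hφ.map_mem _ _ hs, ?_⟩
    change ψ (φ s) = ψ (φ (ψ.symm (ψ s)))
    rw [ψ.symm_apply_apply]
  antimul g h r hr s hs := by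
    rw [← hψ] at hr hs
    obtain ⟨r, hr, rfl⟩ := hr
    obtain ⟨s, hs, rfl⟩ := hs
    change ψ (φ (ψ.symm (ψ r * ψ s))) =
      parSign F (g.par * h.par) • (ψ (φ (ψ.symm (ψ s))) * ψ (φ (ψ.symm (ψ r))))
    rw [← map_mul, ψ.symm_apply_apply, ψ.symm_apply_apply, ψ.symm_apply_apply,
      hφ.antimul g h r hr s hs, map_smul, map_mul]
  invol r := by
    rw [conjLin_apply, conjLin_apply, ψ.symm_apply_apply, hφ.invol, ψ.apply_symm_apply]

theorem HasExchangeCenter.conj {φ : R →ₗ[F] R} (hφ : HasExchangeCenter φ) (ψ : R ≃ₐ[F] R') :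
    HasExchangeCenter (conjLin ψ φ) := by
  obtain ⟨c, hc, hc0, hφc, hspan⟩ := hφ.exists_center
  refine ⟨⟨ψ c, fun r => ?_, ?_, ?_, fun z hz => ?_⟩⟩
  · rw [← ψ.apply_symm_apply r, ← map_mul, hc, map_mul]
  · rwa [Ne, EmbeddingLike.map_eq_zero_iff]
  · rw [conjLin_apply, ψ.symm_apply_apply, hφc, map_neg]
  · obtain ⟨a, b, h⟩ := hspan (ψ.symm z) fun r => by
      rw [← ψ.symm_apply_apply r, ← map_mul, hz, map_mul]
    refine ⟨a, b, ?_⟩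
    rw [← ψ.apply_symm_apply z, h, map_add, map_smul, map_smul, map_one]

end Transport

/-! ### Existence of a model for every even grading. -/

section Realization

variable {F : Type u} [Field F] [IsAlgClosed F] {G : Type v} [CommGroup G]

theorem exists_gradedEquiv_stdRealization (hF : (2 : F) ≠ 0) (C : ∀ P : ExPair F G, ExChoices P)
    {D : Type*} [Ring D] [Algebra F D] [FiniteDimensional F D] {𝒟 : GSharp G → Submodule F D}
    (h𝒟 : IsGradedDivision 𝒟) (heven : ∀ g : GSharp G, g.par ≠ 0 → 𝒟 g = ⊥) {ι : Type*} [Fintype ι]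
    [DecidableEq ι] [Nonempty ι] {γ : ι → GSharp G} {φ : Matrix ι ι D →ₗ[F] Matrix ι ι D}
    (hφ : IsSuperinvolution (endGrading 𝒟 γ) φ) (hc : HasExchangeCenter φ) :
    ∃ (P : ExPair F G) (ψ : D ≃ₐ[F] (C P).Alg), ∀ h, ∀ d ∈ 𝒟 h, ψ d ∈ (C P).grading h := by
  have hscalar : ∀ d ∈ 𝒟 1, ∃ c : F, d = c • (1 : D) := fun d hd => h𝒟.exists_eq_smul_one hd
  obtain ⟨g, c, hcg, hc0, hg, hcc, hφc, hcenter⟩ := hc.exists_homogeneous hF h𝒟 hscalar hφ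
  obtain ⟨φ₀, g₀, Φ, ν, hanti, hinvol, hmem, hΦ, -, -, -, hadj⟩ := hφ.exists_form h𝒟 heven hscalar
  rw [hadj] at hφc
  obtain ⟨P, Y, hY⟩ := h𝒟.exists_exPair hF heven hscalar hanti hinvol hmem hcg hc0 hg hcc
    (eq_neg_of_superAdj_diagonal hanti hinvol hΦ hcc hφc) hcenter
  exact ⟨P, (C P).exists_gradedEquiv hF h𝒟 hY⟩

theorem exists_model_of_isEvenGrading (hF : (2 : F) ≠ 0) (C : ∀ P : ExPair F G, ExChoices P)
    {R : Type u} [Ring R] [Algebra F R] [Nontrivial R] [FiniteDimensional F R]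
    {𝒜 : GSharp G → Submodule F R} {φ : R →ₗ[F] R} (hφ : IsSuperinvolution 𝒜 φ)
    (hc : HasExchangeCenter φ) (heven : IsEvenGrading 𝒜) :
    ∃ (P : ExPair F G) (κ : ZMod 2 → (G ⧸ P.T →₀ ℕ)) (g₀ : GSharp G),
      (C P).IsAdmissible κ g₀ ∧
      GradedSuperinvIso 𝒜 φ ((C P).modelGrading κ g₀) ((C P).modelInv κ g₀) := by
  obtain ⟨D, _, _, 𝒟, k, γ, ψ, h𝒟, hev, hψ⟩ := heven
  have hk : Nonempty (Fin k) := by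
    by_contra hk
    rw [not_nonempty_iff] at hk
    have := ψ.toEquiv.subsingleton
    exact not_subsingleton R this
  obtain ⟨i₀⟩ := id hk
  have hfin : FiniteDimensional F (Matrix (Fin k) (Fin k) D) :=
    Module.Finite.of_surjective ψ.toLinearMap ψ.surjective
  -- An entry map is surjective since `k > 0`, so finite dimension of `R` passes to `D`.
  have hfin' : FiniteDimensional F D :=
    Module.Finite.of_surjective (Matrix.entryLinearMap F D i₀ i₀) fun d =>
      ⟨Matrix.diagonal fun _ => d, Matrix.diagonal_apply_eq _ _⟩
  have hψ' := map_eq_of_iSupIndep hφ.iSup_eq (endGrading_iSupIndep h𝒟.grading.indep γ) ψ hψ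
  obtain ⟨P, θ, hθ⟩ := exists_gradedEquiv_stdRealization hF C h𝒟 hev (hφ.conj ψ hψ') (hc.conj ψ)
  -- The coefficients are replaced entrywise by the standard realization, while the degrees `γ` of
  -- the basis stay the same.
  let ψ₂ : R ≃ₐ[F] Matrix (Fin k) (Fin k) (C P).Alg := ψ.trans θ.mapMatrix
  have hψ₂ := map_eq_of_iSupIndep hφ.iSup_eq
    (endGrading_iSupIndep ((C P).isAlgGrading hF).indep γ) ψ₂ fun g r hr i j =>
      hθ _ _ (hψ g r hr i j)
  obtain ⟨g₀, Φ, hΦ, hadj⟩ := StdRealization.exists_isSuperHermitian hF (hφ.conj ψ₂ hψ₂)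
    (hc.conj ψ₂)
  obtain ⟨κ, hκ, hiso⟩ := (C P).exists_isAdmissible_gradedSuperinvIso hF hΦ
  refine ⟨P, κ, g₀, hκ, GradedSuperinvIso.trans ⟨ψ₂, hψ₂, fun r => ?_⟩ hiso⟩
  rw [← hadj, conjLin_apply, ψ₂.symm_apply_apply]

theorem MxMsop.exists_model (hF : (2 : F) ≠ 0) (C : ∀ P : ExPair F G, ExChoices P) (m n : ℕ)
    (Γ : G → Submodule F (MxMsop F m n))
    (hΓ : IsSuperinvGrading (MxMsop.parity F m n) (MxMsop.exchange F m n) Γ)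
    (hsimple : IsGradedSimple (sharpGrading (MxMsop.parity F m n) Γ))
    (heven : IsEvenGrading (sharpGrading (MxMsop.parity F m n) Γ)) :
    ∃ (P : ExPair F G) (κ : ZMod 2 → (G ⧸ P.T →₀ ℕ)) (g₀ : GSharp G),
      (C P).IsAdmissible κ g₀ ∧
      GradedSuperinvIso (sharpGrading (MxMsop.parity F m n) Γ) (MxMsop.exchange F m n)
        ((C P).modelGrading κ g₀) ((C P).modelInv κ g₀) := by
  -- A nonzero product excludes `m = n = 0`.
  obtain ⟨⟨a, b, hab⟩, -⟩ := hsimple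
  have hR : Nontrivial (MxMsop F m n) := ⟨⟨a * b, 0, hab⟩⟩
  have hne : Nonempty (Fin m ⊕ Fin n) := by
    by_contra h
    rw [not_nonempty_iff] at h
    exact hab (MxMsop.ext_val (fun i => h.elim i) fun i => h.elim i)
  have : FiniteDimensional F (SuperMatOp F m n) :=
    inferInstanceAs (FiniteDimensional F (SuperMat F m n))
  exact exists_model_of_isEvenGrading hF C (MxMsop.isSuperinvolution_exchange hΓ)
    (MxMsop.hasExchangeCenter hF) heven

end Realization

theorem mainTheorem8 {F : Type u} [Field F] [IsAlgClosed F] (hF : (2 : F) ≠ 0)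
    {G : Type v} [CommGroup G] (C : ∀ P : ExPair F G, ExChoices P) :
    (∀ (m n : ℕ) (Γ : G → Submodule F (MxMsop F m n)),
      IsSuperinvGrading (MxMsop.parity F m n) (MxMsop.exchange F m n) Γ →
      IsGradedSimple (sharpGrading (MxMsop.parity F m n) Γ) →
      IsEvenGrading (sharpGrading (MxMsop.parity F m n) Γ) →
      ∃ (P : ExPair F G) (κ : ZMod 2 → (G ⧸ P.T →₀ ℕ)) (g₀ : GSharp G),
        (C P).IsAdmissible κ g₀ ∧
        GradedSuperinvIso (sharpGrading (MxMsop.parity F m n) Γ) (MxMsop.exchange F m n)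
          ((C P).modelGrading κ g₀) ((C P).modelInv κ g₀)) ∧
    (∀ (P P' : ExPair F G) (κ : ZMod 2 → (G ⧸ P.T →₀ ℕ)) (κ' : ZMod 2 → (G ⧸ P'.T →₀ ℕ))
        (g₀ g₀' : GSharp G),
      (C P).IsAdmissible κ g₀ → (C P').IsAdmissible κ' g₀' →
      (GradedSuperinvIso ((C P).modelGrading κ g₀) ((C P).modelInv κ g₀)
          ((C P').modelGrading κ' g₀') ((C P').modelInv κ' g₀') ↔
        P.T = P'.T ∧
        (∀ (s t : G) (hs : s ∈ P.T) (ht : t ∈ P.T) (hs' : s ∈ P'.T) (ht' : t ∈ P'.T),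
          P.β ⟨s, hs⟩ ⟨t, ht⟩ = P'.β ⟨s, hs'⟩ ⟨t, ht'⟩) ∧
        ∃ g : G,
          ((∀ u : G, κ' 0 (QuotientGroup.mk (g * u)) = κ 0 (QuotientGroup.mk u)) ∧
            (∀ u : G, κ' 1 (QuotientGroup.mk (g * u)) = κ 1 (QuotientGroup.mk u)) ∧
            g₀' = GSharp.mk (g⁻¹ ^ 2) 0 * g₀) ∨
          ((∀ u : G, κ' 0 (QuotientGroup.mk (g * u)) = κ 1 (QuotientGroup.mk u)) ∧
            (∀ u : G, κ' 1 (QuotientGroup.mk (g * u)) = κ 0 (QuotientGroup.mk u)) ∧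
            g₀' = GSharp.mk ((P.f : G) * g⁻¹ ^ 2) 0 * g₀))) := by
  exact ⟨MxMsop.exists_model hF C, ExChoices.gradedSuperinvIso_model_iff hF C⟩
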